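/- **Setting.** Fix $m,c,k_B,T_0>0$ and a measurable state density $\phi\ge 0$ on $(0,\infty)$, not a.e. zero, such that $\int_{\mathbb R^3}\int_0^\infty |\mathbb P(p^0,\mathcal I)|\,e^{-C(1+\mathcal I/mc^2)p^0}\phi\,d\mathcal I\,dp<\infty$ for every $C>0$ and every polynomial $\mathbb P$. Write $p^0=\sqrt{(mc)^2+|p|^2}$, $p^\mu=(p^0,p)$, $\hat p=cp/p^0$, $\omega=1+\mathcal I/mc^2$, $a^\mu b_\mu=a^0b^0-\sum_{i=1}^3a^ib^i$, and $\langle h\rangle=\int_{\mathbb R^3}\int_0^\infty h\,\phi(\mathcal I)\,d\mathcal I\,dp$. For a distribution $F=F(p,\mathcal I)$ put $$n^2=\langle F\rangle^2-\sum_{i=1}^3\langle p^iF/p^0\rangle^2,\quad U^\mu=\tfrac cn\langle p^\mu F/p^0\rangle,\quad S=\langle (U^\mu p_\mu)^2F\omega/p^0\rangle,\quad e=\tfrac1cS,\quad q^\mu=c\langle p^\mu(U^\nu p_\nu)F\omega/p^0\rangle-\tfrac1cU^\mu S .$$ Let $Z(T)=\langle e^{-(mc^2+\mathcal I)\sqrt{1+|p|^2}/k_BT}\rangle$,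 $\widetilde e(T)=\langle\sqrt{1+|p|^2}\,e^{-(mc^2+\mathcal I)\sqrt{1+|p|^2}/k_BT}(mc^2+\mathcal I)\rangle/Z(T)$, and $$b(n,T)=\frac{nmc^2}{\gamma^2}\Big(\int_0^\infty\frac{K_2(\gamma\omega)}{\gamma\omega}\phi\,d\mathcal I\Big)^{-1}\int_0^\infty K_3(\gamma\omega)\phi\,d\mathcal I,\qquad \gamma=\frac{mc^2}{k_BT},\quad K_j(\gamma)=\int_0^\infty\cosh(jr)e^{-\gamma\cosh r}dr .$$ The temperature $T>0$ of $F$ is defined by $\widetilde e(T)=e/n$, and $$F_E=\frac{n}{(mc)^3Z(T)}\exp\Big\{-\frac{\omega}{k_BT}U^\mu p_\mu\Big\},\qquad M(F)=\Big(1-p^\mu q_\mu\frac{\omega}{b\,mc^2}\Big)F_E\quad(b=b(n,T)).$$ The model, with relaxation time $\tau>0$, is $$\partial_tF+\hat p\cdot\nabla_xF=\frac{U_\mu p^\mu}{c\tau p^0}\{M(F)-F\},\qquad F|_{t=0}=F_0. \tag{1}$$ Let $F_E^0=\frac1{(mc)^3Z(T_0)}e^{-\omega cp^0/k_BT_0}$,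 $b_0=b(1,T_0)$, $F=F_E^0+f\sqrt{F_E^0}$, and $$e_1=\sqrt{F_E^0},\quad e_{2,3,4}=\tfrac{1}{\sqrt{b_0m}}\,\omega\, p\sqrt{F_E^0},\quad e_5=\frac{cp^0\omega-\widetilde e(T_0)}{\sqrt{k_BT_0^2\,\widetilde e'(T_0)}}\sqrt{F_E^0},\quad P(f)=\sum_{i=1}^5\langle fe_i\rangle e_i .$$ Put $A=\langle f\sqrt{F_E^0}\rangle$, $w=\langle pf\sqrt{F_E^0}/p^0\rangle$, $\Psi_1=A^2-|w|^2$, $\Psi=2A+\Psi_1$, $\Phi=U_\mu p^\mu-cp^0$, $\Phi_1=\Phi+c\,w\cdot p$, $R=\frac{\Psi^3-3\Psi^2}{2(2+\Psi-\Psi^2+2\sqrt{1+\Psi})}$ ($U,S,q$ being those of $F$), and $$\Gamma_1=\Big(\frac{\Psi_1}2-\frac{\Psi^2}{2(2+\Psi+2\sqrt{1+\Psi})}\Big)\sqrt{F_E^0},$$ $$\Gamma_2=\frac{cp^0\omega-\widetilde e(T_0)}{k_BT_0^2\,\widetilde e'(T_0)}\sqrt{F_E^0}\Big\{\frac{1-A}{c}\Big\langle(2cp^0\Phi+\Phi^2)F\frac{\omega}{p^0}\Big\rangle-\frac1c\Big(\frac{\Psi_1}2+R\Big)S-cA\langle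 p^0f\sqrt{F_E^0}\,\omega\rangle\Big\},$$ $$\Gamma_3=-\frac{c\,\omega}{k_BT_0}\Big(\frac\Psi2+R\Big)w\cdot p\sqrt{F_E^0}+\frac{\omega}{b_0mc^2}\Gamma_3^*\cdot p\sqrt{F_E^0}-p^0q^0\frac{\omega}{b_0mc^2}\sqrt{F_E^0},$$ $$\Gamma_3^*=-c^2\sum_{i=1}^3w^i\Big\langle pp^if\sqrt{F_E^0}\frac{\omega}{p^0}\Big\rangle+c\Big\langle p\Phi_1F\frac\omega{p^0}\Big\rangle-w\Big\langle\Big\{c^2p^0f\sqrt{F_E^0}+\frac{2cp^0\Phi+\Phi^2}{p^0}F\Big\}\omega\Big\rangle+\Big(\frac\Psi2+R\Big)w\,S,$$ $$\Gamma_4=\frac1{\sqrt{F_E^0}}\int_0^1(1-\theta)\,y\,D^2\widetilde F(y_\theta)\,y^T\,d\theta .$$ Here $y=(n-1,U,\frac en-\widetilde e(T_0),q^\mu)\in\mathbb R^9$, $y_\theta=(1,0,\widetilde e(T_0),0)+\theta y$, and $\widetilde F(n,U,\eta,q^\mu)$ is, at fixed $(p,\mathcal I)$, the expression $M$ above regarded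 as a function of $n$, $U\in\mathbb R^3$, $\eta$, $q^\mu$, with $U^0=\sqrt{c^2+|U|^2}$ and $T=\widetilde e^{-1}(\eta)$. Finally let $$L(f)=P(f)-f,\qquad \Gamma(f)=\frac{U_\mu p^\mu}{cp^0}\sum_{i=1}^4\Gamma_i(f)+\frac{P(f)-f}{cp^0}\Phi .$$ For $N\ge3$ and $f$ defined for $t$ in a time interval starting at $0$, measurable, and $C^N$ in $(t,x,p)$ for each $\mathcal I>0$, let $E(f)(t)=\sum_{|\alpha|+|\beta|\le N}\int_{\mathbb R^3}\langle|\partial^\alpha_\beta f|^2\rangle\,dx$, where $\alpha$ counts $(t,x)$-derivatives and $\beta$ counts $p$-derivatives. **Proposition.** There is $\delta>0$, depending only on $m,c,k_B,T_0,\phi,N$, such that for every such $f$: 1. At every $t$ with $E(f)(t)<\delta$ and every $x$, all quantities above are well defined for $f(t,x,\cdot,\cdot)$ (the particle flux and the energy-momentum tensor of $F$ converge absolutely, $n,b,b_0,\widetilde e'(T_0)>0$, $\widetilde e(T)=e/n$ has exactly one solution $T>0$, $1+\Psi$ and $2+\Psi-\Psi^2+2\sqrt{1+\Psi}$ are positive,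 $\widetilde F$ is $C^2$ at each $y_\theta$, $0\le\theta\le1$), and for all $p\in\mathbb R^3$, $\mathcal I>0$, $$\Big(1-p^\mu q_\mu\frac{\omega}{b\,mc^2}\Big)F_E-F_E^0=\Big(P(f)+\sum_{i=1}^4\Gamma_i(f)\Big)\sqrt{F_E^0}.$$ 2. At every such $(t,x)$, all $p\in\mathbb R^3$, $\mathcal I>0$ and every $\tau>0$, the equation in (1) holds for $F$ if and only if $$\partial_tf+\hat p\cdot\nabla_xf=\frac1\tau\big(L(f)+\Gamma(f)\big). \tag{2}$$ 3. Hence, if $E(f)(t)<\delta$ on the whole time interval and $F_0=F_E^0+f_0\sqrt{F_E^0}$, then $F$ solves the Cauchy problem (1) with data $F_0$ if and only if $f$ solves (2) with $f|_{t=0}=f_0$. -/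

import Mathlib

namespace RelBGK

noncomputable section

open MeasureTheory Set

/-- Three-dimensional Euclidean space: the space of positions `x` and of momenta `p`. -/
abbrev V3 : Type := EuclideanSpace ℝ (Fin 3)

/-- The data of the model: particle mass `m`, light velocity `c`, Boltzmann constant `kB`,
temperature `T0` of the global equilibrium, and state density `φ` of the internal mode. -/
structure Gas where
  m : ℝ
  c : ℝ
  kB : ℝ
  T0 : ℝ
  φ : ℝ → ℝ

namespace Gas

variable (G : Gas)

/-- The factor `1 + 𝓘 / (m c²)`. -/
def wt (I : ℝ) : ℝ := 1 + I / (G.m * G.c ^ 2)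

/-- The energy component `p⁰ = √((mc)² + |p|²)`. -/
def p0 (p : V3) : ℝ := Real.sqrt ((G.m * G.c) ^ 2 + ‖p‖ ^ 2)

/-- The four-momentum `p^μ = (p⁰, p)`. -/
def fourP (p : V3) : Fin 4 → ℝ := Fin.cons (G.p0 p) (fun i => p i)

/-- The measure `φ(𝓘) d𝓘` on `(0, ∞)`. -/
def ρ : Measure ℝ :=
  (volume.restrict (Ioi 0)).withDensity (fun I => ENNReal.ofReal (G.φ I))

/-- The measure `φ(𝓘) d𝓘 dp` on `ℝ³ × (0, ∞)`. -/
def ν : Measure (V3 × ℝ) := (volume : Measure V3).prod G.ρ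

/-- `∫_{ℝ³} ∫_0^∞ h(p, 𝓘) φ(𝓘) d𝓘 dp`. -/
def mom (h : V3 → ℝ → ℝ) : ℝ := ∫ z, h z.1 z.2 ∂G.ν

/-- Standing assumptions: the physical constants are positive, the state density is measurable,
nonnegative, not almost everywhere zero, and all polynomials in `(p⁰, 𝓘)` are integrable against
`e^{-C (1 + 𝓘/(mc²)) p⁰} φ(𝓘) d𝓘 dp` for every `C > 0`. -/
structure Admissible : Prop where
  m_pos : 0 < G.m
  c_pos : 0 < G.c
  kB_pos : 0 < G.kB
  T0_pos : 0 < G.T0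
  φ_measurable : Measurable G.φ
  φ_nonneg : ∀ I, 0 < I → 0 ≤ G.φ I
  φ_ne_zero : ¬ (∀ᵐ I ∂(volume.restrict (Ioi (0 : ℝ))), G.φ I = 0)
  φ_moments : ∀ C : ℝ, 0 < C → ∀ P : MvPolynomial (Fin 2) ℝ,
    Integrable (fun z : V3 × ℝ =>
      MvPolynomial.eval ![G.p0 z.1, z.2] P * Real.exp (-C * G.wt z.2 * G.p0 z.1)) G.ν

end Gas

/-- The Minkowski product `a^μ b_μ` of signature `(1, -1, -1, -1)`. -/
def mink (a b : Fin 4 → ℝ) : ℝ := a 0 * b 0 - ∑ i : Fin 3, a i.succ * b i.succ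

/-- Modified Bessel function of the second kind. -/
def besselK (k : ℕ) (γ : ℝ) : ℝ :=
  ∫ r in Ioi (0 : ℝ), Real.cosh (k * r) * Real.exp (-γ * Real.cosh r)

namespace Gas

variable (G : Gas)

/-! ### Macroscopic fields of a distribution `F = F(p, 𝓘)` -/

/-- Number density. -/
def n (F : V3 → ℝ → ℝ) : ℝ :=
  Real.sqrt ((G.mom F) ^ 2 - ∑ i : Fin 3, (G.mom fun p I => p i * F p I / G.p0 p) ^ 2)

/-- Eckart four-velocity `U^μ`. -/
def U (F : V3 → ℝ → ℝ) (μ : Fin 4) : ℝ :=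
  G.c / G.n F * G.mom fun p I => G.fourP p μ * F p I / G.p0 p

/-- `∫∫ (U^μ p_μ)² F (1 + 𝓘/(mc²)) φ d𝓘 dp/p⁰`. -/
def S2 (F : V3 → ℝ → ℝ) : ℝ :=
  G.mom fun p I => (mink (G.U F) (G.fourP p)) ^ 2 * F p I * G.wt I / G.p0 p

/-- Energy. -/
def e (F : V3 → ℝ → ℝ) : ℝ := 1 / G.c * G.S2 F

/-- Heat flux `q^μ`. -/
def q (F : V3 → ℝ → ℝ) (μ : Fin 4) : ℝ :=
  G.c * (G.mom fun p I => G.fourP p μ * mink (G.U F) (G.fourP p) * F p I * G.wt I / G.p0 p)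
    - 1 / G.c * G.U F μ * G.S2 F

/-! ### Equilibrium -/

/-- `∫∫ e^{-(mc² + 𝓘) √(1+|p|²) / (kB T)} φ d𝓘 dp`. -/
def Z (T : ℝ) : ℝ :=
  G.mom fun p I =>
    Real.exp (-((G.m * G.c ^ 2 + I) * (1 / (G.kB * T)) * Real.sqrt (1 + ‖p‖ ^ 2)))

/-- The function `ẽ(T)`. -/
def eTilde (T : ℝ) : ℝ :=
  (G.mom fun p I => Real.sqrt (1 + ‖p‖ ^ 2)
      * Real.exp (-((G.m * G.c ^ 2 + I) * (1 / (G.kB * T)) * Real.sqrt (1 + ‖p‖ ^ 2)))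
      * (G.m * G.c ^ 2 + I)) / G.Z T

/-- The inverse of `ẽ : (0, ∞) → ℝ`; it gives the equilibrium temperature as a function
of `e / n`. -/
def temp (y : ℝ) : ℝ := Function.invFunOn G.eTilde (Ioi 0) y

/-- Relativistic chemical potential: the solution `g` of
`e^{-1 + m g / (kB T)} = n / ((mc)³ Z(T))`. -/
def chem (n T : ℝ) : ℝ :=
  G.kB * T / G.m * (1 + Real.log (n / ((G.m * G.c) ^ 3 * G.Z T)))

/-- The equilibrium distribution with parameters `g`, `U^μ`, `T`. -/
def FE (g : ℝ) (U : Fin 4 → ℝ) (T : ℝ) (p : V3) (I : ℝ) : ℝ :=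
  Real.exp (-1 + G.m / G.kB * (g / T) - G.wt I * (1 / (G.kB * T)) * mink U (G.fourP p))

/-- The quantity `b` as a function of `n` and `T`, with `γ = mc²/(kB T)` and
`γ* = γ (1 + 𝓘/(mc²))`. -/
def bCoef (n T : ℝ) : ℝ :=
  let γ : ℝ := G.m * G.c ^ 2 / (G.kB * T)
  n * G.m * G.c ^ 2 / γ ^ 2 * (∫ I, besselK 2 (γ * G.wt I) / (γ * G.wt I) ∂G.ρ)⁻¹
    * ∫ I, besselK 3 (γ * G.wt I) ∂G.ρ

/-- The modified equilibrium `(1 - p^μ q_μ (1 + 𝓘/(mc²)) / (b m c²)) F_E` with given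
density, four-velocity, temperature and heat flux. -/
def modEq (n : ℝ) (U : Fin 4 → ℝ) (T : ℝ) (q : Fin 4 → ℝ) (p : V3) (I : ℝ) : ℝ :=
  (1 - mink (G.fourP p) q * (G.wt I / (G.bCoef n T * G.m * G.c ^ 2)))
    * G.FE (G.chem n T) U T p I

/-- The equilibrium temperature of a distribution. -/
def tempOf (F : V3 → ℝ → ℝ) : ℝ := G.temp (G.e F / G.n F)

/-- The modified equilibrium of a distribution `F`. -/
def modEqOf (F : V3 → ℝ → ℝ) : V3 → ℝ → ℝ :=
  G.modEq (G.n F) (G.U F) (G.tempOf F) (G.q F)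

/-- The global equilibrium (number density `1`, velocity `0`, temperature `T0`). -/
def F0 (p : V3) (I : ℝ) : ℝ :=
  Real.exp (-1 + G.m / G.kB * (G.chem 1 G.T0 / G.T0)
    - G.wt I * (G.c * G.p0 p / (G.kB * G.T0)))

/-- `√F_E⁰`. -/
def sF0 (p : V3) (I : ℝ) : ℝ := Real.sqrt (G.F0 p I)

/-- `F = F_E⁰ + f √F_E⁰`. -/
def pert (f : V3 → ℝ → ℝ) (p : V3) (I : ℝ) : ℝ := G.F0 p I + f p I * G.sF0 p I

/-- `b₀`. -/
def b0 : ℝ := G.bCoef 1 G.T0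

/-! ### The projection -/

/-- `c p⁰ (1 + 𝓘/(mc²)) - ẽ(T0)`. -/
def enDev (p : V3) (I : ℝ) : ℝ := G.c * G.p0 p * G.wt I - G.eTilde G.T0

/-- `e₁`. -/
def e1 (p : V3) (I : ℝ) : ℝ := G.sF0 p I

/-- `e₂, e₃, e₄`. -/
def e234 (i : Fin 3) (p : V3) (I : ℝ) : ℝ :=
  Real.sqrt (1 / (G.b0 * G.m)) * G.wt I * p i * G.sF0 p I

/-- `e₅`. -/
def e5 (p : V3) (I : ℝ) : ℝ :=
  Real.sqrt (1 / (G.kB * G.T0 ^ 2 * deriv G.eTilde G.T0)) * G.enDev p I * G.sF0 p I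

/-- The inner product `⟨f, g⟩` of `L²(φ(𝓘) d𝓘 dp)`. -/
def ip (f g : V3 → ℝ → ℝ) : ℝ := G.mom fun p I => f p I * g p I

/-- `P(f) = ∑ ⟨f, e_i⟩ e_i`. -/
def P (f : V3 → ℝ → ℝ) (p : V3) (I : ℝ) : ℝ :=
  G.ip f G.e1 * G.e1 p I + ∑ i : Fin 3, G.ip f (G.e234 i) * G.e234 i p I
    + G.ip f G.e5 * G.e5 p I

/-! ### The nonlinear perturbations -/

/-- `∫∫ f √F_E⁰ φ d𝓘 dp`. -/
def a (f : V3 → ℝ → ℝ) : ℝ := G.mom fun p I => f p I * G.sF0 p I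

/-- `∫∫ pⁱ f √F_E⁰ φ d𝓘 dp/p⁰`. -/
def w (f : V3 → ℝ → ℝ) (i : Fin 3) : ℝ := G.mom fun p I => p i * f p I * G.sF0 p I / G.p0 p

def Ψ₁ (f : V3 → ℝ → ℝ) : ℝ := G.a f ^ 2 - ∑ i : Fin 3, G.w f i ^ 2

def Ψ (f : V3 → ℝ → ℝ) : ℝ := 2 * G.a f + G.a f ^ 2 - ∑ i : Fin 3, G.w f i ^ 2

def Φ (f : V3 → ℝ → ℝ) (p : V3) : ℝ :=
  mink (G.U (G.pert f)) (G.fourP p) - G.c * G.p0 p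

def Φ₁ (f : V3 → ℝ → ℝ) (p : V3) : ℝ :=
  mink (G.U (G.pert f)) (G.fourP p) - G.c * G.p0 p + G.c * ∑ i : Fin 3, p i * G.w f i

/-- The denominator `2 + Ψ - Ψ² + 2 √(1 + Ψ)`. -/
def den (f : V3 → ℝ → ℝ) : ℝ := 2 + G.Ψ f - G.Ψ f ^ 2 + 2 * Real.sqrt (1 + G.Ψ f)

/-- `(Ψ³ - 3 Ψ²) / (2 (2 + Ψ - Ψ² + 2 √(1 + Ψ)))`. -/
def R (f : V3 → ℝ → ℝ) : ℝ := (G.Ψ f ^ 3 - 3 * G.Ψ f ^ 2) / (2 * G.den f)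

def Γ₁ (f : V3 → ℝ → ℝ) (p : V3) (I : ℝ) : ℝ :=
  (G.Ψ₁ f / 2 - G.Ψ f ^ 2 / (2 * (2 + G.Ψ f + 2 * Real.sqrt (1 + G.Ψ f)))) * G.sF0 p I

def Γ₂ (f : V3 → ℝ → ℝ) (p : V3) (I : ℝ) : ℝ :=
  1 / deriv G.eTilde G.T0 * (1 / (G.kB * G.T0 ^ 2)) * G.enDev p I * G.sF0 p I
    * (1 / G.c * (1 - G.a f)
          * (G.mom fun p I =>
              (2 * G.c * G.p0 p * G.Φ f p + G.Φ f p ^ 2) * G.pert f p I * G.wt I / G.p0 p)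
        - 1 / G.c * (G.Ψ₁ f / 2 + G.R f) * G.S2 (G.pert f)
        - G.c * G.a f * G.mom fun p I => G.p0 p * f p I * G.sF0 p I * G.wt I)

/-- The components of the vector `Γ₃*(f)`. -/
def Γ₃star (f : V3 → ℝ → ℝ) (j : Fin 3) : ℝ :=
  -G.c ^ 2 * (∑ i : Fin 3, G.w f i
        * G.mom fun p I => p j * p i * f p I * G.sF0 p I * G.wt I / G.p0 p)
    + G.c * (G.mom fun p I => p j * G.Φ₁ f p * G.pert f p I * G.wt I / G.p0 p)
    - G.w f j * (G.mom fun p I =>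
        (G.c ^ 2 * G.p0 p * f p I * G.sF0 p I
          + 1 / G.p0 p * (2 * G.c * G.p0 p * G.Φ f p + G.Φ f p ^ 2) * G.pert f p I) * G.wt I)
    + (G.Ψ f / 2 + G.R f) * G.w f j * G.S2 (G.pert f)

def Γ₃ (f : V3 → ℝ → ℝ) (p : V3) (I : ℝ) : ℝ :=
  -G.c * (G.wt I / (G.kB * G.T0)) * (G.Ψ f / 2 + G.R f) * (∑ i : Fin 3, G.w f i * p i)
      * G.sF0 p I
    + G.wt I / (G.b0 * G.m * G.c ^ 2) * (∑ i : Fin 3, G.Γ₃star f i * p i) * G.sF0 p I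
    - G.p0 p * G.q (G.pert f) 0 * (G.wt I / (G.b0 * G.m * G.c ^ 2)) * G.sF0 p I

/-- The space of the nine variables `(n, U, e/n, q^μ)`. -/
abbrev Fields : Type := ℝ × V3 × ℝ × (Fin 4 → ℝ)

/-- `(√(c² + |U|²), U)`. -/
def fourU (U : V3) : Fin 4 → ℝ := Fin.cons (Real.sqrt (G.c ^ 2 + ‖U‖ ^ 2)) (fun i => U i)

/-- The modified equilibrium at fixed `(p, 𝓘)` as a function of `(n, U, e/n, q^μ)`. -/
def Ftilde (p : V3) (I : ℝ) (y : Fields) : ℝ :=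
  G.modEq y.1 (G.fourU y.2.1) (G.temp y.2.2.1) y.2.2.2 p I

/-- The fields `(n, U, e/n, q^μ)` of a distribution. -/
def fieldsOf (F : V3 → ℝ → ℝ) : Fields :=
  (G.n F, WithLp.toLp 2 (fun i : Fin 3 => G.U F i.succ), G.e F / G.n F, G.q F)

/-- The fields `(1, 0, ẽ(T0), 0)` of the global equilibrium. -/
def fields0 : Fields := (1, 0, G.eTilde G.T0, 0)

/-- The transitional fields `θ (n, U, e/n, q^μ) + (1 - θ) (1, 0, ẽ(T0), 0)`. -/
def fieldsθ (F : V3 → ℝ → ℝ) (θ : ℝ) : Fields :=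
  θ • G.fieldsOf F + (1 - θ) • G.fields0

/-- The second-order Taylor remainder; `D²` is the Hessian in the nine variables. -/
def Γ₄ (f : V3 → ℝ → ℝ) (p : V3) (I : ℝ) : ℝ :=
  1 / G.sF0 p I * ∫ θ in (0 : ℝ)..1, (1 - θ) *
    fderiv ℝ (fderiv ℝ (G.Ftilde p I)) (G.fieldsθ (G.pert f) θ)
      (G.fieldsOf (G.pert f) - G.fields0) (G.fieldsOf (G.pert f) - G.fields0)

/-- `∑_{i=1}^4 Γ_i(f)`. -/
def Γsum (f : V3 → ℝ → ℝ) (p : V3) (I : ℝ) : ℝ :=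
  G.Γ₁ f p I + G.Γ₂ f p I + G.Γ₃ f p I + G.Γ₄ f p I

/-- The linearized operator `L = P - I`. -/
def L (f : V3 → ℝ → ℝ) (p : V3) (I : ℝ) : ℝ := G.P f p I - f p I

/-- The nonlinear perturbation `Γ`. -/
def Γ (f : V3 → ℝ → ℝ) (p : V3) (I : ℝ) : ℝ :=
  mink (G.U (G.pert f)) (G.fourP p) / (G.c * G.p0 p) * G.Γsum f p I
    + (G.P f p I - f p I) / (G.c * G.p0 p) * G.Φ f p

/-- Everything that enters the linearization is well defined for the distribution
`F = F_E⁰ + f √F_E⁰`: the fluxes converge absolutely, `n` and `b` are positive, the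
temperature relation `ẽ(T) = e/n` has exactly one solution `T > 0`, `b₀` and the derivative of `ẽ` at `T0` are
positive, the denominators in the remainders do not vanish, and the modified equilibrium is `C²` in the nine fields along the
segment from the equilibrium fields to those of `F`. -/
structure WellDefined (f : V3 → ℝ → ℝ) : Prop where
  flux : ∀ μ, Integrable (fun z : V3 × ℝ =>
    G.fourP z.1 μ * G.pert f z.1 z.2 / G.p0 z.1) G.ν
  stress : ∀ μ κ, Integrable (fun z : V3 × ℝ =>
    G.fourP z.1 μ * G.fourP z.1 κ * G.pert f z.1 z.2 * G.wt z.2 / G.p0 z.1) G.ν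
  n_pos : 0 < G.n (G.pert f)
  temp_unique : ∃! T, 0 < T ∧ G.eTilde T = G.e (G.pert f) / G.n (G.pert f)
  b_pos : 0 < G.bCoef (G.n (G.pert f)) (G.tempOf (G.pert f))
  b0_pos : 0 < G.b0
  deriv_eTilde_pos : 0 < deriv G.eTilde G.T0
  Ψ_pos : 0 < 1 + G.Ψ f
  den_pos : 0 < G.den f
  smooth : ∀ p I, 0 < I → ∀ θ ∈ Icc (0 : ℝ) 1,
    ContDiffAt ℝ 2 (G.Ftilde p I) (G.fieldsθ (G.pert f) θ)

end Gas

/-! ### Space-time functions `f(t, x, p, 𝓘)`, their derivatives and the energy -/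

/-- Functions of `(t, x, p, 𝓘)`. -/
abbrev STFun : Type := ℝ → V3 → V3 → ℝ → ℝ

/-- `∂_t` on the time interval `S` (one-sided at an end point that belongs to `S`). -/
def dt (S : Set ℝ) (f : STFun) : STFun := fun t x p I => derivWithin (fun s => f s x p I) S t

/-- `∂_{xⁱ}`. -/
def dx (i : Fin 3) (f : STFun) : STFun := fun t x p I =>
  lineDeriv ℝ (fun y => f t y p I) x (EuclideanSpace.single i 1)

/-- `∂_{pⁱ}`. -/
def dp (i : Fin 3) (f : STFun) : STFun := fun t x p I =>
  lineDeriv ℝ (fun r => f t x r I) p (EuclideanSpace.single i 1)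

/-- `∂^α_β = ∂_t^{α₀} ∂_{x¹}^{α₁} ∂_{x²}^{α₂} ∂_{x³}^{α₃} ∂_{p¹}^{β₁} ∂_{p²}^{β₂} ∂_{p³}^{β₃}`. -/
def dmulti (S : Set ℝ) (α : Fin 4 → ℕ) (β : Fin 3 → ℕ) (f : STFun) : STFun :=
  (dt S)^[α 0] ((dx 0)^[α 1] ((dx 1)^[α 2] ((dx 2)^[α 3]
    ((dp 0)^[β 0] ((dp 1)^[β 1] ((dp 2)^[β 2] f))))))

/-- The pairs of multi-indices with `|α| + |β| ≤ N`. -/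
def multiIndices (N : ℕ) : Finset ((Fin 4 → ℕ) × (Fin 3 → ℕ)) :=
  ((Fintype.piFinset fun _ : Fin 4 => Finset.range (N + 1)) ×ˢ
    (Fintype.piFinset fun _ : Fin 3 => Finset.range (N + 1))).filter
      fun ab => ∑ i, ab.1 i + ∑ i, ab.2 i ≤ N

/-- A time interval (of finite or infinite length, with positive length) starting at `0`. -/
structure IsTimeInterval (S : Set ℝ) : Prop where
  ordConnected : S.OrdConnected
  zero_mem : (0 : ℝ) ∈ S
  nonneg : S ⊆ Ici 0
  nontrivial : S.Nontrivial

/-- A classical perturbation: measurable, and `N` times continuously differentiable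
in `(t, x, p)` for each `𝓘 > 0`. -/
structure IsClassical (N : ℕ) (S : Set ℝ) (f : STFun) : Prop where
  measurable : ∀ t ∈ S, Measurable fun z : V3 × V3 × ℝ => f t z.1 z.2.1 z.2.2
  contDiffOn : ∀ I, 0 < I →
    ContDiffOn ℝ N (fun z : ℝ × V3 × V3 => f z.1 z.2.1 z.2.2 I) (S ×ˢ univ)

namespace Gas

variable (G : Gas)

/-- The energy functional `E(f)(t) = ∑_{|α|+|β| ≤ N} ‖∂^α_β f(t)‖²` with the norm of
`L²(φ(𝓘) d𝓘 dp dx)`; the value `∞` is allowed. -/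
def energy (N : ℕ) (S : Set ℝ) (f : STFun) (t : ℝ) : ENNReal :=
  ∑ ab ∈ multiIndices N,
    ∫⁻ x : V3, ∫⁻ z : V3 × ℝ, ‖dmulti S ab.1 ab.2 f t x z.1 z.2‖ₑ ^ 2 ∂G.ν

/-- `F = F_E⁰ + f √F_E⁰` as a function of `(t, x, p, 𝓘)`. -/
def pertST (f : STFun) : STFun := fun t x => G.pert (f t x)

/-- The transport operator `∂_t f + p̂ · ∇_x f`, with `p̂ = c p / p⁰`. -/
def transport (S : Set ℝ) (f : STFun) : STFun := fun t x p I =>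
  dt S f t x p I + ∑ i : Fin 3, G.c * p i / G.p0 p * dx i f t x p I

/-- The relativistic BGK equation for `F` at a point `(t, x, p, 𝓘)`. -/
def BGKAt (τ : ℝ) (S : Set ℝ) (F : STFun) (t : ℝ) (x p : V3) (I : ℝ) : Prop :=
  G.transport S F t x p I =
    mink (G.U (F t x)) (G.fourP p) / (G.c * τ * G.p0 p) * (G.modEqOf (F t x) p I - F t x p I)

/-- The equation `∂_t f + p̂ · ∇_x f = (L(f) + Γ(f)) / τ` at a point `(t, x, p, 𝓘)`. -/
def LinAt (τ : ℝ) (S : Set ℝ) (f : STFun) (t : ℝ) (x p : V3) (I : ℝ) : Prop :=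
  G.transport S f t x p I = 1 / τ * (G.L (f t x) p I + G.Γ (f t x) p I)

/-- `F` solves the Cauchy problem for the relativistic BGK equation on `S` with data `Finit`. -/
def SolvesBGK (τ : ℝ) (S : Set ℝ) (F : STFun) (Finit : V3 → V3 → ℝ → ℝ) : Prop :=
  (∀ t ∈ S, ∀ x p I, 0 < I → G.BGKAt τ S F t x p I) ∧
    ∀ x p I, 0 < I → F 0 x p I = Finit x p I

/-- `f` solves the Cauchy problem for the equation with `L` and `Γ` on `S` with data `finit`. -/
def SolvesLin (τ : ℝ) (S : Set ℝ) (f : STFun) (finit : V3 → V3 → ℝ → ℝ) : Prop :=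
  (∀ t ∈ S, ∀ x p I, 0 < I → G.LinAt τ S f t x p I) ∧
    ∀ x p I, 0 < I → f 0 x p I = finit x p I

end Gas

end

end RelBGK

namespace RelBGK

noncomputable section

open MeasureTheory Set ProbabilityTheory

/-! ### Sobolev embedding in the space variable -/

/-! Everything reduces to one fact: at each point `x` the function `f(t,x,·,·)` is small in `L²(φ d𝓘
dp)`. This follows from a Sobolev embedding in `x`. The one-dimensional bound of `u(x)²` by
integrals of `u²` and `u'²`, used in the three coordinate directions, involves only derivatives of
order at most one in each coordinate. These occur in `E(f)` because `N ≥ 3`, and the constant is 64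
(`lintegral_enorm_sq_le_energy`).

Every weight in the particle flux and the energy-momentum tensor, times `√F_E⁰`, is square
integrable. By Cauchy–Schwarz these moments of `F` are close to those of `F_E⁰`, hence so are `n`,
`U` and `e/n`. With `X` the particle energy in rescaled momentum, `Z` is the moment generating
function of `X` at `-1/(kB T)` and `ẽ` is the derivative of its logarithm. So `ẽ'` is a positive
multiple of a variance, and `ẽ` has a smooth inverse. The modified equilibrium is then `C²` in the
nine fields along the whole segment from the equilibrium fields.

Taylor's formula on that segment yields `F_E⁰`, a first-order term and the remainder `Γ₄ √F_E⁰`. The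
first-order term is linear in `n - 1`, `U`, `e/n - ẽ(T0)` and `q`, which are themselves nonlinear in
`f`. Exact algebraic identities split it: density gives `e₁` and `Γ₁` (`n_sub_one`), energy gives
`e₅` and `Γ₂` (`energy_deviation`), velocity and heat flux together give `e₂, e₃, e₄` and `Γ₃`
(`momentum_deviation`). In the last identity the linear part of the velocity cancels against part of
the heat flux. This works because `b₀ m c = kB T0 (T^{ii} + T^{00})` for the equilibrium tensor
(`b0_eq`), which follows from writing `K₂` and `K₃` as radial integrals.

The two equations then differ by the factor `√F_E⁰`, which is positive and independent of `(t, x)`.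
-/

/-- For `s` in `[x, x+1]`, `u(x)² = u(s)² - ∫ 2uu'` and `2|uu'| ≤ u² + u'²`. Averaging over `s` adds
a second integral, whence the factor 2. -/
theorem sq_le_integral_sq_add_sq {u u' : ℝ → ℝ} (hu : ∀ s, HasDerivAt u (u' s) s)
    (hu' : Continuous u') (x : ℝ) :
    u x ^ 2 ≤ 2 * ∫ s in x..x + 1, (u s ^ 2 + u' s ^ 2) := by
  have hc : Continuous u := continuous_iff_continuousAt.2 fun s => (hu s).continuousAt
  have hint : ∀ a b, IntervalIntegrable (fun s => u s ^ 2 + u' s ^ 2) volume a b := fun a b =>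
    (by fun_prop : Continuous fun s => u s ^ 2 + u' s ^ 2).intervalIntegrable a b
  have key : ∀ s ∈ Icc x (x + 1),
      u x ^ 2 ≤ u s ^ 2 + ∫ r in x..x + 1, (u r ^ 2 + u' r ^ 2) := by
    intro s hs
    have h1 : ∫ r in x..s, 2 * u r * u' r = u s ^ 2 - u x ^ 2 := by
      refine intervalIntegral.integral_eq_sub_of_hasDerivAt (f := fun r => u r ^ 2) ?_
        ((by fun_prop : Continuous fun r => 2 * u r * u' r).intervalIntegrable _ _)
      intro r _
      have := (hu r).fun_pow 2
      simpa using this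
    have h2 : -(∫ r in x..s, 2 * u r * u' r) ≤ ∫ r in x..s, (u r ^ 2 + u' r ^ 2) := by
      rw [← intervalIntegral.integral_neg]
      refine intervalIntegral.integral_mono_on hs.1 ?_ (hint _ _) ?_
      · exact (by fun_prop : Continuous fun r => -(2 * u r * u' r)).intervalIntegrable _ _
      · intro r _
        nlinarith [sq_nonneg (u r + u' r)]
    have h3 : ∫ r in x..s, (u r ^ 2 + u' r ^ 2) ≤ ∫ r in x..x + 1, (u r ^ 2 + u' r ^ 2) := by
      refine intervalIntegral.integral_mono_interval le_rfl hs.1 hs.2 ?_ (hint _ _)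
      exact Filter.Eventually.of_forall fun r => by positivity
    linarith
  have h4 : ∫ _ in x..x + 1, u x ^ 2
      ≤ ∫ s in x..x + 1, (u s ^ 2 + ∫ r in x..x + 1, (u r ^ 2 + u' r ^ 2)) := by
    refine intervalIntegral.integral_mono_on (by linarith) (by simp) ?_ key
    exact (by fun_prop : Continuous fun s =>
      u s ^ 2 + ∫ r in x..x + 1, (u r ^ 2 + u' r ^ 2)).intervalIntegrable _ _
  rw [intervalIntegral.integral_add ((by fun_prop : Continuous fun s =>
    u s ^ 2).intervalIntegrable _ _) (by simp)] at h4
  have h5 : ∫ s in x..x + 1, u s ^ 2 ≤ ∫ r in x..x + 1, (u r ^ 2 + u' r ^ 2) := by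
    refine intervalIntegral.integral_mono_on (by linarith)
      ((by fun_prop : Continuous fun s => u s ^ 2).intervalIntegrable _ _) (hint _ _) ?_
    intro r _
    nlinarith [sq_nonneg (u' r)]
  simp at h4
  linarith

theorem enorm_sq_le_lintegral {u u' : ℝ → ℝ} (hu : ∀ s, HasDerivAt u (u' s) s)
    (hu' : Continuous u') (x : ℝ) :
    ‖u x‖ₑ ^ 2 ≤ ∫⁻ s, (2 * (‖u s‖ₑ ^ 2 + ‖u' s‖ₑ ^ 2)) := by
  have hc : Continuous u := continuous_iff_continuousAt.2 fun s => (hu s).continuousAt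
  have e : ∀ y : ℝ, ‖y‖ₑ ^ 2 = ENNReal.ofReal (y ^ 2) := fun y => by
    rw [← Real.enorm_of_nonneg (sq_nonneg y), enorm_pow]
  have h := sq_le_integral_sq_add_sq hu hu' x
  rw [e, ← intervalIntegral.integral_const_mul,
    intervalIntegral.integral_of_le (by linarith)] at *
  calc ENNReal.ofReal (u x ^ 2)
      ≤ ENNReal.ofReal (∫ s in Ioc x (x + 1), 2 * (u s ^ 2 + u' s ^ 2)) :=
        ENNReal.ofReal_le_ofReal h
    _ = ∫⁻ s in Ioc x (x + 1), ENNReal.ofReal (2 * (u s ^ 2 + u' s ^ 2)) := by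
        refine ofReal_integral_eq_lintegral_ofReal ?_ ?_
        · exact ((by fun_prop : Continuous fun s =>
            2 * (u s ^ 2 + u' s ^ 2)).integrableOn_Icc).mono_set Ioc_subset_Icc_self
        · exact Filter.Eventually.of_forall fun r => by positivity
    _ ≤ ∫⁻ s, ENNReal.ofReal (2 * (u s ^ 2 + u' s ^ 2)) := setLIntegral_le_lintegral _ _
    _ = _ := by
        congr 1; ext s
        rw [ENNReal.ofReal_mul (by norm_num), ENNReal.ofReal_add (sq_nonneg _) (sq_nonneg _), e, e]
        simp

/-- The partial derivative of a function of the space variable. -/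
def pderiv (i : Fin 3) (g : V3 → ℝ) (x : V3) : ℝ := lineDeriv ℝ g x (EuclideanSpace.single i 1)

theorem pderiv_eq_fderiv {g : V3 → ℝ} (hg : Differentiable ℝ g) (i : Fin 3) :
    pderiv i g = fun x => fderiv ℝ g x (EuclideanSpace.single i 1) := by
  ext x
  exact (hg x).lineDeriv_eq_fderiv

theorem ContDiff.pderiv {g : V3 → ℝ} {k : ℕ} (hg : ContDiff ℝ (k + 1 : ℕ) g) (i : Fin 3) :
    ContDiff ℝ k (pderiv i g) := by
  rw [pderiv_eq_fderiv (hg.differentiable (by simp))]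
  exact (hg.fderiv_right (m := k) (by simp)).clm_apply contDiff_const

/-- The square of a function, in coordinates. -/
def sqCoord (g : V3 → ℝ) (v : Fin 3 → ℝ) : ENNReal := ‖g (WithLp.toLp 2 v)‖ₑ ^ 2

theorem measurable_sqCoord {g : V3 → ℝ} (hg : Continuous g) : Measurable (sqCoord g) := by
  have h : Continuous fun v : Fin 3 → ℝ => g (WithLp.toLp 2 v) := by fun_prop
  exact (h.measurable.enorm).pow_const 2

/-- The one-dimensional bound on the line through `v` in direction `i`. The marginal integral lets
the coordinates be integrated out one at a time. -/
theorem sqCoord_le_lmarginal {g : V3 → ℝ} (hg : ContDiff ℝ 1 g) (i : Fin 3) :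
    sqCoord g ≤ lmarginal (fun _ => volume) {i}
      (fun v => 2 * (sqCoord g v + sqCoord (pderiv i g) v)) := by
  intro v
  rw [lmarginal_singleton]
  have hd : ∀ s, HasDerivAt (fun s : ℝ => g (WithLp.toLp 2 (Function.update v i s)))
      (pderiv i g (WithLp.toLp 2 (Function.update v i s))) s := by
    intro s
    have h1 : HasFDerivAt g (fderiv ℝ g (WithLp.toLp 2 (Function.update v i s)))
      (WithLp.toLp 2 (Function.update v i s)) :=
      (hg.differentiable (by simp) _).hasFDerivAt
    have h2 : HasDerivAt (fun s : ℝ => (WithLp.toLp 2 (Function.update v i s) : V3))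
        (EuclideanSpace.single i 1) s := by
      have := (PiLp.continuousLinearEquiv 2 ℝ (fun _ : Fin 3 => ℝ)).symm.hasFDerivAt.comp_hasDerivAt
        s (hasDerivAt_update v i s)
      exact this
    rw [pderiv_eq_fderiv (hg.differentiable (by simp))]
    exact h1.comp_hasDerivAt s h2
  have hc : Continuous fun s : ℝ => pderiv i g (WithLp.toLp 2 (Function.update v i s)) := by
    have : Continuous (pderiv i g) := (ContDiff.pderiv (k := 0) (by simpa using hg) i).continuous
    exact this.comp ((PiLp.continuous_toLp 2 _).comp (continuous_const.update i continuous_id))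
  have := enorm_sq_le_lintegral hd hc (v i)
  simpa [sqCoord] using this

theorem lmarginal_add_of_measurable {ι : Type*} [DecidableEq ι] (s : Finset ι)
    {f g : (ι → ℝ) → ENNReal} (hf : Measurable f) :
    lmarginal (fun _ => volume) s (fun v => f v + g v)
      = fun v => lmarginal (fun _ => volume) s f v + lmarginal (fun _ => volume) s g v := by
  ext v
  simp only [lmarginal]
  exact lintegral_add_left (hf.comp measurable_updateFinset) _

theorem lmarginal_const_mul {ι : Type*} [DecidableEq ι] (s : Finset ι) (c : ENNReal)
    {f : (ι → ℝ) → ENNReal} (hf : Measurable f) :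
    lmarginal (fun _ => volume) s (fun v => c * f v)
      = fun v => c * lmarginal (fun _ => volume) s f v := by
  ext v
  simp only [lmarginal]
  exact lintegral_const_mul _ (hf.comp measurable_updateFinset)

/-- One step of the iterated embedding. -/
theorem lmarginal_sqCoord_le {g : V3 → ℝ} (hg : ContDiff ℝ 1 g) (s : Finset (Fin 3)) {i : Fin 3}
    (hi : i ∉ s) :
    lmarginal (fun _ => volume) s (sqCoord g) ≤ fun v =>
      2 * (lmarginal (fun _ => volume) (insert i s) (sqCoord g) v
        + lmarginal (fun _ => volume) (insert i s) (sqCoord (pderiv i g)) v) := by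
  have hm := measurable_sqCoord hg.continuous
  have hm' := measurable_sqCoord
    (ContDiff.pderiv (k := 0) (by simpa using hg) i).continuous
  refine (lmarginal_mono (sqCoord_le_lmarginal hg i)).trans (le_of_eq ?_)
  have hadd : Measurable fun v => sqCoord g v + sqCoord (pderiv i g) v := hm.add hm'
  have hmul : Measurable fun v => 2 * (sqCoord g v + sqCoord (pderiv i g) v) := hadd.const_mul 2
  rw [← lmarginal_union (fun _ => volume) _ hmul
    (Finset.disjoint_singleton_right.2 hi), Finset.union_comm, ← Finset.insert_eq,
    lmarginal_const_mul _ _ hadd]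
  ext v
  simp only [lmarginal_add_of_measurable _ hm]

/-- The mixed derivative of order at most one in each direction. -/
def mixed (a : Fin 3 → ℕ) (g : V3 → ℝ) : V3 → ℝ :=
  (pderiv 0)^[a 0] ((pderiv 1)^[a 1] ((pderiv 2)^[a 2] g))

/-- Each of the three directions contributes a factor 2, hence `8 = 2³`, and leaves or
differentiates the function, hence eight derivatives. The highest one has order three. -/
theorem enorm_sq_le_sum_mixed {g : V3 → ℝ} (hg : ContDiff ℝ 3 g) (x : V3) :
    ‖g x‖ₑ ^ 2 ≤ ∑ a ∈ Fintype.piFinset fun _ : Fin 3 => Finset.range 2,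
      8 * ∫⁻ y : V3, ‖mixed a g y‖ₑ ^ 2 := by
  have hg3 : ContDiff ℝ (2 + 1 : ℕ) g := hg
  have h2 := ContDiff.pderiv hg3 2
  have h1 := ContDiff.pderiv (k := 1) (hg.of_le (by norm_num)) 1
  have h21 := ContDiff.pderiv (k := 1) h2 1
  have h0 := hg.of_le (m := 1) (by norm_num)
  have h20 := h2.of_le (m := 1) (by norm_num)
  have e : ∀ h : V3 → ℝ, ∀ v, lmarginal (fun _ => volume) Finset.univ (sqCoord h) v
      = ∫⁻ y : V3, ‖h y‖ₑ ^ 2 := by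
    intro h v
    rw [lmarginal_univ]
    have := (PiLp.volume_preserving_toLp (Fin 3)).lintegral_comp_emb
      (MeasurableEquiv.toLp 2 (Fin 3 → ℝ)).measurableEmbedding (fun y => ‖h y‖ₑ ^ 2)
    exact this
  have key : ∀ h : V3 → ℝ, sqCoord h = lmarginal (fun _ => volume) ∅ (sqCoord h) := fun h => by
    rw [lmarginal_empty]
  have hu : (insert 0 (insert 1 {2}) : Finset (Fin 3)) = Finset.univ := by decide
  have a2 := fun v => lmarginal_sqCoord_le h0 ∅ (i := 2) (by simp) v
  have a1 := fun v => lmarginal_sqCoord_le h0 {2} (i := 1) (by simp) v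
  have b1 := fun v => lmarginal_sqCoord_le h20 {2} (i := 1) (by simp) v
  have c1 := fun v => lmarginal_sqCoord_le h0 (insert 1 {2}) (i := 0) (by simp) v
  have c2 := fun v => lmarginal_sqCoord_le h1 (insert 1 {2}) (i := 0) (by simp) v
  have c3 := fun v => lmarginal_sqCoord_le h20 (insert 1 {2}) (i := 0) (by simp) v
  have c4 := fun v => lmarginal_sqCoord_le h21 (insert 1 {2}) (i := 0) (by simp) v
  simp only [hu, e, insert_empty_eq] at a2 a1 b1 c1 c2 c3 c4
  have hx : ‖g x‖ₑ ^ 2 = sqCoord g x.ofLp := rfl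
  rw [hx, key]
  refine (a2 _).trans ?_
  have hset : (Fintype.piFinset fun _ : Fin 3 => Finset.range 2)
      = {![0,0,0], ![1,0,0], ![0,1,0], ![1,1,0], ![0,0,1], ![1,0,1], ![0,1,1], ![1,1,1]} := by
    decide
  rw [hset]
  calc _ ≤ 2 * (2 * (2 * ((∫⁻ y : V3, ‖g y‖ₑ ^ 2) + ∫⁻ y : V3, ‖pderiv 0 g y‖ₑ ^ 2)
          + 2 * ((∫⁻ y : V3, ‖pderiv 1 g y‖ₑ ^ 2) + ∫⁻ y : V3, ‖pderiv 0 (pderiv 1 g) y‖ₑ ^ 2))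
        + 2 * (2 * ((∫⁻ y : V3, ‖pderiv 2 g y‖ₑ ^ 2) + ∫⁻ y : V3, ‖pderiv 0 (pderiv 2 g) y‖ₑ ^ 2)
          + 2 * ((∫⁻ y : V3, ‖pderiv 1 (pderiv 2 g) y‖ₑ ^ 2)
            + ∫⁻ y : V3, ‖pderiv 0 (pderiv 1 (pderiv 2 g)) y‖ₑ ^ 2))) := by
        refine mul_le_mul_right (add_le_add ((a1 _).trans ?_) ((b1 _).trans ?_)) _
        · exact mul_le_mul_right (add_le_add (c1 _) (c2 _)) _
        · exact mul_le_mul_right (add_le_add (c3 _) (c4 _)) _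
    _ = _ := by
        rw [Finset.sum_insert (by decide), Finset.sum_insert (by decide),
          Finset.sum_insert (by decide), Finset.sum_insert (by decide),
          Finset.sum_insert (by decide), Finset.sum_insert (by decide),
          Finset.sum_insert (by decide), Finset.sum_singleton]
        simp only [mixed, Matrix.cons_val, Function.iterate_zero, Function.iterate_one, id]
        ring

/-! ### Joint measurability of space derivatives -/

/-- Jointly measurable and of class `C^k` in the space variable. -/
structure RegularInSpace {Z : Type*} [MeasurableSpace Z] (k : ℕ) (F : V3 → Z → ℝ) : Prop where
  measurable : Measurable fun q : V3 × Z => F q.1 q.2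
  contDiff : ∀ z, ContDiff ℝ k fun y => F y z

/-- The derivative is the pointwise limit of difference quotients with step `1/(n+1)`, each jointly
measurable. Joint measurability is what Tonelli's theorem needs later. -/
theorem RegularInSpace.pderiv {Z : Type*} [MeasurableSpace Z] {k : ℕ} {F : V3 → Z → ℝ}
    (hF : RegularInSpace (k + 1) F) (i : Fin 3) :
    RegularInSpace k fun y z => RelBGK.pderiv i (fun y => F y z) y := by
  refine ⟨?_, fun z => ContDiff.pderiv (hF.contDiff z) i⟩
  have hlim : ∀ q : V3 × Z, Filter.Tendsto (fun n : ℕ => ((n : ℝ) + 1) *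
      (F (q.1 + (1 / ((n : ℝ) + 1)) • EuclideanSpace.single i 1) q.2 - F q.1 q.2)) Filter.atTop
      (nhds (RelBGK.pderiv i (fun y => F y q.2) q.1)) := by
    intro q
    have hd : Differentiable ℝ fun y => F y q.2 := (hF.contDiff q.2).differentiable (by simp)
    have h1 : HasLineDerivAt ℝ (fun y => F y q.2) (RelBGK.pderiv i (fun y => F y q.2) q.1) q.1
        (EuclideanSpace.single i 1) := (hd q.1).lineDifferentiableAt.hasLineDerivAt
    have h2 := h1.tendsto_slope_zero
    have h3 : Filter.Tendsto (fun n : ℕ => 1 / ((n : ℝ) + 1)) Filter.atTop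
        (nhdsWithin 0 {0}ᶜ) := by
      refine tendsto_nhdsWithin_iff.2 ⟨tendsto_one_div_add_atTop_nhds_zero_nat, ?_⟩
      refine Filter.Eventually.of_forall fun n => ?_
      have : (0 : ℝ) < 1 / ((n : ℝ) + 1) := by positivity
      exact this.ne'
    have h4 := h2.comp h3
    simpa [Function.comp_def] using h4
  refine measurable_of_tendsto_metrizable (fun n => ?_) (tendsto_pi_nhds.2 hlim)
  have hs : Measurable fun q : V3 × Z =>
      F (q.1 + (1 / ((n : ℝ) + 1)) • EuclideanSpace.single i 1) q.2 :=
    hF.measurable.comp (f := fun q : V3 × Z =>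
      (q.1 + (1 / ((n : ℝ) + 1)) • EuclideanSpace.single i 1, q.2)) (by fun_prop)
  exact (hs.sub hF.measurable).const_mul _

theorem RegularInSpace.iterate {Z : Type*} [MeasurableSpace Z] {k : ℕ} {F : V3 → Z → ℝ}
    (hF : RegularInSpace (k + 1) F) (i : Fin 3) {a : ℕ} (ha : a < 2) :
    RegularInSpace k fun y z => (RelBGK.pderiv i)^[a] (fun y => F y z) y := by
  interval_cases a
  · exact ⟨hF.measurable, fun z => (hF.contDiff z).of_le (by exact_mod_cast Nat.le_succ k)⟩
  · exact hF.pderiv i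

theorem RegularInSpace.measurable_mixed {Z : Type*} [MeasurableSpace Z] {F : V3 → Z → ℝ}
    (hF : RegularInSpace 3 F) {a : Fin 3 → ℕ} (ha : ∀ i, a i < 2) :
    Measurable fun q : V3 × Z => mixed a (fun y => F y q.2) q.1 :=
  (((hF.iterate 2 (ha 2)).iterate 1 (ha 1)).iterate 0 (ha 0)).measurable

theorem dx_iterate (i : Fin 3) (k : ℕ) (f : STFun) (t : ℝ) (p : V3) (I : ℝ) :
    (fun y => (dx i)^[k] f t y p I) = (pderiv i)^[k] fun y => f t y p I := by
  induction k with
  | zero => rfl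
  | succ k ih =>
    rw [Function.iterate_succ_apply', Function.iterate_succ_apply', ← ih]
    rfl

/-- The derivatives in the embedding are terms of the energy with no `t`- or `p`-derivative. -/
theorem dmulti_space (S : Set ℝ) (a : Fin 3 → ℕ) (f : STFun) (t : ℝ) (x p : V3) (I : ℝ) :
    dmulti S (Fin.cons 0 a) 0 f t x p I = mixed a (fun y => f t y p I) x := by
  have h : dmulti S (Fin.cons 0 a) 0 f = (dx 0)^[a 0] ((dx 1)^[a 1] ((dx 2)^[a 2] f)) := rfl
  rw [h, mixed, ← dx_iterate, ← dx_iterate, ← dx_iterate]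

/-! ### From the energy functional to square integrability at each point -/

namespace Gas

variable {G : Gas}

/-- Positivity and regularity are only available for `𝓘 > 0`; this makes them available almost
everywhere. -/
theorem ae_pos (G : Gas) : ∀ᵐ z ∂G.ν, 0 < z.2 := by
  have h1 : ∀ᵐ I ∂(volume.restrict (Ioi (0 : ℝ))), 0 < I :=
    ae_restrict_mem measurableSet_Ioi
  have h2 : ∀ᵐ I ∂G.ρ, 0 < I := (withDensity_absolutelyContinuous _ _).ae_le h1
  exact Measure.quasiMeasurePreserving_snd.ae h2

instance (G : Gas) : SFinite G.ρ := by unfold ρ; infer_instance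

instance (G : Gas) : SFinite G.ν := by unfold ν; infer_instance

/-- The embedding is applied at fixed `(p, 𝓘)`, integrated against `ν`, and the integrals are
exchanged. There are eight derivatives, each with constant 8. -/
theorem lintegral_enorm_sq_le_energy (G : Gas) {N : ℕ} (hN : 3 ≤ N) {S : Set ℝ} {f : STFun}
    (hf : IsClassical N S f) {t : ℝ} (ht : t ∈ S) (x : V3) :
    ∫⁻ z, ‖f t x z.1 z.2‖ₑ ^ 2 ∂G.ν ≤ 64 * G.energy N S f t := by
  -- Smoothness is known only for `𝓘 > 0`. Extension by zero makes it hold for all `z` and changes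
  -- nothing `ν`-almost everywhere.
  set F : V3 → V3 × ℝ → ℝ := fun y z => if 0 < z.2 then f t y z.1 z.2 else 0 with hFdef
  have hF : RegularInSpace 3 F := by
    refine ⟨?_, fun z => ?_⟩
    · exact Measurable.ite (measurableSet_lt measurable_const (by fun_prop))
        (hf.measurable t ht) measurable_const
    · by_cases hz : 0 < z.2
      · simp only [hFdef, hz, if_true]
        have h1 := (hf.contDiffOn z.2 hz).of_le (m := 3) (by exact_mod_cast hN)
        have h2 : ContDiff ℝ 3 fun y : V3 => ((t, y, z.1) : ℝ × V3 × V3) := by fun_prop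
        have h3 := h1.comp (s := univ) h2.contDiffOn (fun y _ => ⟨ht, mem_univ _⟩)
        exact contDiffOn_univ.1 h3
      · simp only [hFdef, hz, if_false]
        exact contDiff_const
  have hbound : ∀ a ∈ Fintype.piFinset (fun _ : Fin 3 => Finset.range 2),
      ∫⁻ z, ∫⁻ y, ‖mixed a (fun y => F y z) y‖ₑ ^ 2 ∂volume ∂G.ν ≤ G.energy N S f t := by
    intro a ha
    have ha' : ∀ i, a i < 2 := fun i => by simpa using Fintype.mem_piFinset.1 ha i
    have hm := hF.measurable_mixed ha'
    rw [lintegral_lintegral_swap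
      (((hm.comp measurable_swap).enorm.pow_const 2).aemeasurable)]
    have hmem : ((Fin.cons 0 a, 0) : (Fin 4 → ℕ) × (Fin 3 → ℕ)) ∈ multiIndices N := by
      have h0 := ha' 0
      have h1 := ha' 1
      have h2 := ha' 2
      refine Finset.mem_filter.2 ⟨Finset.mem_product.2 ⟨?_, ?_⟩, ?_⟩
      · refine Fintype.mem_piFinset.2 fun i => Finset.mem_range.2 ?_
        refine Fin.cases ?_ (fun j => ?_) i
        · simp
        · have := ha' j
          simp only [Fin.cons_succ]
          omega
      · exact Fintype.mem_piFinset.2 fun i => Finset.mem_range.2 (by simp)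
      · simp only [Fin.sum_univ_succ, Fin.cons_zero, Fin.cons_succ, Pi.zero_apply,
          Finset.sum_const_zero, Fin.succ_zero_eq_one, Fin.succ_one_eq_two]
        simp
        omega
    unfold energy
    refine le_trans (le_of_eq ?_) (Finset.single_le_sum (f := fun ab : (Fin 4 → ℕ) × (Fin 3 → ℕ) =>
      ∫⁻ x : V3, ∫⁻ z : V3 × ℝ, ‖dmulti S ab.1 ab.2 f t x z.1 z.2‖ₑ ^ 2 ∂G.ν)
      (fun _ _ => zero_le) hmem)
    refine lintegral_congr fun y => lintegral_congr_ae ?_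
    filter_upwards [G.ae_pos] with z hz
    simp only [dmulti_space, hFdef, hz, if_true]
  calc ∫⁻ z, ‖f t x z.1 z.2‖ₑ ^ 2 ∂G.ν = ∫⁻ z, ‖F x z‖ₑ ^ 2 ∂G.ν := by
        refine lintegral_congr_ae ?_
        filter_upwards [G.ae_pos] with z hz
        simp only [hFdef, hz, if_true]
    _ ≤ ∫⁻ z, (∑ a ∈ Fintype.piFinset fun _ : Fin 3 => Finset.range 2,
          8 * ∫⁻ y : V3, ‖mixed a (fun y => F y z) y‖ₑ ^ 2) ∂G.ν :=
        lintegral_mono fun z => enorm_sq_le_sum_mixed (hF.contDiff z) x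
    _ = ∑ a ∈ Fintype.piFinset fun _ : Fin 3 => Finset.range 2,
          8 * ∫⁻ z, (∫⁻ y : V3, ‖mixed a (fun y => F y z) y‖ₑ ^ 2) ∂G.ν := by
        have hmeas : ∀ a ∈ Fintype.piFinset (fun _ : Fin 3 => Finset.range 2),
            Measurable fun z => ∫⁻ y : V3, ‖mixed a (fun y => F y z) y‖ₑ ^ 2 := by
          intro a ha
          have ha' : ∀ i, a i < 2 := fun i => by simpa using Fintype.mem_piFinset.1 ha i
          exact ((hF.measurable_mixed ha').comp measurable_swap).enorm.pow_const 2
            |>.lintegral_prod_right'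
        rw [lintegral_finsetSum _ fun a ha => (hmeas a ha).const_mul 8]
        exact Finset.sum_congr rfl fun a ha => lintegral_const_mul _ (hmeas a ha)
    _ ≤ ∑ a ∈ Fintype.piFinset fun _ : Fin 3 => Finset.range 2, 8 * G.energy N S f t :=
        Finset.sum_le_sum fun a ha => mul_le_mul_right (hbound a ha) _
    _ = 64 * G.energy N S f t := by
        rw [Finset.sum_const, nsmul_eq_mul, ← mul_assoc]
        congr 1
        simp
        norm_num

/-! ### The particle energy and elementary bounds -/

/-- The energy `c p⁰ (1 + 𝓘/(mc²))`. -/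
def energyAt (G : Gas) (z : V3 × ℝ) : ℝ := G.c * G.p0 z.1 * G.wt z.2

/-- The energy in the rescaled momentum `p / (mc)`. -/
def energyUnit (G : Gas) (z : V3 × ℝ) : ℝ := (G.m * G.c ^ 2 + z.2) * Real.sqrt (1 + ‖z.1‖ ^ 2)

@[fun_prop]
theorem continuous_p0 (G : Gas) : Continuous G.p0 := by
  unfold p0; fun_prop

@[fun_prop]
theorem measurable_p0 (G : Gas) : Measurable G.p0 := G.continuous_p0.measurable

@[fun_prop]
theorem measurable_wt (G : Gas) : Measurable G.wt := by
  unfold wt; fun_prop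

@[fun_prop]
theorem measurable_energyAt (G : Gas) : Measurable G.energyAt := by
  unfold energyAt; fun_prop

@[fun_prop]
theorem measurable_energyUnit (G : Gas) : Measurable G.energyUnit := by
  unfold energyUnit; fun_prop

@[fun_prop]
theorem measurable_fourP (G : Gas) (μ : Fin 4) : Measurable fun p : V3 => G.fourP p μ := by
  refine Fin.cases ?_ (fun i => ?_) μ
  · simpa [fourP] using G.measurable_p0
  · simp only [fourP, Fin.cons_succ]; fun_prop

theorem Admissible.mc_pos (hG : G.Admissible) : 0 < G.m * G.c := mul_pos hG.m_pos hG.c_pos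

theorem Admissible.mc2_pos (hG : G.Admissible) : 0 < G.m * G.c ^ 2 :=
  mul_pos hG.m_pos (pow_pos hG.c_pos 2)

theorem Admissible.p0_pos (hG : G.Admissible) (p : V3) : 0 < G.p0 p :=
  Real.sqrt_pos.2 (by have := hG.mc_pos; positivity)

theorem norm_sq_eq_sum (p : V3) : ‖p‖ ^ 2 = ∑ i : Fin 3, p i ^ 2 := by
  rw [EuclideanSpace.norm_eq, Real.sq_sqrt (by positivity)]
  simp

theorem mc_le_p0 (G : Gas) (p : V3) : G.m * G.c ≤ G.p0 p :=
  Real.le_sqrt_of_sq_le (by nlinarith [sq_nonneg ‖p‖])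

theorem abs_fourP_le (G : Gas) (p : V3) (μ : Fin 4) : |G.fourP p μ| ≤ G.p0 p := by
  refine Fin.cases ?_ (fun i => ?_) μ
  · simp [fourP, p0, abs_of_nonneg (Real.sqrt_nonneg _)]
  · simp only [fourP, Fin.cons_succ, p0]
    refine Real.abs_le_sqrt ?_
    have : p i ^ 2 ≤ ‖p‖ ^ 2 := by
      rw [norm_sq_eq_sum]
      exact Finset.single_le_sum (f := fun i => p i ^ 2) (fun _ _ => sq_nonneg _)
        (Finset.mem_univ i)
    nlinarith [sq_nonneg (G.m * G.c)]

theorem Admissible.one_le_wt (hG : G.Admissible) {I : ℝ} (hI : 0 < I) : 1 ≤ G.wt I := by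
  have := div_pos hI hG.mc2_pos
  unfold wt; linarith

theorem Admissible.wt_pos (hG : G.Admissible) {I : ℝ} (hI : 0 < I) : 0 < G.wt I :=
  zero_lt_one.trans_le (hG.one_le_wt hI)

theorem Admissible.le_energyAt (hG : G.Admissible) {z : V3 × ℝ} (hz : 0 < z.2) :
    G.m * G.c ^ 2 ≤ G.energyAt z := by
  have h1 := hG.one_le_wt hz
  have h2 := G.mc_le_p0 z.1
  have h3 : G.c * (G.m * G.c) ≤ G.c * G.p0 z.1 := mul_le_mul_of_nonneg_left h2 hG.c_pos.le
  have h4 : 0 ≤ G.c * G.p0 z.1 := (mul_pos hG.c_pos (hG.p0_pos _)).le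
  unfold energyAt
  nlinarith

/-- The exponent of `F_E⁰` is written in `p`, those of `Z` and `ẽ` in `p/(mc)`; this relates the
two. -/
theorem Admissible.energyAt_smul (hG : G.Admissible) (z : V3 × ℝ) :
    G.energyAt ((G.m * G.c) • z.1, z.2) = G.energyUnit z := by
  have h := hG.mc_pos
  have h2 := hG.mc2_pos
  have : G.p0 ((G.m * G.c) • z.1) = G.m * G.c * Real.sqrt (1 + ‖z.1‖ ^ 2) := by
    unfold p0
    rw [norm_smul, Real.norm_of_nonneg h.le,
      show (G.m * G.c) ^ 2 + (G.m * G.c * ‖z.1‖) ^ 2 = (G.m * G.c) ^ 2 * (1 + ‖z.1‖ ^ 2) by ring,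
      Real.sqrt_mul (sq_nonneg _), Real.sqrt_sq h.le]
  have hm := hG.m_pos.ne'
  have hc := hG.c_pos.ne'
  simp only [energyAt, energyUnit, wt, this]
  field_simp

/-! ### Changes of variables in the momentum -/

theorem measurableEmbedding_smul_fst {a : ℝ} (ha : a ≠ 0) :
    MeasurableEmbedding fun z : V3 × ℝ => (a • z.1, z.2) :=
  ((MeasurableEquiv.smul₀ a ha).prodCongr (MeasurableEquiv.refl ℝ)).measurableEmbedding

theorem map_smul_ν (G : Gas) {a : ℝ} (ha : 0 < a) :
    G.ν.map (fun z : V3 × ℝ => (a • z.1, z.2)) = ENNReal.ofReal ((a ^ 3)⁻¹) • G.ν := by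
  have h := Measure.map_addHaar_smul (volume : Measure V3) ha.ne'
  have h2 := Measure.map_prod_map (volume : Measure V3) G.ρ
    (measurable_const_smul a : Measurable fun p : V3 => a • p) measurable_id
  rw [Measure.map_id, h, Measure.prod_smul_left] at h2
  rw [ν, show (fun z : V3 × ℝ => (a • z.1, z.2)) = Prod.map (fun p : V3 => a • p) id from rfl,
    ← h2]
  simp [abs_of_pos ha]

theorem integral_smul_fst (G : Gas) {a : ℝ} (ha : 0 < a) (g : V3 × ℝ → ℝ) :
    ∫ z, g (a • z.1, z.2) ∂G.ν = (a ^ 3)⁻¹ * ∫ z, g z ∂G.ν := by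
  rw [← (measurableEmbedding_smul_fst ha.ne').integral_map, G.map_smul_ν ha, integral_smul_measure,
    ENNReal.toReal_ofReal (by positivity), smul_eq_mul]

theorem integrable_smul_fst (G : Gas) {a : ℝ} (ha : 0 < a) (g : V3 × ℝ → ℝ) :
    Integrable (fun z => g (a • z.1, z.2)) G.ν ↔ Integrable g G.ν := by
  have h := (measurableEmbedding_smul_fst ha.ne').integrable_map_iff (μ := G.ν) (g := g)
  rw [G.map_smul_ν ha, integrable_smul_measure
    (by simp only [ne_eq, ENNReal.ofReal_eq_zero, not_le]; positivity) (by simp)] at h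
  exact h.symm

theorem measurePreserving_isometry (G : Gas) (A : V3 ≃ₗᵢ[ℝ] V3) :
    MeasurePreserving (fun z : V3 × ℝ => (A z.1, z.2)) G.ν G.ν :=
  A.measurePreserving.prod (MeasurePreserving.id G.ρ)

theorem integral_isometry (G : Gas) (A : V3 ≃ₗᵢ[ℝ] V3) (g : V3 × ℝ → ℝ) :
    ∫ z, g (A z.1, z.2) ∂G.ν = ∫ z, g z ∂G.ν :=
  (G.measurePreserving_isometry A).integral_comp
    ((A.toHomeomorph.toMeasurableEquiv.prodCongr (MeasurableEquiv.refl ℝ)).measurableEmbedding) g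

/-! ### Integrability -/

theorem Admissible.integrable_exp_energyAt (hG : G.Admissible) {s : ℝ} (hs : 0 < s) :
    Integrable (fun z => Real.exp (-s * G.energyAt z)) G.ν := by
  have h := hG.φ_moments (s * G.c) (mul_pos hs hG.c_pos) 1
  refine h.congr (Filter.Eventually.of_forall fun z => ?_)
  simp only [map_one, one_mul, energyAt]
  congr 1; ring

/-- Half of the exponential absorbs the power, by `x^k ≤ k!/(s/2)^k · e^{sx/2}`; the other half is
integrable. -/
theorem Admissible.integrable_mul_exp (hG : G.Admissible) {s : ℝ} (hs : 0 < s) {g : V3 × ℝ → ℝ}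
    (hg : Measurable g) {K : ℝ} {k : ℕ} (hb : ∀ z : V3 × ℝ, 0 < z.2 → |g z| ≤ K * G.energyAt z ^ k) :
    Integrable (fun z => g z * Real.exp (-s * G.energyAt z)) G.ν := by
  have h0 : 0 < s / 2 := by linarith
  refine ((hG.integrable_exp_energyAt h0).const_mul (|K| * (k.factorial / (s / 2) ^ k))).mono'
    (by fun_prop) ?_
  filter_upwards [G.ae_pos] with z hz
  have hE : 0 ≤ G.energyAt z := hG.mc2_pos.le.trans (hG.le_energyAt hz)
  have h1 : G.energyAt z ^ k ≤ k.factorial / (s / 2) ^ k * Real.exp (s / 2 * G.energyAt z) := by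
    have := Real.pow_div_factorial_le_exp (s / 2 * G.energyAt z) (by positivity) k
    rw [div_le_iff₀ (by positivity)] at this
    rw [div_mul_eq_mul_div, le_div_iff₀ (by positivity)]
    calc _ = (s / 2 * G.energyAt z) ^ k := by ring
      _ ≤ _ := this
      _ = _ := by ring
  rw [norm_mul, Real.norm_eq_abs, Real.norm_eq_abs, Real.abs_exp]
  calc |g z| * Real.exp (-s * G.energyAt z)
      ≤ (|K| * (k.factorial / (s / 2) ^ k * Real.exp (s / 2 * G.energyAt z)))
          * Real.exp (-s * G.energyAt z) := by
        refine mul_le_mul_of_nonneg_right ?_ (Real.exp_nonneg _)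
        exact ((hb z hz).trans (mul_le_mul_of_nonneg_right (le_abs_self K) (by positivity))).trans
          (mul_le_mul_of_nonneg_left h1 (abs_nonneg K))
    _ = |K| * (k.factorial / (s / 2) ^ k) *
          (Real.exp (s / 2 * G.energyAt z) * Real.exp (-s * G.energyAt z)) := by ring
    _ = _ := by rw [← Real.exp_add]; ring_nf

theorem Admissible.integrable_mul_exp_unit (hG : G.Admissible) {s : ℝ} (hs : 0 < s)
    {g : V3 × ℝ → ℝ} (hg : Measurable g) {K : ℝ} {k : ℕ}
    (hb : ∀ z : V3 × ℝ, 0 < z.2 → |g z| ≤ K * G.energyUnit z ^ k) :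
    Integrable (fun z => g z * Real.exp (-s * G.energyUnit z)) G.ν := by
  have hmc := hG.mc_pos
  have hg' : Measurable fun z : V3 × ℝ => g ((G.m * G.c)⁻¹ • z.1, z.2) :=
    hg.comp (f := fun z : V3 × ℝ => ((G.m * G.c)⁻¹ • z.1, z.2)) (by fun_prop)
  have h := hG.integrable_mul_exp (K := K) (k := k) hs hg' (fun z hz => by
    have := hb ((G.m * G.c)⁻¹ • z.1, z.2) hz
    rwa [← hG.energyAt_smul, smul_inv_smul₀ hmc.ne'] at this)
  rw [← G.integrable_smul_fst hmc] at h
  simpa only [inv_smul_smul₀ hmc.ne', hG.energyAt_smul] using h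

theorem Admissible.energyUnit_pos (hG : G.Admissible) {z : V3 × ℝ} (hz : 0 < z.2) :
    0 < G.energyUnit z := by
  have := hG.mc2_pos
  unfold energyUnit; positivity

/-! ### Thermodynamic functions -/

theorem Admissible.ρ_ne_zero (hG : G.Admissible) : G.ρ ≠ 0 := by
  intro h
  unfold ρ at h
  rw [withDensity_eq_zero_iff (by have := hG.φ_measurable; fun_prop)] at h
  refine hG.φ_ne_zero ?_
  filter_upwards [h, ae_restrict_mem measurableSet_Ioi] with I hI hI0
  exact le_antisymm (ENNReal.ofReal_eq_zero.1 hI) (hG.φ_nonneg I hI0)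

theorem Admissible.ν_ne_zero (hG : G.Admissible) : G.ν ≠ 0 := by
  intro h
  have h1 := congrArg (fun μ => μ (univ ×ˢ univ)) h
  simp only [ν, Measure.prod_prod, Measure.coe_zero, Pi.zero_apply, mul_eq_zero,
    Measure.measure_univ_eq_zero] at h1
  exact h1.elim (NeZero.ne _) hG.ρ_ne_zero

/-- Nondegeneracy that makes the variance of the energy positive. Spheres are null sets, so two
momenta of different norm would give the same energy at almost every `𝓘`, although the energy is
strictly increasing in `|p|`. -/
theorem Admissible.not_ae_energyUnit_eq (hG : G.Admissible) (κ : ℝ) :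
    ¬ ∀ᵐ z ∂G.ν, G.energyUnit z = κ := by
  intro h
  have h1 : ∀ᵐ z ∂G.ν, G.energyUnit z = κ ∧ 0 < z.2 := h.and G.ae_pos
  have h2 := Measure.ae_ae_of_ae_prod h1
  obtain ⟨p₁, hp₁⟩ := h2.exists
  have h3 : ∀ᵐ p : V3, ‖p‖ ≠ ‖p₁‖ := by
    refine ae_iff.2 ?_
    have := Measure.addHaar_sphere (volume : Measure V3) 0 ‖p₁‖
    convert this using 2
    ext p; simp
  obtain ⟨p₂, hp₂, hne⟩ := (h2.and h3).exists
  have : ∀ᵐ I ∂G.ρ, False := by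
    filter_upwards [hp₁, hp₂] with I h1 h2
    have hpos : 0 < G.m * G.c ^ 2 + I := add_pos hG.mc2_pos h1.2
    have e := h2.1.trans h1.1.symm
    simp only [energyUnit] at e
    have e1 := mul_left_cancel₀ hpos.ne' e
    have e2 := (Real.sqrt_inj (by positivity) (by positivity)).1 e1
    have e3 : ‖p₂‖ ^ 2 = ‖p₁‖ ^ 2 := by linarith
    exact hne ((sq_eq_sq₀ (norm_nonneg _) (norm_nonneg _)).1 e3)
  exact hG.ρ_ne_zero (by simpa using this)

theorem Admissible.mem_interior_integrableExpSet (hG : G.Admissible) {t : ℝ} (ht : t < 0) :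
    t ∈ interior (integrableExpSet G.energyUnit G.ν) := by
  refine mem_interior.2 ⟨Iio 0, fun t ht => ?_, isOpen_Iio, ht⟩
  have := hG.integrable_mul_exp_unit (s := -t) (by simpa using ht) (g := fun _ => 1) (K := 1)
    (k := 0) measurable_const (by simp)
  simpa [integrableExpSet] using this

/-- `-1 / (kB T)`. -/
def negBeta (G : Gas) (T : ℝ) : ℝ := -(1 / (G.kB * T))

theorem Admissible.negBeta_neg (hG : G.Admissible) {T : ℝ} (hT : 0 < T) : G.negBeta T < 0 := by
  have := hG.kB_pos
  unfold negBeta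
  have : 0 < 1 / (G.kB * T) := by positivity
  linarith

/-- Reading `Z` as a moment generating function provides analyticity in `T` and all derivative
formulas, since every negative parameter is interior to its domain. -/
theorem Z_eq_mgf (G : Gas) (T : ℝ) : G.Z T = mgf G.energyUnit G.ν (G.negBeta T) := by
  unfold Z mom mgf energyUnit negBeta
  congr 1; ext z; ring_nf

theorem Admissible.eTilde_eq_deriv_cgf (hG : G.Admissible) {T : ℝ} (hT : 0 < T) :
    G.eTilde T = deriv (cgf G.energyUnit G.ν) (G.negBeta T) := by
  rw [deriv_cgf (hG.mem_interior_integrableExpSet (hG.negBeta_neg hT)), ← Z_eq_mgf]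
  unfold eTilde mom energyUnit negBeta
  congr 2; ext z
  simp only []
  rw [show -(1 / (G.kB * T)) * ((G.m * G.c ^ 2 + z.2) * Real.sqrt (1 + ‖z.1‖ ^ 2))
    = -((G.m * G.c ^ 2 + z.2) * (1 / (G.kB * T)) * Real.sqrt (1 + ‖z.1‖ ^ 2)) by ring]
  ring

theorem Admissible.Z_pos (hG : G.Admissible) {T : ℝ} (hT : 0 < T) : 0 < G.Z T := by
  rw [Z_eq_mgf]
  exact mgf_pos' hG.ν_ne_zero
    (interior_subset (s := integrableExpSet G.energyUnit G.ν)
      (hG.mem_interior_integrableExpSet (hG.negBeta_neg hT)))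

theorem Admissible.hasDerivAt_negBeta (hG : G.Admissible) {T : ℝ} (hT : 0 < T) :
    HasDerivAt G.negBeta (1 / (G.kB * T ^ 2)) T := by
  have hk := hG.kB_pos.ne'
  have h := ((hasDerivAt_inv hT.ne').const_mul (-(1 / G.kB)))
  convert! h using 1
  · ext T; simp [negBeta, mul_comm]
  · field_simp

theorem Admissible.analyticAt_negBeta (hG : G.Admissible) {T : ℝ} (hT : 0 < T) :
    AnalyticAt ℝ G.negBeta T := by
  have hk := hG.kB_pos
  unfold negBeta
  have : G.kB * T ≠ 0 := by positivity
  fun_prop (disch := assumption)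

theorem Admissible.analyticAt_Z (hG : G.Admissible) {T : ℝ} (hT : 0 < T) :
    AnalyticAt ℝ G.Z T := by
  rw [show G.Z = mgf G.energyUnit G.ν ∘ G.negBeta from funext G.Z_eq_mgf]
  exact (analyticAt_mgf (hG.mem_interior_integrableExpSet (hG.negBeta_neg hT))).comp
    (hG.analyticAt_negBeta hT)

theorem Admissible.eTilde_eventuallyEq (hG : G.Admissible) {T : ℝ} (hT : 0 < T) :
    G.eTilde =ᶠ[nhds T] deriv (cgf G.energyUnit G.ν) ∘ G.negBeta := by
  filter_upwards [lt_mem_nhds hT] with T hT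
  exact hG.eTilde_eq_deriv_cgf hT

theorem Admissible.analyticAt_eTilde (hG : G.Admissible) {T : ℝ} (hT : 0 < T) :
    AnalyticAt ℝ G.eTilde T :=
  ((analyticAt_cgf (hG.mem_interior_integrableExpSet (hG.negBeta_neg hT))).deriv.comp
    (hG.analyticAt_negBeta hT)).congr (hG.eTilde_eventuallyEq hT).symm

/-- The derivative is `1/(kB T²)` times the second derivative of the cumulant generating function.
That is the variance of the energy under the Gibbs weight, and the energy is not almost everywhere
constant. -/
theorem Admissible.deriv_eTilde_pos (hG : G.Admissible) {T : ℝ} (hT : 0 < T) :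
    0 < deriv G.eTilde T := by
  have hmem := hG.mem_interior_integrableExpSet (hG.negBeta_neg hT)
  have ha := (analyticAt_cgf hmem).deriv.differentiableAt.hasDerivAt
  rw [(hG.eTilde_eventuallyEq hT).deriv_eq,
    (ha.comp T (hG.hasDerivAt_negBeta hT)).deriv]
  have hk := hG.kB_pos
  refine mul_pos ?_ (by positivity)
  have h2 := iteratedDeriv_two_cgf_eq_integral hmem
  rw [iteratedDeriv_succ, iteratedDeriv_one] at h2
  rw [h2]
  refine div_pos ?_ (by rw [← Z_eq_mgf]; exact hG.Z_pos hT)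
  set κ := deriv (cgf G.energyUnit G.ν) (G.negBeta T)
  set s := -G.negBeta T with hs
  have hspos : 0 < s := by have := hG.negBeta_neg hT; simp only [hs]; linarith
  have hint : Integrable (fun z => (G.energyUnit z - κ) ^ 2
      * Real.exp (G.negBeta T * G.energyUnit z)) G.ν := by
    have i2 := hG.integrable_mul_exp_unit hspos (g := fun z => G.energyUnit z ^ 2) (K := 1)
      (k := 2) (by fun_prop) (fun z hz => by rw [abs_of_nonneg (by positivity)]; simp)
    have i1 := hG.integrable_mul_exp_unit hspos (g := fun z => G.energyUnit z) (K := 1)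
      (k := 1) (by fun_prop) (fun z hz => by rw [abs_of_nonneg (hG.energyUnit_pos hz).le]; simp)
    have i0 := hG.integrable_mul_exp_unit hspos (g := fun z => 1) (K := 1)
      (k := 0) (by fun_prop) (fun z hz => by simp)
    refine ((i2.sub (i1.const_mul (2 * κ))).add (i0.const_mul (κ ^ 2))).congr
      (Filter.Eventually.of_forall fun z => ?_)
    simp only [Pi.add_apply, Pi.sub_apply, hs, neg_neg]
    ring
  rw [integral_pos_iff_support_of_nonneg (fun z => by positivity) hint]
  refine pos_iff_ne_zero.2 fun h0 => hG.not_ae_energyUnit_eq κ ?_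
  refine ae_iff.2 (measure_mono_null (fun z hz => ?_) h0)
  have : G.energyUnit z - κ ≠ 0 := sub_ne_zero.2 hz
  exact (by positivity : (0 : ℝ) < (G.energyUnit z - κ) ^ 2
    * Real.exp (G.negBeta T * G.energyUnit z)).ne'

theorem Admissible.strictMonoOn_eTilde (hG : G.Admissible) : StrictMonoOn G.eTilde (Ioi 0) := by
  refine strictMonoOn_of_deriv_pos (convex_Ioi 0) (fun T hT => ?_) fun T hT => ?_
  · exact (hG.analyticAt_eTilde hT).continuousAt.continuousWithinAt
  · rw [interior_Ioi] at hT
    exact hG.deriv_eTilde_pos hT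

theorem Admissible.temp_eTilde (hG : G.Admissible) {T : ℝ} (hT : 0 < T) :
    G.temp (G.eTilde T) = T :=
  hG.strictMonoOn_eTilde.injOn.leftInvOn_invFunOn hT

/-- The temperature is a smooth function of the energy per particle. -/
theorem Admissible.temp_smooth (hG : G.Admissible) {T : ℝ} (hT : 0 < T) :
    ContDiffAt ℝ 2 G.temp (G.eTilde T) ∧
      HasDerivAt G.temp (deriv G.eTilde T)⁻¹ (G.eTilde T) ∧
      ∀ᶠ y in nhds (G.eTilde T), 0 < G.temp y ∧ G.eTilde (G.temp y) = y := by
  have hd := (hG.analyticAt_eTilde hT).hasStrictDerivAt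
  have hne := (hG.deriv_eTilde_pos hT).ne'
  have hc : ContDiffAt ℝ 2 G.eTilde T := (hG.analyticAt_eTilde hT).contDiffAt
  have hF := hd.hasStrictFDerivAt_equiv hne
  set g := HasStrictFDerivAt.localInverse G.eTilde _ T hF with hgdef
  have hg := hF.to_localInverse
  have hgT : g (G.eTilde T) = T := hF.localInverse_apply_image
  have hev := hF.eventually_right_inverse
  have hgc : ContinuousAt g (G.eTilde T) := hg.continuousAt
  have hpos : ∀ᶠ y in nhds (G.eTilde T), 0 < g y :=
    hgc.eventually (by rw [hgT]; exact lt_mem_nhds hT)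
  -- `temp` is a chosen inverse with no regularity built in. Injectivity on `(0, ∞)` forces it to
  -- agree with the local inverse wherever the latter is positive.
  have heq : G.temp =ᶠ[nhds (G.eTilde T)] g := by
    filter_upwards [hev, hpos] with y h1 h2
    rw [← hG.temp_eTilde h2]
    congr 1
    exact h1.symm
  refine ⟨?_, ?_, ?_⟩
  · have : ContDiffAt ℝ 2 g (G.eTilde T) := by
      have hF' := hc.to_localInverse (f' := ContinuousLinearEquiv.unitsEquivAut ℝ (Units.mk0 _ hne))
        hF.hasFDerivAt (by norm_num)
      exact hF'
    exact this.congr_of_eventuallyEq heq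
  · have := (hd.to_localInverse hne).hasDerivAt
    exact this.congr_of_eventuallyEq heq
  · filter_upwards [hev, hpos, heq] with y h1 h2 h3
    rw [h3]
    exact ⟨h2, h1⟩

end Gas

/-! ### Bessel functions as radial integrals -/

/-- Half of the exponential absorbs the power; `cosh t ≥ t/2` turns the other half into plain
exponential decay. -/
theorem cosh_pow_mul_exp_le {z : ℝ} (hz : 0 < z) (k : ℕ) {t : ℝ} :
    Real.cosh t ^ k * Real.exp (-z * Real.cosh t)
      ≤ k.factorial / (z / 2) ^ k * Real.exp (-(z / 4) * t) := by
  have hc := Real.cosh_pos t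
  have h1 := Real.pow_div_factorial_le_exp (z / 2 * Real.cosh t) (by positivity) k
  rw [div_le_iff₀ (by positivity), mul_pow] at h1
  have h2 : t / 2 ≤ Real.cosh t := by
    have h3 := Real.add_one_le_exp t
    have h4 := Real.exp_pos (-t)
    rw [Real.cosh_eq]; linarith
  have h5 : Real.cosh t ^ k ≤ k.factorial / (z / 2) ^ k * Real.exp (z / 2 * Real.cosh t) := by
    rw [div_mul_eq_mul_div, le_div_iff₀ (by positivity)]
    linarith
  calc _ ≤ k.factorial / (z / 2) ^ k * Real.exp (z / 2 * Real.cosh t)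
          * Real.exp (-z * Real.cosh t) := mul_le_mul_of_nonneg_right h5 (Real.exp_nonneg _)
    _ = k.factorial / (z / 2) ^ k * Real.exp (-(z / 2) * Real.cosh t) := by
        rw [mul_assoc, ← Real.exp_add]; ring_nf
    _ ≤ _ := by
        refine mul_le_mul_of_nonneg_left (Real.exp_le_exp.2 ?_) (by positivity)
        nlinarith

theorem integrableOn_mul_exp_cosh {z : ℝ} (hz : 0 < z) {g : ℝ → ℝ} (hg : Continuous g) {K : ℝ}
    {k : ℕ} (hb : ∀ t, |g t| ≤ K * Real.cosh t ^ k) :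
    IntegrableOn (fun t => g t * Real.exp (-z * Real.cosh t)) (Ioi 0) ∧
      Filter.Tendsto (fun t => g t * Real.exp (-z * Real.cosh t)) Filter.atTop (nhds 0) := by
  have hK : 0 ≤ K := by
    have := (abs_nonneg _).trans (hb 0)
    simpa using this
  have hle : ∀ t, ‖g t * Real.exp (-z * Real.cosh t)‖
      ≤ K * (k.factorial / (z / 2) ^ k) * Real.exp (-(z / 4) * t) := by
    intro t
    rw [norm_mul, Real.norm_eq_abs, Real.norm_eq_abs, Real.abs_exp]
    calc _ ≤ K * Real.cosh t ^ k * Real.exp (-z * Real.cosh t) :=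
          mul_le_mul_of_nonneg_right (hb t) (Real.exp_nonneg _)
      _ = K * (Real.cosh t ^ k * Real.exp (-z * Real.cosh t)) := by ring
      _ ≤ _ := (mul_le_mul_of_nonneg_left (cosh_pow_mul_exp_le hz k) hK).trans_eq (by ring)
  constructor
  · refine Integrable.mono' (((exp_neg_integrableOn_Ioi 0 (b := z / 4) (by linarith))).const_mul
      (K * (k.factorial / (z / 2) ^ k))) ?_ (Filter.Eventually.of_forall hle)
    exact (by fun_prop : Continuous fun t =>
      g t * Real.exp (-z * Real.cosh t)).aestronglyMeasurable
  · refine squeeze_zero_norm hle ?_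
    have h1 : Filter.Tendsto (fun t : ℝ => -(z / 4) * t) Filter.atTop Filter.atBot :=
      Filter.tendsto_id.const_mul_atTop_of_neg (by linarith)
    simpa using (Real.tendsto_exp_atBot.comp h1).const_mul (K * (k.factorial / (z / 2) ^ k))

theorem abs_sinh_le_cosh (t : ℝ) : |Real.sinh t| ≤ Real.cosh t :=
  abs_le_of_sq_le_sq (by rw [Real.sinh_sq]; linarith) (Real.cosh_pos t).le

/-- Polar coordinates followed by `|p| = sinh t`, so that `√(1+|p|²) = cosh t`. The constant is the
area of the unit sphere. -/
theorem integral_radial (g : ℝ → ℝ) :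
    ∫ p : V3, g (Real.sqrt (1 + ‖p‖ ^ 2))
      = 3 * (volume : Measure V3).real (Metric.ball 0 1)
        * ∫ t in Ioi (0 : ℝ), Real.cosh t * (Real.sinh t ^ 2 * g (Real.cosh t)) := by
  rw [integral_fun_norm_addHaar (volume : Measure V3) (fun r => g (Real.sqrt (1 + r ^ 2)))]
  simp only [finrank_euclideanSpace, Fintype.card_fin, nsmul_eq_mul, smul_eq_mul, Nat.cast_ofNat,
    Nat.add_one_sub_one]
  have himg : Real.sinh '' Ioi 0 = Ioi 0 := by
    ext r
    simp only [mem_image, mem_Ioi]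
    exact ⟨fun ⟨t, ht, h⟩ => h ▸ Real.sinh_pos_iff.2 ht,
      fun hr => ⟨Real.arsinh r, Real.arsinh_pos_iff.2 hr, Real.sinh_arsinh r⟩⟩
  have h := integral_image_eq_integral_abs_deriv_smul (f := Real.sinh) (f' := Real.cosh)
    measurableSet_Ioi (s := Ioi 0) (fun t _ => (Real.hasDerivAt_sinh t).hasDerivWithinAt)
    Real.sinh_injective.injOn (fun r => r ^ 2 * g (Real.sqrt (1 + r ^ 2)))
  rw [himg] at h
  rw [h, mul_assoc]
  congr 2
  refine setIntegral_congr_fun measurableSet_Ioi fun t _ => ?_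
  simp only [smul_eq_mul, abs_of_pos (Real.cosh_pos t)]
  rw [show 1 + Real.sinh t ^ 2 = Real.cosh t ^ 2 by rw [Real.cosh_sq']; ,
    Real.sqrt_sq (Real.cosh_pos t).le]

/-- Integration by parts: `cosh t sinh t e^{-z cosh t}` vanishes at both ends, and `(cosh t sinh t)'
= cosh 2t` produces `K₂`. -/
theorem integral_exp_radial {z : ℝ} (hz : 0 < z) :
    ∫ p : V3, Real.exp (-z * Real.sqrt (1 + ‖p‖ ^ 2))
      = 3 * (volume : Measure V3).real (Metric.ball 0 1) * (besselK 2 z / z) := by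
  rw [integral_radial (fun u => Real.exp (-z * u))]
  congr 1
  have hs := abs_sinh_le_cosh
  have i1 := (integrableOn_mul_exp_cosh hz (g := fun t => Real.cosh (2 * t)) (K := 2) (k := 2)
    (by fun_prop) (fun t => by
      have := (sq_le_sq₀ (abs_nonneg _) (Real.cosh_pos t).le).2 (hs t)
      rw [sq_abs] at this
      rw [abs_of_pos (Real.cosh_pos _), Real.cosh_two_mul]; linarith)).1
  have i2 := (integrableOn_mul_exp_cosh hz (g := fun t => Real.cosh t * Real.sinh t ^ 2) (K := 1)
    (k := 3) (by fun_prop) (fun t => by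
      have := (sq_le_sq₀ (abs_nonneg _) (Real.cosh_pos t).le).2 (hs t)
      rw [abs_mul, abs_pow, abs_of_pos (Real.cosh_pos _)]
      nlinarith [Real.cosh_pos t])).1
  have i3 := (integrableOn_mul_exp_cosh hz (g := fun t => Real.cosh t * Real.sinh t) (K := 1)
    (k := 2) (by fun_prop) (fun t => by
      rw [abs_mul, abs_of_pos (Real.cosh_pos _)]
      nlinarith [Real.cosh_pos t, hs t])).2
  have hd : ∀ t, HasDerivAt (fun t => Real.cosh t * Real.sinh t * Real.exp (-z * Real.cosh t))
      (Real.cosh (2 * t) * Real.exp (-z * Real.cosh t)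
        - z * (Real.cosh t * Real.sinh t ^ 2 * Real.exp (-z * Real.cosh t))) t := by
    intro t
    have h := ((Real.hasDerivAt_cosh t).mul (Real.hasDerivAt_sinh t)).mul
      ((Real.hasDerivAt_cosh t).const_mul (-z)).exp
    convert! h using 1
    rw [Real.cosh_two_mul]; simp only [Pi.mul_apply]; ring
  have h := integral_Ioi_of_hasDerivAt_of_tendsto' (a := 0) (fun t _ => hd t)
    (i1.sub (i2.const_mul z)) i3
  rw [integral_sub i1 (i2.const_mul z), integral_const_mul] at h
  simp only [Real.sinh_zero, mul_zero, zero_mul, sub_zero] at h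
  rw [eq_div_iff hz.ne']
  unfold besselK
  simp only [Nat.cast_ofNat]
  rw [sub_eq_zero.1 h, mul_comm]
  simp only [mul_assoc]

/-- The weight is energy plus pressure, the latter being a third of `|p|²/√(1+|p|²)`. The boundary
function is `(sinh 3t / 3) e^{-z cosh t}`, written as `4/3 sinh³ t + sinh t`; its first factor has
derivative `cosh 3t`, which produces `K₃`. -/
theorem integral_weighted_radial {z : ℝ} (hz : 0 < z) :
    ∫ p : V3, (Real.sqrt (1 + ‖p‖ ^ 2) + ‖p‖ ^ 2 / (3 * Real.sqrt (1 + ‖p‖ ^ 2)))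
        * Real.exp (-z * Real.sqrt (1 + ‖p‖ ^ 2))
      = 3 * (volume : Measure V3).real (Metric.ball 0 1) * (besselK 3 z / z) := by
  have h0 := integral_radial (fun u => (u + (u ^ 2 - 1) / (3 * u)) * Real.exp (-z * u))
  have e : ∀ p : V3, Real.sqrt (1 + ‖p‖ ^ 2) ^ 2 - 1 = ‖p‖ ^ 2 := fun p => by
    rw [Real.sq_sqrt (by positivity)]; ring
  simp only [e] at h0
  rw [h0]
  congr 1
  have hs := abs_sinh_le_cosh
  have h3 : ∀ t, |Real.sinh t| ^ 3 ≤ Real.cosh t ^ 3 := fun t =>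
    pow_le_pow_left₀ (abs_nonneg _) (hs t) 3
  have h1 : ∀ t, Real.cosh t ≤ Real.cosh t ^ 3 := fun t =>
    le_self_pow₀ (Real.one_le_cosh t) (by norm_num)
  have i1 := (integrableOn_mul_exp_cosh hz (g := fun t => Real.cosh (3 * t)) (K := 4) (k := 3)
    (by fun_prop) (fun t => by
      rw [abs_of_pos (Real.cosh_pos _), Real.cosh_three_mul]; linarith [Real.cosh_pos t])).1
  have i2 := (integrableOn_mul_exp_cosh hz
    (g := fun t => Real.sinh t ^ 2 * (Real.cosh t ^ 2 + Real.sinh t ^ 2 / 3)) (K := 2)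
    (k := 4) (by fun_prop) (fun t => by
      have h := (sq_le_sq₀ (abs_nonneg _) (Real.cosh_pos t).le).2 (hs t)
      rw [sq_abs] at h
      rw [abs_of_nonneg (by positivity)]
      nlinarith [sq_nonneg (Real.sinh t), sq_nonneg (Real.cosh t)])).1
  have i3 := (integrableOn_mul_exp_cosh hz
    (g := fun t => 4 / 3 * Real.sinh t ^ 3 + Real.sinh t) (K := 3)
    (k := 3) (by fun_prop) (fun t => by
      refine (abs_add_le _ _).trans ?_
      rw [abs_mul, abs_pow, abs_of_pos (by norm_num : (0 : ℝ) < 4 / 3)]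
      linarith [h3 t, h1 t, hs t, pow_pos (Real.cosh_pos t) 3])).2
  have hd : ∀ t, HasDerivAt
      (fun t => (4 / 3 * Real.sinh t ^ 3 + Real.sinh t) * Real.exp (-z * Real.cosh t))
      (Real.cosh (3 * t) * Real.exp (-z * Real.cosh t)
        - z * (Real.sinh t ^ 2 * (Real.cosh t ^ 2 + Real.sinh t ^ 2 / 3)
          * Real.exp (-z * Real.cosh t))) t := by
    intro t
    have h := ((((Real.hasDerivAt_sinh t).fun_pow 3).const_mul (4 / 3)).fun_add
      (Real.hasDerivAt_sinh t)).fun_mul ((Real.hasDerivAt_cosh t).const_mul (-z)).exp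
    convert! h using 1
    rw [Real.cosh_three_mul]
    have := Real.cosh_sq t
    simp only [Nat.cast_ofNat, Nat.add_one_sub_one]
    rw [show Real.cosh t ^ 3 = Real.cosh t ^ 2 * Real.cosh t by ring, this]
    ring
  have h := integral_Ioi_of_hasDerivAt_of_tendsto' (a := 0) (fun t _ => hd t)
    (i1.sub (i2.const_mul z)) i3
  rw [integral_sub i1 (i2.const_mul z), integral_const_mul] at h
  simp only [Real.sinh_zero, ne_eq, OfNat.ofNat_ne_zero, not_false_eq_true, zero_pow, mul_zero,
    add_zero, zero_mul, sub_zero] at h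
  rw [eq_div_iff hz.ne']
  unfold besselK
  simp only [Nat.cast_ofNat]
  rw [sub_eq_zero.1 h, mul_comm]
  congr 1
  refine setIntegral_congr_fun measurableSet_Ioi fun t _ => ?_
  have hc := (Real.cosh_pos t).ne'
  have := Real.cosh_sq t
  rw [show Real.cosh t ^ 2 - 1 = Real.sinh t ^ 2 by linarith]
  field_simp

/-! ### The enthalpy integral and the coefficient `b` -/

namespace Gas

variable {G : Gas}

/-- The weight `(mc² + 𝓘) (√(1+|p|²) + |p|² / (3 √(1+|p|²)))`. -/
def pressureWeight (G : Gas) (z : V3 × ℝ) : ℝ :=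
  (G.m * G.c ^ 2 + z.2) *
    (Real.sqrt (1 + ‖z.1‖ ^ 2) + ‖z.1‖ ^ 2 / (3 * Real.sqrt (1 + ‖z.1‖ ^ 2)))

@[fun_prop]
theorem measurable_pressureWeight (G : Gas) : Measurable G.pressureWeight := by
  unfold pressureWeight; fun_prop

/-- The enthalpy integral `∫∫ pressureWeight e^{-X/(kB T)} φ d𝓘 dp`. -/
def enthalpy (G : Gas) (T : ℝ) : ℝ :=
  ∫ z, G.pressureWeight z * Real.exp (G.negBeta T * G.energyUnit z) ∂G.ν

theorem Admissible.pressureWeight_pos (hG : G.Admissible) {z : V3 × ℝ} (hz : 0 < z.2) :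
    0 < G.pressureWeight z := by
  have := hG.mc2_pos
  unfold pressureWeight; positivity

theorem Admissible.pressureWeight_le (hG : G.Admissible) {z : V3 × ℝ} (hz : 0 < z.2) :
    G.pressureWeight z ≤ 2 * G.energyUnit z := by
  have := hG.mc2_pos
  have hu : 0 < Real.sqrt (1 + ‖z.1‖ ^ 2) := by positivity
  have hsq : Real.sqrt (1 + ‖z.1‖ ^ 2) ^ 2 = 1 + ‖z.1‖ ^ 2 := Real.sq_sqrt (by positivity)
  have h : ‖z.1‖ ^ 2 / (3 * Real.sqrt (1 + ‖z.1‖ ^ 2)) ≤ Real.sqrt (1 + ‖z.1‖ ^ 2) := by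
    rw [div_le_iff₀ (by positivity)]
    nlinarith [sq_nonneg ‖z.1‖]
  have h2 : 0 ≤ G.m * G.c ^ 2 + z.2 := by linarith
  unfold pressureWeight energyUnit
  nlinarith

theorem Admissible.integrable_pressureWeight (hG : G.Admissible) {s : ℝ} (hs : 0 < s) :
    Integrable (fun z => G.pressureWeight z * Real.exp (-s * G.energyUnit z)) G.ν :=
  hG.integrable_mul_exp_unit hs (K := 2) (k := 1) (by fun_prop) fun z hz => by
    rw [abs_of_pos (hG.pressureWeight_pos hz), pow_one]
    exact hG.pressureWeight_le hz

theorem Admissible.enthalpy_pos (hG : G.Admissible) {T : ℝ} (hT : 0 < T) : 0 < G.enthalpy T := by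
  have hs : 0 < -G.negBeta T := by have := hG.negBeta_neg hT; linarith
  have hi := hG.integrable_pressureWeight hs
  rw [neg_neg] at hi
  have hpos : ∀ᵐ z ∂G.ν, 0 < G.pressureWeight z * Real.exp (G.negBeta T * G.energyUnit z) := by
    filter_upwards [G.ae_pos] with z hz
    exact mul_pos (hG.pressureWeight_pos hz) (Real.exp_pos _)
  unfold enthalpy
  rw [integral_pos_iff_support_of_nonneg_ae (hpos.mono fun z hz => hz.le) hi]
  refine pos_iff_ne_zero.2 fun h0 => hG.ν_ne_zero ?_
  have h1 : ∀ᵐ z ∂G.ν, False := by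
    have h2 : ∀ᵐ z ∂G.ν, z ∉ Function.support
      (fun z => G.pressureWeight z * Real.exp (G.negBeta T * G.energyUnit z)) :=
      measure_eq_zero_iff_ae_notMem.1 h0
    filter_upwards [hpos, h2] with z h1 h2
    exact h2 h1.ne'
  simpa using h1

/-- Once the positive weight is absorbed into the measure, the enthalpy is again a moment generating
function of the energy. -/
theorem Admissible.analyticAt_enthalpy (hG : G.Admissible) {T : ℝ} (hT : 0 < T) :
    AnalyticAt ℝ G.enthalpy T := by
  set ν' := G.ν.withDensity fun z => ENNReal.ofReal (G.pressureWeight z) with hν'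
  have hw : Measurable fun z => ENNReal.ofReal (G.pressureWeight z) := by fun_prop
  have hae : ∀ (g : V3 × ℝ → ℝ), (fun z => (ENNReal.ofReal (G.pressureWeight z)).toReal • g z)
      =ᵐ[G.ν] fun z => G.pressureWeight z * g z := by
    intro g
    filter_upwards [G.ae_pos] with z hz
    rw [ENNReal.toReal_ofReal (hG.pressureWeight_pos hz).le, smul_eq_mul]
  have h1 : G.enthalpy = mgf G.energyUnit ν' ∘ G.negBeta := by
    ext T
    simp only [enthalpy, mgf, Function.comp, hν']
    rw [integral_withDensity_eq_integral_toReal_smul hw (by simp)]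
    exact (integral_congr_ae (hae _)).symm
  have h2 : G.negBeta T ∈ interior (integrableExpSet G.energyUnit ν') := by
    refine mem_interior.2 ⟨Iio 0, fun t ht => ?_, isOpen_Iio, hG.negBeta_neg hT⟩
    simp only [integrableExpSet, mem_ofPred_eq, hν']
    rw [integrable_withDensity_iff_integrable_smul' hw (by simp)]
    have h3 := hG.integrable_pressureWeight (s := -t) (by simpa using ht)
    rw [neg_neg] at h3
    exact h3.congr (hae _).symm
  rw [h1]
  exact (analyticAt_mgf h2).comp (hG.analyticAt_negBeta hT)

theorem Admissible.gamma_wt (hG : G.Admissible) (T I : ℝ) :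
    G.m * G.c ^ 2 / (G.kB * T) * G.wt I = 1 / (G.kB * T) * (G.m * G.c ^ 2 + I) := by
  have h := hG.mc2_pos.ne'
  have h1 := hG.kB_pos.ne'
  unfold wt
  by_cases hT : T = 0
  · simp [hT]
  have h3 := hG.m_pos.ne'
  have h4 := hG.c_pos.ne'
  field_simp

/-- The coefficient `b` in terms of the partition function and the enthalpy integral. -/
theorem Admissible.bCoef_eq (hG : G.Admissible) (n : ℝ) {T : ℝ} (hT : 0 < T) :
    G.bCoef n T = n * (G.kB * T / (G.m * G.c ^ 2) * (G.enthalpy T / G.Z T)) := by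
  have hk := hG.kB_pos
  have hmc := hG.mc2_pos
  set s := 1 / (G.kB * T) with hs
  have hspos : 0 < s := by positivity
  set V := (volume : Measure V3).real (Metric.ball 0 1) with hV
  have hVpos : 0 < V :=
    ENNReal.toReal_pos (Metric.measure_ball_pos _ _ one_pos).ne' measure_ball_lt_top.ne
  have hρ : ∀ᵐ I ∂G.ρ, 0 < I :=
    (withDensity_absolutelyContinuous _ _).ae_le (ae_restrict_mem measurableSet_Ioi)
  -- The momentum is integrated first, at fixed `𝓘`. The factor `3V` appears in `Z` and in the
  -- enthalpy, so it drops out of their quotient.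
  have hZ : G.Z T = 3 * V * ∫ I, besselK 2 (G.m * G.c ^ 2 / (G.kB * T) * G.wt I)
      / (G.m * G.c ^ 2 / (G.kB * T) * G.wt I) ∂G.ρ := by
    have hi := hG.integrable_mul_exp_unit hspos (g := fun _ => 1) (K := 1) (k := 0)
      measurable_const (by simp)
    rw [Z_eq_mgf, mgf, negBeta, ← hs]
    simp only [one_mul] at hi
    unfold ν at hi ⊢
    rw [integral_prod_symm _ hi, ← integral_const_mul]
    refine integral_congr_ae ?_
    filter_upwards [hρ] with I hI
    have hz : 0 < s * (G.m * G.c ^ 2 + I) := by positivity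
    rw [hG.gamma_wt, ← hs, ← integral_exp_radial hz]
    congr 1; ext p; unfold energyUnit; ring_nf
  have hD : G.enthalpy T = 3 * V * (G.kB * T *
      ∫ I, besselK 3 (G.m * G.c ^ 2 / (G.kB * T) * G.wt I) ∂G.ρ) := by
    have hi := hG.integrable_pressureWeight hspos
    rw [enthalpy, negBeta, ← hs]
    unfold ν at hi ⊢
    rw [integral_prod_symm _ hi, ← integral_const_mul, ← integral_const_mul]
    refine integral_congr_ae ?_
    filter_upwards [hρ] with I hI
    have hz : 0 < s * (G.m * G.c ^ 2 + I) := by positivity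
    have h := integral_weighted_radial hz
    have hkT : G.kB * T = 1 / s := by rw [hs]; field_simp
    have hI' : G.m * G.c ^ 2 + I ≠ 0 := by positivity
    have h2 : 3 * V * (G.kB * T * besselK 3 (G.m * G.c ^ 2 / (G.kB * T) * G.wt I))
        = (G.m * G.c ^ 2 + I) * (3 * V * (besselK 3 (s * (G.m * G.c ^ 2 + I))
          / (s * (G.m * G.c ^ 2 + I)))) := by
      rw [hG.gamma_wt, ← hs, hkT]
      field_simp
    rw [h2, ← h, ← integral_const_mul]
    congr 1; ext p; unfold energyUnit pressureWeight; ring_nf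
  have hZpos := hG.Z_pos hT
  unfold bCoef
  simp only []
  rw [hD, hZ]
  rw [hZ] at hZpos
  set A := ∫ I, besselK 2 (G.m * G.c ^ 2 / (G.kB * T) * G.wt I)
      / (G.m * G.c ^ 2 / (G.kB * T) * G.wt I) ∂G.ρ
  set B := ∫ I, besselK 3 (G.m * G.c ^ 2 / (G.kB * T) * G.wt I) ∂G.ρ
  have hA : A ≠ 0 := by
    rintro h; rw [h] at hZpos; simp at hZpos
  have h3 := hG.m_pos.ne'
  have h4 := hG.c_pos.ne'
  field_simp

/-- The heat-conduction coefficient per particle. -/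
def bUnit (G : Gas) (T : ℝ) : ℝ := G.kB * T / (G.m * G.c ^ 2) * (G.enthalpy T / G.Z T)

theorem Admissible.bUnit_pos (hG : G.Admissible) {T : ℝ} (hT : 0 < T) : 0 < G.bUnit T := by
  have h1 := hG.kB_pos
  have h2 := hG.mc2_pos
  have h3 := hG.Z_pos hT
  have h4 := hG.enthalpy_pos hT
  unfold bUnit; positivity

theorem Admissible.analyticAt_bUnit (hG : G.Admissible) {T : ℝ} (hT : 0 < T) :
    AnalyticAt ℝ G.bUnit T := by
  have h1 := hG.analyticAt_Z hT
  have h2 := hG.analyticAt_enthalpy hT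
  have h3 := (hG.Z_pos hT).ne'
  have h4 := hG.mc2_pos.ne'
  exact ((analyticAt_const.mul analyticAt_id).div analyticAt_const h4).mul (h2.div h1 h3)

end Gas

/-- Second-order Taylor formula along a segment with integral remainder. -/
theorem taylor_segment {E : Type*} [NormedAddCommGroup E] [NormedSpace ℝ E] {g : E → ℝ} {y v : E}
    (h : ∀ θ ∈ Icc (0 : ℝ) 1, ContDiffAt ℝ 2 g (y + θ • v)) :
    g (y + v) = g y + fderiv ℝ g y v
      + ∫ θ in (0 : ℝ)..1, (1 - θ) * fderiv ℝ (fderiv ℝ g) (y + θ • v) v v := by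
  have hline : ∀ θ : ℝ, HasDerivAt (fun θ : ℝ => y + θ • v) v θ := fun θ => by
    simpa using ((hasDerivAt_id θ).smul_const v).const_add y
  have hu : uIcc (0 : ℝ) 1 = Icc 0 1 := uIcc_of_le zero_le_one
  -- A primitive of the remainder's integrand: differentiating `1 - θ` cancels the derivative of `g`
  -- along the segment.
  have hd : ∀ θ ∈ uIcc (0 : ℝ) 1,
      HasDerivAt (fun θ : ℝ => (1 - θ) * fderiv ℝ g (y + θ • v) v + g (y + θ • v))
        ((1 - θ) * fderiv ℝ (fderiv ℝ g) (y + θ • v) v v) θ := by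
    intro θ hθ
    have hg := h θ (hu ▸ hθ)
    have h1 := (hg.differentiableAt (by norm_num)).hasFDerivAt.comp_hasDerivAt θ (hline θ)
    have h2 := ((hg.fderiv_right (m := 1) (by norm_num)).differentiableAt
      (by norm_num)).hasFDerivAt.comp_hasDerivAt θ (hline θ)
    have h3 := h2.clm_apply (hasDerivAt_const θ v)
    have h4 := (((hasDerivAt_id θ).const_sub 1).mul h3).add h1
    convert! h4 using 1
    simp
  have hc : IntervalIntegrable
      (fun θ : ℝ => (1 - θ) * fderiv ℝ (fderiv ℝ g) (y + θ • v) v v) volume 0 1 := by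
    refine ContinuousOn.intervalIntegrable fun θ hθ => ContinuousAt.continuousWithinAt ?_
    have hg := h θ (hu ▸ hθ)
    have h1 := ((hg.fderiv_right (m := 1) (by norm_num)).fderiv_right (m := 0)
      (by norm_num)).continuousAt
    have h2 : ContinuousAt (fun θ : ℝ => fderiv ℝ (fderiv ℝ g) (y + θ • v)) θ :=
      h1.comp (f := fun θ : ℝ => y + θ • v) (by fun_prop)
    have h3 : ContinuousAt (fun θ : ℝ => fderiv ℝ (fderiv ℝ g) (y + θ • v) v v) θ :=
      (h2.clm_apply continuousAt_const).clm_apply continuousAt_const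
    exact (by fun_prop : ContinuousAt (fun θ : ℝ => 1 - θ) θ).mul h3
  have := intervalIntegral.integral_eq_sub_of_hasDerivAt hd hc
  rw [this]
  simp only [sub_self, zero_mul, one_smul, zero_add, sub_zero, one_mul, zero_smul, add_zero]
  ring

/-! ### The modified equilibrium as a function of the nine fields -/

namespace Gas

variable {G : Gas}

theorem Admissible.exp_chem (hG : G.Admissible) {n T : ℝ} (hn : 0 < n) (hT : 0 < T) (x : ℝ) :
    Real.exp (-1 + G.m / G.kB * (G.chem n T / T) - x)
      = n / ((G.m * G.c) ^ 3 * G.Z T) * Real.exp (-x) := by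
  have h1 := hG.kB_pos.ne'
  have h2 := hG.m_pos.ne'
  have h3 := hG.Z_pos hT
  have h4 := hG.mc_pos
  have e : -1 + G.m / G.kB * (G.chem n T / T) - x
      = Real.log (n / ((G.m * G.c) ^ 3 * G.Z T)) + -x := by
    unfold chem; field_simp; ring
  rw [e, Real.exp_add, Real.exp_log (by positivity)]

/-- The global equilibrium as a function of the energy. -/
theorem Admissible.F0_eq (hG : G.Admissible) (p : V3) (I : ℝ) :
    G.F0 p I = 1 / ((G.m * G.c) ^ 3 * G.Z G.T0)
      * Real.exp (G.negBeta G.T0 * G.energyAt (p, I)) := by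
  unfold F0
  rw [hG.exp_chem one_pos hG.T0_pos]
  unfold negBeta energyAt
  congr 2; ring

theorem Admissible.F0_pos (hG : G.Admissible) (p : V3) (I : ℝ) : 0 < G.F0 p I := by
  have h3 := hG.Z_pos hG.T0_pos
  have h4 := hG.mc_pos
  rw [hG.F0_eq]; positivity

theorem mink_fourU (G : Gas) (U p : V3) :
    mink (G.fourU U) (G.fourP p) = Real.sqrt (G.c ^ 2 + ‖U‖ ^ 2) * G.p0 p - ∑ i, U i * p i := rfl

theorem mink_fourP (G : Gas) (p : V3) (q : Fin 4 → ℝ) :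
    mink (G.fourP p) q = G.p0 p * q 0 - ∑ i : Fin 3, p i * q i.succ := rfl

/-- The modified equilibrium in reduced form. -/
theorem Admissible.Ftilde_eq (hG : G.Admissible) (p : V3) (I : ℝ) {y : Fields} (hn : 0 < y.1)
    (hT : 0 < G.temp y.2.2.1) :
    G.Ftilde p I y = (1 - (G.p0 p * y.2.2.2 0 - ∑ i : Fin 3, p i * y.2.2.2 i.succ)
          * (G.wt I / (y.1 * G.bUnit (G.temp y.2.2.1) * G.m * G.c ^ 2)))
        * (y.1 / ((G.m * G.c) ^ 3 * G.Z (G.temp y.2.2.1))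
          * Real.exp (-(G.wt I * (1 / (G.kB * G.temp y.2.2.1))
            * (Real.sqrt (G.c ^ 2 + ‖y.2.1‖ ^ 2) * G.p0 p - ∑ i, y.2.1 i * p i)))) := by
  unfold Ftilde modEq FE
  rw [hG.exp_chem hn hT, hG.bCoef_eq _ hT, mink_fourU, mink_fourP]
  rfl

theorem Admissible.temp_pos_of_nhds (hG : G.Admissible) {T : ℝ} (hT : 0 < T) :
    ∀ᶠ η in nhds (G.eTilde T), 0 < G.temp η :=
  (hG.temp_smooth hT).2.2.mono fun _ h => h.1

theorem Admissible.eventually_fields_pos (hG : G.Admissible) {y : Fields}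
    (hn : 0 < y.1) {T : ℝ} (hT : 0 < T) (hy : y.2.2.1 = G.eTilde T) :
    ∀ᶠ y' in nhds y, 0 < y'.1 ∧ 0 < G.temp y'.2.2.1 := by
  have h1 : ∀ᶠ y' : Fields in nhds y, 0 < y'.1 :=
    (continuous_fst.tendsto y).eventually (lt_mem_nhds hn)
  have h2 : ∀ᶠ y' : Fields in nhds y, 0 < G.temp y'.2.2.1 := by
    have hc : Continuous fun y' : Fields => y'.2.2.1 := by fun_prop
    exact (hc.tendsto y).eventually (hy ▸ hG.temp_pos_of_nhds hT)
  exact h1.and h2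

/-- The closed form holds on a neighbourhood, because positivity of density and temperature is
stable there; it is a composition of smooth functions with nonvanishing denominators. -/
theorem Admissible.contDiffAt_Ftilde (hG : G.Admissible) (p : V3) (I : ℝ) {y : Fields}
    (hn : 0 < y.1) {T : ℝ} (hT : 0 < T) (hy : y.2.2.1 = G.eTilde T) :
    ContDiffAt ℝ 2 (G.Ftilde p I) y := by
  have hev := (hG.eventually_fields_pos hn hT hy).mono fun y' h => hG.Ftilde_eq p I h.1 h.2
  refine ContDiffAt.congr_of_eventuallyEq ?_ hev
  have hyT : G.temp y.2.2.1 = T := by rw [hy, hG.temp_eTilde hT]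
  have hη : ContDiffAt ℝ 2 (fun y' : Fields => y'.2.2.1) y := by fun_prop
  have htemp : ContDiffAt ℝ 2 (fun y' : Fields => G.temp y'.2.2.1) y :=
    ContDiffAt.comp (g := G.temp) y (hy ▸ (hG.temp_smooth hT).1) hη
  have hZ : ContDiffAt ℝ 2 (fun y' : Fields => G.Z (G.temp y'.2.2.1)) y :=
    ContDiffAt.comp (g := G.Z) (f := fun y' : Fields => G.temp y'.2.2.1) y
      (by rw [hyT]; exact (hG.analyticAt_Z hT).contDiffAt) htemp
  have hb : ContDiffAt ℝ 2 (fun y' : Fields => G.bUnit (G.temp y'.2.2.1)) y :=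
    ContDiffAt.comp (g := G.bUnit) (f := fun y' : Fields => G.temp y'.2.2.1) y
      (by rw [hyT]; exact (hG.analyticAt_bUnit hT).contDiffAt) htemp
  have hq : ∀ μ, ContDiffAt ℝ 2 (fun y' : Fields => y'.2.2.2 μ) y := fun μ => by fun_prop
  have hU : ∀ i, ContDiffAt ℝ 2 (fun y' : Fields => y'.2.1 i) y := fun i => by fun_prop
  -- The squared norm is smooth even at `U = 0`, and `c² > 0` keeps the argument of the root away
  -- from zero.
  have hU0 : ContDiffAt ℝ 2 (fun y' : Fields => Real.sqrt (G.c ^ 2 + ‖y'.2.1‖ ^ 2)) y := by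
    refine ContDiffAt.sqrt ?_ (by have := hG.c_pos; positivity)
    have h1 : ContDiffAt ℝ 2 (fun y' : Fields => y'.2.1) y := by fun_prop
    exact contDiffAt_const.add (h1.norm_sq ℝ)
  have hn1 : ContDiffAt ℝ 2 (fun y' : Fields => y'.1) y := by fun_prop
  have hmc := hG.mc_pos.ne'
  have hm := hG.m_pos.ne'
  have hc := hG.c_pos.ne'
  have hk := hG.kB_pos.ne'
  have hZ0 := (hG.Z_pos hT).ne'
  have hb0 := (hG.bUnit_pos hT).ne'
  refine ContDiffAt.mul (ContDiffAt.sub contDiffAt_const (ContDiffAt.mul ?_ ?_)) (ContDiffAt.mul ?_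
    (ContDiffAt.exp (ContDiffAt.neg (ContDiffAt.mul ?_ ?_))))
  · exact (contDiffAt_const.mul (hq 0)).sub
      (ContDiffAt.sum fun i _ => contDiffAt_const.mul (hq i.succ))
  · refine contDiffAt_const.div (((hn1.mul hb).mul contDiffAt_const).mul contDiffAt_const) ?_
    rw [hyT]
    have := hn.ne'
    positivity
  · refine hn1.div (contDiffAt_const.mul hZ) ?_
    rw [hyT]; positivity
  · refine contDiffAt_const.mul (contDiffAt_const.div (contDiffAt_const.mul htemp) ?_)
    rw [hyT]; have := hT.ne'; positivity
  · exact (hU0.mul contDiffAt_const).sub (ContDiffAt.sum fun i _ => (hU i).mul contDiffAt_const)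

/-- The logarithmic derivative of `Z` is `ẽ/(kB T²)`. It supplies the `-ẽ(T0)` in `enDev` when the
normalized Gibbs factor is differentiated in `T`. -/
theorem Admissible.hasDerivAt_Z (hG : G.Admissible) {T : ℝ} (hT : 0 < T) :
    HasDerivAt G.Z (G.eTilde T * G.Z T / (G.kB * T ^ 2)) T := by
  have hmem := hG.mem_interior_integrableExpSet (hG.negBeta_neg hT)
  have h := (hasDerivAt_mgf hmem).comp T (hG.hasDerivAt_negBeta hT)
  have e : G.eTilde T * G.Z T
      = ∫ z, G.energyUnit z * Real.exp (G.negBeta T * G.energyUnit z) ∂G.ν := by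
    rw [hG.eTilde_eq_deriv_cgf hT, deriv_cgf hmem, Z_eq_mgf,
      div_mul_cancel₀ _ (by rw [← Z_eq_mgf]; exact (hG.Z_pos hT).ne')]
  rw [e]
  convert! h using 1
  · exact funext G.Z_eq_mgf
  · ring

/-- The differential at equilibrium, computed along lines so that one-variable calculus suffices. -/
theorem Admissible.hasDerivAt_Ftilde_line (hG : G.Admissible) (p : V3) (I : ℝ) (v : Fields) :
    HasDerivAt (fun θ : ℝ => G.Ftilde p I (G.fields0 + θ • v))
      (G.F0 p I * (v.1 + G.wt I / (G.kB * G.T0) * ∑ i, v.2.1 i * p i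
        + G.enDev p I / (G.kB * G.T0 ^ 2 * deriv G.eTilde G.T0) * v.2.2.1
        - mink (G.fourP p) v.2.2.2 * (G.wt I / (G.b0 * G.m * G.c ^ 2)))) 0 := by
  have hT := hG.T0_pos
  have hb : G.b0 = G.bUnit G.T0 := by unfold b0; rw [hG.bCoef_eq 1 hT, one_mul]; rfl
  have hm := hG.m_pos.ne'
  have hc := hG.c_pos
  have hk := hG.kB_pos.ne'
  have hZ0 := (hG.Z_pos hT).ne'
  have hb0 := (hG.bUnit_pos hT).ne'
  have he := (hG.deriv_eTilde_pos hT).ne'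
  have hev : ∀ᶠ θ : ℝ in nhds 0, G.Ftilde p I (G.fields0 + θ • v)
      = (1 - (G.p0 p * (θ * v.2.2.2 0) - ∑ i : Fin 3, p i * (θ * v.2.2.2 i.succ))
          * (G.wt I / ((1 + θ * v.1) * G.bUnit (G.temp (G.eTilde G.T0 + θ * v.2.2.1))
            * G.m * G.c ^ 2)))
        * ((1 + θ * v.1) / ((G.m * G.c) ^ 3 * G.Z (G.temp (G.eTilde G.T0 + θ * v.2.2.1)))
          * Real.exp (-(G.wt I * (1 / (G.kB * G.temp (G.eTilde G.T0 + θ * v.2.2.1)))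
            * (Real.sqrt (G.c ^ 2 + θ ^ 2 * ‖v.2.1‖ ^ 2) * G.p0 p
              - ∑ i, (θ * v.2.1 i) * p i)))) := by
    have h1 := hG.eventually_fields_pos (y := G.fields0) one_pos hT rfl
    have h2 : Filter.Tendsto (fun θ : ℝ => G.fields0 + θ • v) (nhds 0) (nhds G.fields0) := by
      have : Continuous fun θ : ℝ => G.fields0 + θ • v := by fun_prop
      simpa using this.tendsto 0
    filter_upwards [h2.eventually h1] with θ hθ
    rw [hG.Ftilde_eq p I hθ.1 hθ.2]
    simp [fields0, norm_smul, mul_pow]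
  refine HasDerivAt.congr_of_eventuallyEq ?_ hev
  have dη : HasDerivAt (fun θ : ℝ => G.eTilde G.T0 + θ * v.2.2.1) v.2.2.1 0 := by
    simpa using ((hasDerivAt_id (0 : ℝ)).mul_const v.2.2.1).const_add (G.eTilde G.T0)
  have dT : HasDerivAt (fun θ : ℝ => G.temp (G.eTilde G.T0 + θ * v.2.2.1))
      ((deriv G.eTilde G.T0)⁻¹ * v.2.2.1) 0 :=
    HasDerivAt.comp (h₂ := G.temp) 0 (by simpa using (hG.temp_smooth hT).2.1) dη
  have hT0 : G.temp (G.eTilde G.T0 + 0 * v.2.2.1) = G.T0 := by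
    rw [zero_mul, add_zero, hG.temp_eTilde hT]
  have dZ : HasDerivAt (fun θ : ℝ => G.Z (G.temp (G.eTilde G.T0 + θ * v.2.2.1)))
      (G.eTilde G.T0 * G.Z G.T0 / (G.kB * G.T0 ^ 2) * ((deriv G.eTilde G.T0)⁻¹ * v.2.2.1)) 0 :=
    HasDerivAt.comp (h₂ := G.Z) 0 (by rw [hT0]; exact hG.hasDerivAt_Z hT) dT
  -- This derivative leaves no trace in the result: it is multiplied by the heat flux, which
  -- vanishes at equilibrium.
  have dB : HasDerivAt (fun θ : ℝ => G.bUnit (G.temp (G.eTilde G.T0 + θ * v.2.2.1)))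
      (deriv G.bUnit G.T0 * ((deriv G.eTilde G.T0)⁻¹ * v.2.2.1)) 0 :=
    HasDerivAt.comp (h₂ := G.bUnit) 0
      (by rw [hT0]; exact (hG.analyticAt_bUnit hT).differentiableAt.hasDerivAt) dT
  have dn : HasDerivAt (fun θ : ℝ => 1 + θ * v.1) v.1 0 := by
    simpa using ((hasDerivAt_id (0 : ℝ)).mul_const v.1).const_add 1
  have dq : HasDerivAt (fun θ : ℝ => G.p0 p * (θ * v.2.2.2 0)
      - ∑ i : Fin 3, p i * (θ * v.2.2.2 i.succ)) (mink (G.fourP p) v.2.2.2) 0 := by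
    rw [mink_fourP]
    have e : (fun θ : ℝ => G.p0 p * (θ * v.2.2.2 0) - ∑ i : Fin 3, p i * (θ * v.2.2.2 i.succ))
        = fun θ => θ * (G.p0 p * v.2.2.2 0 - ∑ i : Fin 3, p i * v.2.2.2 i.succ) := by
      ext θ
      rw [mul_sub, Finset.mul_sum]
      congr 1
      · ring
      · exact Finset.sum_congr rfl fun i _ => by ring
    rw [e]
    simpa using (hasDerivAt_id (0 : ℝ)).mul_const _
  have dU : HasDerivAt (fun θ : ℝ => Real.sqrt (G.c ^ 2 + θ ^ 2 * ‖v.2.1‖ ^ 2) * G.p0 p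
      - ∑ i, (θ * v.2.1 i) * p i) (-∑ i, v.2.1 i * p i) 0 := by
    -- `U⁰` is even in `U`, so it contributes nothing to first order; only `U · p` does.
    have h1 : HasDerivAt (fun θ : ℝ => G.c ^ 2 + θ ^ 2 * ‖v.2.1‖ ^ 2) 0 0 := by
      simpa using (((hasDerivAt_id (0 : ℝ)).fun_pow 2).mul_const (‖v.2.1‖ ^ 2)).const_add (G.c ^ 2)
    have h2 := (h1.sqrt (by simpa using hc.ne')).mul_const (G.p0 p)
    have e : (fun θ : ℝ => ∑ i, (θ * v.2.1 i) * p i) = fun θ => θ * ∑ i, v.2.1 i * p i := by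
      ext θ
      rw [Finset.mul_sum]
      exact Finset.sum_congr rfl fun i _ => by ring
    have h3 : HasDerivAt (fun θ : ℝ => ∑ i, (θ * v.2.1 i) * p i) (∑ i, v.2.1 i * p i) 0 := by
      rw [e]; simpa using (hasDerivAt_id (0 : ℝ)).mul_const _
    simpa using h2.fun_sub h3
  have hcoef : HasDerivAt (fun θ : ℝ => G.wt I / ((1 + θ * v.1)
      * G.bUnit (G.temp (G.eTilde G.T0 + θ * v.2.2.1)) * G.m * G.c ^ 2)) _ 0 :=
    (hasDerivAt_const (0 : ℝ) (G.wt I)).fun_div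
      (((dn.fun_mul dB).mul_const G.m).mul_const (G.c ^ 2))
      (by rw [hT0]; simp only [zero_mul, add_zero, one_mul]; positivity)
  have hpre := dn.fun_div (dZ.const_mul ((G.m * G.c) ^ 3))
    (by rw [hT0]; have := hG.mc_pos; positivity)
  have hexp := ((((hasDerivAt_const (0 : ℝ) (1 : ℝ)).fun_div (dT.const_mul G.kB)
    (by rw [hT0]; have := hT.ne'; positivity)).const_mul (G.wt I)).fun_mul dU).fun_neg.exp
  have hall := ((dq.fun_mul hcoef).const_sub 1).fun_mul (hpre.fun_mul hexp)
  convert! hall using 1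
  rw [hT0, hb, hG.F0_eq]
  unfold negBeta energyAt enDev
  have hsq : Real.sqrt (G.c ^ 2) = G.c := Real.sqrt_sq hc.le
  simp only [zero_mul, mul_zero, Finset.sum_const_zero, sub_zero, add_zero, one_mul, zero_sub,
    ne_eq, OfNat.ofNat_ne_zero, not_false_eq_true, zero_pow, hsq]
  have hX : Real.exp (-(1 / (G.kB * G.T0)) * (G.c * G.p0 p * G.wt I))
      = Real.exp (-(G.wt I * (1 / (G.kB * G.T0)) * (G.c * G.p0 p))) := by
    congr 1; ring
  rw [hX]
  have hT' := hT.ne'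
  have hc' := hc.ne'
  field_simp
  ring

theorem Admissible.fderiv_Ftilde (hG : G.Admissible) (p : V3) (I : ℝ) (v : Fields) :
    fderiv ℝ (G.Ftilde p I) G.fields0 v
      = G.F0 p I * (v.1 + G.wt I / (G.kB * G.T0) * ∑ i, v.2.1 i * p i
        + G.enDev p I / (G.kB * G.T0 ^ 2 * deriv G.eTilde G.T0) * v.2.2.1
        - mink (G.fourP p) v.2.2.2 * (G.wt I / (G.b0 * G.m * G.c ^ 2))) := by
  have h1 := (hG.contDiffAt_Ftilde p I (y := G.fields0) one_pos hG.T0_pos rfl).differentiableAt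
    (by norm_num)
  have h2 : HasDerivAt (fun θ : ℝ => G.fields0 + θ • v) v 0 := by
    simpa using ((hasDerivAt_id (0 : ℝ)).smul_const v).const_add G.fields0
  have h3 : HasFDerivAt (G.Ftilde p I) (fderiv ℝ (G.Ftilde p I) G.fields0)
      (G.fields0 + (0 : ℝ) • v) := by
    simpa using h1.hasFDerivAt
  have h4 := h3.comp_hasDerivAt 0 h2
  exact h4.unique (hG.hasDerivAt_Ftilde_line p I v)

theorem Admissible.Ftilde_fields0 (hG : G.Admissible) (p : V3) (I : ℝ) :
    G.Ftilde p I G.fields0 = G.F0 p I := by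
  have hT : 0 < G.temp G.fields0.2.2.1 := by
    simp only [fields0, hG.temp_eTilde hG.T0_pos]; exact hG.T0_pos
  rw [hG.Ftilde_eq p I one_pos hT, hG.F0_eq]
  simp only [fields0, hG.temp_eTilde hG.T0_pos]
  simp [Real.sqrt_sq hG.c_pos.le, negBeta, energyAt]
  left
  ring

theorem fieldsθ_eq (G : Gas) (F : V3 → ℝ → ℝ) (θ : ℝ) :
    G.fieldsθ F θ = G.fields0 + θ • (G.fieldsOf F - G.fields0) := by
  unfold fieldsθ
  module

/-! ### Moments of square integrable perturbations -/

/-- The squared norm of `L²(φ(𝓘) d𝓘 dp)`. -/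
def normSq (G : Gas) (h : V3 → ℝ → ℝ) : ENNReal := ∫⁻ z, ‖h z.1 z.2‖ₑ ^ 2 ∂G.ν

/-- Measurable and square integrable against `φ(𝓘) d𝓘 dp`. -/
structure SquareIntegrable (G : Gas) (h : V3 → ℝ → ℝ) : Prop where
  measurable : Measurable fun z : V3 × ℝ => h z.1 z.2
  lt_top : G.normSq h < ⊤

/-- A measurable weight bounded by a multiple of the energy. -/
structure EnergyBounded (G : Gas) (g : V3 × ℝ → ℝ) : Prop where
  measurable : Measurable g
  bound : ∃ K : ℝ, ∀ z : V3 × ℝ, 0 < z.2 → |g z| ≤ K * G.energyAt z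

@[fun_prop]
theorem Admissible.measurable_F0 (hG : G.Admissible) : Measurable fun z : V3 × ℝ => G.F0 z.1 z.2 := by
  simp only [hG.F0_eq]
  fun_prop

theorem Admissible.sF0_sq (hG : G.Admissible) (p : V3) (I : ℝ) : G.sF0 p I ^ 2 = G.F0 p I :=
  Real.sq_sqrt (hG.F0_pos p I).le

theorem Admissible.sF0_pos (hG : G.Admissible) (p : V3) (I : ℝ) : 0 < G.sF0 p I :=
  Real.sqrt_pos.2 (hG.F0_pos p I)

theorem Admissible.measurable_sF0 (hG : G.Admissible) :
    Measurable fun z : V3 × ℝ => G.sF0 z.1 z.2 :=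
  hG.measurable_F0.sqrt

theorem Admissible.integrable_mul_F0 (hG : G.Admissible) {g : V3 × ℝ → ℝ} (hg : Measurable g)
    {K : ℝ} {k : ℕ} (hb : ∀ z : V3 × ℝ, 0 < z.2 → |g z| ≤ K * G.energyAt z ^ k) :
    Integrable (fun z => g z * G.F0 z.1 z.2) G.ν := by
  have hs : 0 < -G.negBeta G.T0 := by have := hG.negBeta_neg hG.T0_pos; linarith
  have h := (hG.integrable_mul_exp hs hg hb).const_mul (1 / ((G.m * G.c) ^ 3 * G.Z G.T0))
  refine h.congr (Filter.Eventually.of_forall fun z => ?_)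
  simp only [hG.F0_eq, neg_neg]
  ring

theorem EnergyBounded.integrable_mul_F0 {g : V3 × ℝ → ℝ} (hg : G.EnergyBounded g)
    (hG : G.Admissible) : Integrable (fun z => g z * G.F0 z.1 z.2) G.ν := by
  obtain ⟨K, hK⟩ := hg.bound
  exact hG.integrable_mul_F0 hg.measurable (K := K) (k := 1) (by simpa using hK)

/-- `g² F_E⁰` is at most a multiple of the squared energy times `F_E⁰`, which is integrable.
Cauchy–Schwarz then bounds moments of `f √F_E⁰` by the `L²` norm of `f`. -/
theorem EnergyBounded.memLp {g : V3 × ℝ → ℝ} (hg : G.EnergyBounded g) (hG : G.Admissible) :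
    MemLp (fun z => G.sF0 z.1 z.2 * g z) 2 G.ν := by
  obtain ⟨K, hK⟩ := hg.bound
  have hm : AEStronglyMeasurable (fun z => G.sF0 z.1 z.2 * g z) G.ν :=
    (hG.measurable_sF0.mul hg.measurable).aestronglyMeasurable
  rw [memLp_two_iff_integrable_sq hm]
  refine (hG.integrable_mul_F0 (hg.measurable.pow_const 2) (K := K ^ 2) (k := 2)
    fun z hz => ?_).congr (Filter.Eventually.of_forall fun z => ?_)
  · rw [abs_pow, ← mul_pow]
    exact pow_le_pow_left₀ (abs_nonneg _) (hK z hz) 2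
  · simp only [mul_pow, hG.sF0_sq]
    ring

theorem SquareIntegrable.memLp {h : V3 → ℝ → ℝ} (hh : G.SquareIntegrable h) :
    MemLp (fun z : V3 × ℝ => h z.1 z.2) 2 G.ν := by
  rw [memLp_two_iff_integrable_sq hh.measurable.aestronglyMeasurable]
  refine ⟨(hh.measurable.pow_const 2).aestronglyMeasurable, ?_⟩
  have := hh.lt_top
  unfold normSq at this
  simpa [HasFiniteIntegral, enorm_pow] using this

theorem SquareIntegrable.integrable_mul {h : V3 → ℝ → ℝ} (hh : G.SquareIntegrable h)
    (hG : G.Admissible) {g : V3 × ℝ → ℝ} (hg : G.EnergyBounded g) :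
    Integrable (fun z => g z * (h z.1 z.2 * G.sF0 z.1 z.2)) G.ν := by
  have := hh.memLp.integrable_mul (hg.memLp hG)
  refine this.congr (Filter.Eventually.of_forall fun z => ?_)
  simp only [Pi.mul_apply]
  ring

theorem Admissible.enorm_integral_le (hG : G.Admissible) {h : V3 → ℝ → ℝ}
    (hh : Measurable fun z : V3 × ℝ => h z.1 z.2) {g : V3 × ℝ → ℝ} (hg : G.EnergyBounded g) :
    ‖∫ z, g z * (h z.1 z.2 * G.sF0 z.1 z.2) ∂G.ν‖ₑ
      ≤ (G.normSq h) ^ (1 / 2 : ℝ)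
        * (∫⁻ z, ‖G.sF0 z.1 z.2 * g z‖ₑ ^ (2 : ℝ) ∂G.ν) ^ (1 / 2 : ℝ) := by
  refine (enorm_integral_le_lintegral_enorm _).trans ?_
  have := ENNReal.lintegral_mul_le_Lp_mul_Lq G.ν Real.HolderConjugate.two_two
    (f := fun z : V3 × ℝ => ‖h z.1 z.2‖ₑ) (g := fun z => ‖G.sF0 z.1 z.2 * g z‖ₑ)
    hh.enorm.aemeasurable (hG.measurable_sF0.mul hg.measurable).enorm.aemeasurable
  refine le_trans (le_of_eq ?_) (this.trans (le_of_eq ?_))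
  · refine lintegral_congr fun z => ?_
    simp only [Pi.mul_apply, enorm_mul]
    ring
  · unfold normSq
    simp

open Filter Topology in
/-- Convergence to zero in `L²(φ(𝓘) d𝓘 dp)` of measurable functions. -/
def smallness (G : Gas) : Filter (V3 → ℝ → ℝ) :=
  comap G.normSq (𝓝 0) ⊓ 𝓟 {h | Measurable fun z : V3 × ℝ => h z.1 z.2}

/-- Limits of moments are combined in filter language; this recovers an explicit radius, from which
`δ` is taken. -/
theorem eventually_smallness_iff {Q : (V3 → ℝ → ℝ) → Prop} :
    (∀ᶠ h in G.smallness, Q h) ↔ ∃ ε : ℝ, 0 < ε ∧ ∀ h : V3 → ℝ → ℝ,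
      (Measurable fun z : V3 × ℝ => h z.1 z.2) → G.normSq h < ENNReal.ofReal ε → Q h := by
  unfold smallness
  rw [Filter.eventually_inf_principal]
  constructor
  · intro h
    rw [Filter.eventually_comap] at h
    obtain ⟨ε, hε, h2⟩ := (ENNReal.nhds_zero_basis.eventually_iff).1 h
    rcases eq_or_ne ε ⊤ with rfl | hne
    · refine ⟨1, one_pos, fun g hg hlt => h2 (hlt.trans ENNReal.ofReal_lt_top) g rfl hg⟩
    · refine ⟨ε.toReal, ENNReal.toReal_pos hε.ne' hne, fun g hg hlt => ?_⟩
      rw [ENNReal.ofReal_toReal hne] at hlt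
      exact h2 hlt g rfl hg
  · rintro ⟨ε, hε, h⟩
    rw [Filter.eventually_comap]
    filter_upwards [gt_mem_nhds (ENNReal.ofReal_pos.2 hε)] with a ha g hga hg
    exact h g hg (hga ▸ ha)

theorem eventually_squareIntegrable (G : Gas) : ∀ᶠ h in G.smallness, G.SquareIntegrable h :=
  eventually_smallness_iff.2 ⟨1, one_pos, fun _ hm hlt =>
    ⟨hm, hlt.trans ENNReal.ofReal_lt_top⟩⟩

theorem EnergyBounded.tendsto {g : V3 × ℝ → ℝ} (hg : G.EnergyBounded g) (hG : G.Admissible) :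
    Filter.Tendsto (fun h : V3 → ℝ → ℝ => ∫ z, g z * (h z.1 z.2 * G.sF0 z.1 z.2) ∂G.ν)
      G.smallness (nhds 0) := by
  set C := (∫⁻ z, ‖G.sF0 z.1 z.2 * g z‖ₑ ^ (2 : ℝ) ∂G.ν) ^ (1 / 2 : ℝ) with hC
  have hCfin : C ≠ ⊤ := by
    have h1 := (hg.memLp hG).eLpNorm_lt_top
    rw [eLpNorm_eq_lintegral_rpow_enorm_toReal (by simp) (by simp)] at h1
    simpa [hC] using h1.ne
  have h0 : Filter.Tendsto (fun h => (G.normSq h) ^ (1 / 2 : ℝ) * C) G.smallness (nhds 0) := by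
    have h1 : Filter.Tendsto G.normSq G.smallness (nhds 0) :=
      Filter.tendsto_comap.mono_left inf_le_left
    have h2 := (ENNReal.continuous_rpow_const (y := 1 / 2)).tendsto 0 |>.comp h1
    have h3 := ENNReal.Tendsto.mul_const (b := C) h2 (Or.inr hCfin)
    simpa using h3
  have h4 : Filter.Tendsto
      (fun h : V3 → ℝ → ℝ => ‖∫ z, g z * (h z.1 z.2 * G.sF0 z.1 z.2) ∂G.ν‖ₑ)
      G.smallness (nhds 0) := by
    refine tendsto_of_tendsto_of_tendsto_of_le_of_le' tendsto_const_nhds h0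
      (Filter.Eventually.of_forall fun _ => zero_le) ?_
    filter_upwards [G.eventually_squareIntegrable] with h hh
    exact hG.enorm_integral_le hh.measurable hg
  rw [tendsto_zero_iff_norm_tendsto_zero]
  have h5 := (ENNReal.continuousAt_toReal (by simp : (0 : ENNReal) ≠ ⊤)).tendsto.comp h4
  simpa [Function.comp_def] using h5

/-! ### Particle flux and energy-momentum tensor -/

/-- The particle flux. -/
def flux (G : Gas) (F : V3 → ℝ → ℝ) (μ : Fin 4) : ℝ :=
  G.mom fun p I => G.fourP p μ * F p I / G.p0 p

/-- The energy-momentum tensor. -/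
def stress (G : Gas) (F : V3 → ℝ → ℝ) (μ κ : Fin 4) : ℝ :=
  G.mom fun p I => G.fourP p μ * G.fourP p κ * F p I * G.wt I / G.p0 p

theorem Admissible.energyBounded_flux (hG : G.Admissible) (μ : Fin 4) :
    G.EnergyBounded fun z => G.fourP z.1 μ / G.p0 z.1 := by
  refine ⟨by fun_prop, 1 / (G.m * G.c ^ 2), fun z hz => ?_⟩
  have h1 := hG.p0_pos z.1
  have h2 := hG.mc2_pos
  rw [abs_div, abs_of_pos h1]
  refine (div_le_one_of_le₀ (G.abs_fourP_le _ _) h1.le).trans ?_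
  rw [one_div, ← div_eq_inv_mul, one_le_div h2]
  exact hG.le_energyAt hz

theorem Admissible.energyBounded_stress (hG : G.Admissible) (μ κ : Fin 4) :
    G.EnergyBounded fun z => G.fourP z.1 μ * G.fourP z.1 κ * G.wt z.2 / G.p0 z.1 := by
  refine ⟨by fun_prop, 1 / G.c, fun z hz => ?_⟩
  have h1 := hG.p0_pos z.1
  have h2 := hG.wt_pos hz
  have hc := hG.c_pos
  rw [abs_div, abs_of_pos h1, abs_mul, abs_mul, abs_of_pos h2, div_le_iff₀ h1]
  unfold energyAt
  calc _ ≤ G.p0 z.1 * G.p0 z.1 * G.wt z.2 := by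
        gcongr <;> exact G.abs_fourP_le _ _
    _ = _ := by field_simp

theorem Admissible.integrable_flux_F0 (hG : G.Admissible) (μ : Fin 4) :
    Integrable (fun z => G.fourP z.1 μ * G.F0 z.1 z.2 / G.p0 z.1) G.ν :=
  ((hG.energyBounded_flux μ).integrable_mul_F0 hG).congr
    (Filter.Eventually.of_forall fun z => by simp only []; ring)

theorem Admissible.integrable_stress_F0 (hG : G.Admissible) (μ κ : Fin 4) :
    Integrable (fun z => G.fourP z.1 μ * G.fourP z.1 κ * G.F0 z.1 z.2 * G.wt z.2 / G.p0 z.1)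
      G.ν :=
  ((hG.energyBounded_stress μ κ).integrable_mul_F0 hG).congr
    (Filter.Eventually.of_forall fun z => by simp only []; ring)

section Perturbation

variable {h : V3 → ℝ → ℝ}

/-- The part of the flux that is linear in the perturbation. -/
def fluxLin (G : Gas) (h : V3 → ℝ → ℝ) : Fin 4 → ℝ := G.flux fun p I => h p I * G.sF0 p I

/-- The part of the energy-momentum tensor that is linear in the perturbation. -/
def stressLin (G : Gas) (h : V3 → ℝ → ℝ) : Fin 4 → Fin 4 → ℝ :=
  G.stress fun p I => h p I * G.sF0 p I

theorem SquareIntegrable.integrable_fluxLin (hh : G.SquareIntegrable h) (hG : G.Admissible)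
    (μ : Fin 4) :
    Integrable (fun z => G.fourP z.1 μ * (h z.1 z.2 * G.sF0 z.1 z.2) / G.p0 z.1) G.ν :=
  (hh.integrable_mul hG (hG.energyBounded_flux μ)).congr
    (Filter.Eventually.of_forall fun z => by simp only []; ring)

theorem SquareIntegrable.integrable_stressLin (hh : G.SquareIntegrable h) (hG : G.Admissible)
    (μ κ : Fin 4) :
    Integrable (fun z => G.fourP z.1 μ * G.fourP z.1 κ * (h z.1 z.2 * G.sF0 z.1 z.2) * G.wt z.2
      / G.p0 z.1) G.ν :=
  (hh.integrable_mul hG (hG.energyBounded_stress μ κ)).congr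
    (Filter.Eventually.of_forall fun z => by simp only []; ring)

theorem SquareIntegrable.integrable_flux (hh : G.SquareIntegrable h) (hG : G.Admissible)
    (μ : Fin 4) :
    Integrable (fun z => G.fourP z.1 μ * G.pert h z.1 z.2 / G.p0 z.1) G.ν :=
  ((hG.integrable_flux_F0 μ).add (hh.integrable_fluxLin hG μ)).congr
    (Filter.Eventually.of_forall fun z => by simp only [pert, Pi.add_apply]; ring)

theorem SquareIntegrable.integrable_stress (hh : G.SquareIntegrable h) (hG : G.Admissible)
    (μ κ : Fin 4) :
    Integrable (fun z => G.fourP z.1 μ * G.fourP z.1 κ * G.pert h z.1 z.2 * G.wt z.2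
      / G.p0 z.1) G.ν :=
  ((hG.integrable_stress_F0 μ κ).add (hh.integrable_stressLin hG μ κ)).congr
    (Filter.Eventually.of_forall fun z => by simp only [pert, Pi.add_apply]; ring)

theorem SquareIntegrable.flux_pert (hh : G.SquareIntegrable h) (hG : G.Admissible) (μ : Fin 4) :
    G.flux (G.pert h) μ = G.flux G.F0 μ + G.fluxLin h μ := by
  unfold flux fluxLin flux mom
  rw [← integral_add (hG.integrable_flux_F0 μ) (hh.integrable_fluxLin hG μ)]
  congr 1; ext z; unfold pert; ring

theorem SquareIntegrable.stress_pert (hh : G.SquareIntegrable h) (hG : G.Admissible)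
    (μ κ : Fin 4) :
    G.stress (G.pert h) μ κ = G.stress G.F0 μ κ + G.stressLin h μ κ := by
  unfold stress stressLin stress mom
  rw [← integral_add (hG.integrable_stress_F0 μ κ) (hh.integrable_stressLin hG μ κ)]
  congr 1; ext z; unfold pert; ring

end Perturbation

theorem Admissible.tendsto_fluxLin (hG : G.Admissible) (μ : Fin 4) :
    Filter.Tendsto (fun h => G.fluxLin h μ) G.smallness (nhds 0) := by
  refine ((hG.energyBounded_flux μ).tendsto hG).congr fun h => ?_
  unfold fluxLin flux mom
  congr 1; ext z; ring

theorem Admissible.tendsto_stressLin (hG : G.Admissible) (μ κ : Fin 4) :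
    Filter.Tendsto (fun h => G.stressLin h μ κ) G.smallness (nhds 0) := by
  refine ((hG.energyBounded_stress μ κ).tendsto hG).congr fun h => ?_
  unfold stressLin stress mom
  congr 1; ext z; ring

/-! ### Moments of the global equilibrium -/

/-- The Jacobian of `p ↦ mc p` cancels the factor `(mc)³` in the normalization of `F_E⁰`. -/
theorem Admissible.integral_mul_F0 (hG : G.Admissible) (g : V3 × ℝ → ℝ) :
    ∫ z, g z * G.F0 z.1 z.2 ∂G.ν
      = (∫ z, g ((G.m * G.c) • z.1, z.2) * Real.exp (G.negBeta G.T0 * G.energyUnit z) ∂G.ν)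
        / G.Z G.T0 := by
  have h := G.integral_smul_fst hG.mc_pos (fun z => g z * Real.exp (G.negBeta G.T0 * G.energyAt z))
  simp only [hG.energyAt_smul] at h
  rw [h]
  simp only [hG.F0_eq]
  rw [← integral_const_mul, ← integral_div]
  congr 1; ext z
  have := (hG.Z_pos hG.T0_pos).ne'
  have := hG.mc_pos.ne'
  field_simp

theorem Admissible.flux_F0_zero (hG : G.Admissible) : G.flux G.F0 0 = 1 := by
  have h := hG.integral_mul_F0 fun _ => 1
  simp only [one_mul] at h
  have h2 : ∫ z, Real.exp (G.negBeta G.T0 * G.energyUnit z) ∂G.ν = G.Z G.T0 := (G.Z_eq_mgf _).symm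
  rw [h2, div_self (hG.Z_pos hG.T0_pos).ne'] at h
  rw [← h]
  unfold flux mom
  congr 1; ext z
  have := (hG.p0_pos z.1).ne'
  simp only [fourP, Fin.cons_zero]
  field_simp

theorem Admissible.stress_F0_zero (hG : G.Admissible) :
    G.c * G.stress G.F0 0 0 = G.eTilde G.T0 := by
  have h := hG.integral_mul_F0 G.energyAt
  simp only [hG.energyAt_smul] at h
  have hmem := hG.mem_interior_integrableExpSet (hG.negBeta_neg hG.T0_pos)
  rw [hG.eTilde_eq_deriv_cgf hG.T0_pos, deriv_cgf hmem, ← Z_eq_mgf, ← h]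
  unfold stress mom
  rw [← integral_const_mul]
  congr 1; ext z
  have := (hG.p0_pos z.1).ne'
  simp only [fourP, Fin.cons_zero, energyAt]
  field_simp

theorem p0_isometry (G : Gas) (A : V3 ≃ₗᵢ[ℝ] V3) (p : V3) : G.p0 (A p) = G.p0 p := by
  unfold p0; rw [A.norm_map]

theorem F0_isometry (G : Gas) (A : V3 ≃ₗᵢ[ℝ] V3) (p : V3) (I : ℝ) :
    G.F0 (A p) I = G.F0 p I := by
  unfold F0; rw [p0_isometry]

/-- Reflection in the `i`-th coordinate. -/
def reflectCoord (i : Fin 3) : V3 ≃ₗᵢ[ℝ] V3 :=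
  LinearIsometryEquiv.piLpCongrRight 2 fun k =>
    if k = i then LinearIsometryEquiv.neg ℝ else LinearIsometryEquiv.refl ℝ ℝ

theorem reflectCoord_self (i : Fin 3) (p : V3) : reflectCoord i p i = -p i := by
  simp [reflectCoord]

theorem reflectCoord_of_ne {i j : Fin 3} (hij : j ≠ i) (p : V3) : reflectCoord i p j = p j := by
  simp [reflectCoord, hij]

/-- `F_E⁰` depends on `p` through `|p|` only, so reflecting one coordinate kills every moment odd in
it; the mixed components of the tensor vanish likewise. -/
theorem flux_F0_succ (G : Gas) (i : Fin 3) : G.flux G.F0 i.succ = 0 := by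
  have h := G.integral_isometry (reflectCoord i)
    (fun z => G.fourP z.1 i.succ * G.F0 z.1 z.2 / G.p0 z.1)
  simp only [p0_isometry, F0_isometry, fourP, Fin.cons_succ, reflectCoord_self, neg_mul, neg_div,
    integral_neg] at h
  unfold flux mom
  simp only [fourP, Fin.cons_succ]
  linarith

theorem stress_F0_zero_succ (G : Gas) (i : Fin 3) : G.stress G.F0 0 i.succ = 0 := by
  have h := G.integral_isometry (reflectCoord i)
    (fun z => G.fourP z.1 0 * G.fourP z.1 i.succ * G.F0 z.1 z.2 * G.wt z.2 / G.p0 z.1)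
  simp only [p0_isometry, F0_isometry, fourP, Fin.cons_succ, Fin.cons_zero, reflectCoord_self,
    mul_neg, neg_mul, neg_div, integral_neg] at h
  unfold stress mom
  simp only [fourP, Fin.cons_succ, Fin.cons_zero]
  linarith

theorem stress_F0_of_ne (G : Gas) {i j : Fin 3} (hij : i ≠ j) :
    G.stress G.F0 i.succ j.succ = 0 := by
  have h := G.integral_isometry (reflectCoord j)
    (fun z => G.fourP z.1 i.succ * G.fourP z.1 j.succ * G.F0 z.1 z.2 * G.wt z.2 / G.p0 z.1)
  simp only [p0_isometry, F0_isometry, fourP, Fin.cons_succ, reflectCoord_self,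
    reflectCoord_of_ne hij, mul_neg, neg_mul, neg_div, integral_neg] at h
  unfold stress mom
  simp only [fourP, Fin.cons_succ]
  linarith

theorem stress_F0_diag_eq (G : Gas) (i j : Fin 3) :
    G.stress G.F0 i.succ i.succ = G.stress G.F0 j.succ j.succ := by
  have h := G.integral_isometry (LinearIsometryEquiv.piLpCongrLeft 2 ℝ ℝ (Equiv.swap i j))
    (fun z => G.fourP z.1 i.succ * G.fourP z.1 i.succ * G.F0 z.1 z.2 * G.wt z.2 / G.p0 z.1)
  simp only [p0_isometry, F0_isometry, fourP, Fin.cons_succ] at h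
  unfold stress mom
  simp only [fourP, Fin.cons_succ]
  rw [← h]
  simp [LinearIsometryEquiv.piLpCongrLeft_apply, Equiv.piCongrLeft']

/-- The normalization of `b₀`: enthalpy of the global equilibrium. -/
theorem Admissible.b0_eq (hG : G.Admissible) (i : Fin 3) :
    G.b0 * G.m * G.c
      = G.kB * G.T0 * (G.stress G.F0 i.succ i.succ + G.stress G.F0 0 0) := by
  have h := hG.integral_mul_F0 fun z => G.wt z.2 * (G.p0 z.1 + ‖z.1‖ ^ 2 / (3 * G.p0 z.1))
  have hm := hG.m_pos.ne'
  have hc := hG.c_pos.ne'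
  have hmc := hG.mc_pos
  have e : ∀ z : V3 × ℝ, G.wt z.2 * (G.p0 ((G.m * G.c) • z.1)
      + ‖(G.m * G.c) • z.1‖ ^ 2 / (3 * G.p0 ((G.m * G.c) • z.1)))
      = 1 / G.c * G.pressureWeight z := by
    intro z
    have hp : G.p0 ((G.m * G.c) • z.1) = G.m * G.c * Real.sqrt (1 + ‖z.1‖ ^ 2) := by
      unfold p0
      rw [norm_smul, Real.norm_of_nonneg hmc.le,
        show (G.m * G.c) ^ 2 + (G.m * G.c * ‖z.1‖) ^ 2 = (G.m * G.c) ^ 2 * (1 + ‖z.1‖ ^ 2) by ring,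
        Real.sqrt_mul (sq_nonneg _), Real.sqrt_sq hmc.le]
    have hs : Real.sqrt (1 + ‖z.1‖ ^ 2) ≠ 0 := by positivity
    rw [hp, norm_smul, Real.norm_of_nonneg hmc.le]
    unfold wt pressureWeight
    field_simp
  simp only [e] at h
  have h2 : ∫ z, 1 / G.c * G.pressureWeight z * Real.exp (G.negBeta G.T0 * G.energyUnit z) ∂G.ν
      = 1 / G.c * G.enthalpy G.T0 := by
    simp only [mul_assoc, integral_const_mul, enthalpy]
  rw [h2] at h
  -- By isotropy a single diagonal entry is a third of the spatial trace, whose weight is `|p|²/p⁰`.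
  -- This matches the energy-plus-pressure weight of the enthalpy.
  have h3 : ∫ z, G.wt z.2 * (G.p0 z.1 + ‖z.1‖ ^ 2 / (3 * G.p0 z.1)) * G.F0 z.1 z.2 ∂G.ν
      = G.stress G.F0 0 0 + (1 / 3) * ∑ j : Fin 3, G.stress G.F0 j.succ j.succ := by
    unfold stress mom
    rw [← integral_finsetSum _ fun j _ => hG.integrable_stress_F0 j.succ j.succ,
      ← integral_const_mul, ← integral_add (hG.integrable_stress_F0 0 0)
        ((integrable_finsetSum _ fun j _ => hG.integrable_stress_F0 j.succ j.succ).const_mul _)]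
    congr 1; ext z
    have hp := (hG.p0_pos z.1).ne'
    simp only [fourP, Fin.cons_succ, Fin.cons_zero, norm_sq_eq_sum, Fin.sum_univ_three]
    field_simp
  have h4 : ∑ j : Fin 3, G.stress G.F0 j.succ j.succ = 3 * G.stress G.F0 i.succ i.succ := by
    rw [Finset.sum_congr rfl fun j _ => G.stress_F0_diag_eq j i]
    simp
  rw [h3, h4] at h
  rw [show G.stress G.F0 i.succ i.succ + G.stress G.F0 0 0 = 1 / G.c * G.enthalpy G.T0 / G.Z G.T0
    by rw [← h]; ring, b0, hG.bCoef_eq 1 hG.T0_pos]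
  have hZ := (hG.Z_pos hG.T0_pos).ne'
  field_simp

end Gas

/-! ### Macroscopic fields of the perturbed distribution in terms of moments -/

/-- Lowering of the index of a four-vector. -/
def lower (a : Fin 4 → ℝ) : Fin 4 → ℝ := Fin.cons (a 0) fun i => -a i.succ

theorem mink_eq_sum_lower (a b : Fin 4 → ℝ) : mink a b = ∑ μ, lower a μ * b μ := by
  rw [Fin.sum_univ_succ]
  simp [mink, lower, sub_eq_add_neg]

namespace Gas

variable {G : Gas} {h : V3 → ℝ → ℝ}

/-- `S` and the integrals in `q` are contractions of the energy-momentum tensor, so their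
convergence and their values reduce to those of its components. -/
theorem SquareIntegrable.contract (hh : G.SquareIntegrable h) (hG : G.Admissible)
    (d d' : Fin 4 → ℝ) :
    Integrable (fun z => (∑ μ, d μ * G.fourP z.1 μ) * (∑ κ, d' κ * G.fourP z.1 κ)
        * G.pert h z.1 z.2 * G.wt z.2 / G.p0 z.1) G.ν ∧
      ∫ z, (∑ μ, d μ * G.fourP z.1 μ) * (∑ κ, d' κ * G.fourP z.1 κ)
        * G.pert h z.1 z.2 * G.wt z.2 / G.p0 z.1 ∂G.ν
        = ∑ μ, ∑ κ, d μ * d' κ * G.stress (G.pert h) μ κ := by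
  have e : ∀ z : V3 × ℝ, (∑ μ, d μ * G.fourP z.1 μ) * (∑ κ, d' κ * G.fourP z.1 κ)
        * G.pert h z.1 z.2 * G.wt z.2 / G.p0 z.1
      = ∑ μ, ∑ κ, d μ * d' κ * (G.fourP z.1 μ * G.fourP z.1 κ * G.pert h z.1 z.2 * G.wt z.2
        / G.p0 z.1) := by
    intro z
    rw [Finset.sum_mul_sum]
    simp only [Finset.sum_mul, Finset.sum_div]
    refine Finset.sum_congr rfl fun μ _ => Finset.sum_congr rfl fun κ _ => ?_
    ring
  simp only [e]
  have hi : ∀ μ κ, Integrable (fun z : V3 × ℝ => d μ * d' κ * (G.fourP z.1 μ * G.fourP z.1 κ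
      * G.pert h z.1 z.2 * G.wt z.2 / G.p0 z.1)) G.ν := fun μ κ =>
    (hh.integrable_stress hG μ κ).const_mul _
  refine ⟨integrable_finsetSum _ fun μ _ => integrable_finsetSum _ fun κ _ => hi μ κ, ?_⟩
  rw [integral_finsetSum _ fun μ _ => integrable_finsetSum _ fun κ _ => hi μ κ]
  refine Finset.sum_congr rfl fun μ _ => ?_
  rw [integral_finsetSum _ fun κ _ => hi μ κ]
  exact Finset.sum_congr rfl fun κ _ => integral_const_mul _ _

theorem SquareIntegrable.S2_integrable (hh : G.SquareIntegrable h) (hG : G.Admissible) :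
    Integrable (fun z => (mink (G.U (G.pert h)) (G.fourP z.1)) ^ 2 * G.pert h z.1 z.2 * G.wt z.2
      / G.p0 z.1) G.ν := by
  refine (hh.contract hG (lower (G.U (G.pert h))) (lower (G.U (G.pert h)))).1.congr
    (Filter.Eventually.of_forall fun z => ?_)
  simp only [← mink_eq_sum_lower, sq]

theorem SquareIntegrable.S2_eq (hh : G.SquareIntegrable h) (hG : G.Admissible) :
    G.S2 (G.pert h) = ∑ μ, ∑ κ, lower (G.U (G.pert h)) μ * lower (G.U (G.pert h)) κ
      * G.stress (G.pert h) μ κ := by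
  rw [← (hh.contract hG _ _).2]
  unfold S2 mom
  congr 1; ext z
  simp only [← mink_eq_sum_lower, sq]

theorem Admissible.flux_zero (hG : G.Admissible) (F : V3 → ℝ → ℝ) : G.flux F 0 = G.mom F := by
  unfold flux mom
  congr 1; ext z
  have := (hG.p0_pos z.1).ne'
  simp only [fourP, Fin.cons_zero]
  field_simp

theorem Admissible.a_eq (hG : G.Admissible) : G.a h = G.fluxLin h 0 := by
  unfold fluxLin
  rw [hG.flux_zero]; rfl

theorem w_eq (i : Fin 3) : G.w h i = G.fluxLin h i.succ := by
  unfold w fluxLin flux mom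
  congr 1; ext z
  simp only [fourP, Fin.cons_succ]; ring

theorem SquareIntegrable.flux_pert_zero (hh : G.SquareIntegrable h) (hG : G.Admissible) :
    G.flux (G.pert h) 0 = 1 + G.a h := by
  rw [hh.flux_pert hG, hG.flux_F0_zero, hG.a_eq]

theorem SquareIntegrable.flux_pert_succ (hh : G.SquareIntegrable h) (hG : G.Admissible)
    (i : Fin 3) : G.flux (G.pert h) i.succ = G.w h i := by
  rw [hh.flux_pert hG, G.flux_F0_succ, w_eq, zero_add]

theorem SquareIntegrable.n_pert (hh : G.SquareIntegrable h) (hG : G.Admissible) :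
    G.n (G.pert h) = Real.sqrt (1 + G.Ψ h) := by
  have h1 := hh.flux_pert_zero hG
  rw [hG.flux_zero] at h1
  have h2 : ∀ i : Fin 3, (G.mom fun p I => p i * G.pert h p I / G.p0 p) = G.w h i :=
    hh.flux_pert_succ hG
  unfold n Ψ
  simp only [h1, h2]
  congr 1; ring

theorem SquareIntegrable.U_pert_zero (hh : G.SquareIntegrable h) (hG : G.Admissible) :
    G.U (G.pert h) 0 = G.c / G.n (G.pert h) * (1 + G.a h) := by
  rw [← hh.flux_pert_zero hG]; rfl

theorem SquareIntegrable.U_pert_succ (hh : G.SquareIntegrable h) (hG : G.Admissible)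
    (i : Fin 3) : G.U (G.pert h) i.succ = G.c / G.n (G.pert h) * G.w h i := by
  rw [← hh.flux_pert_succ hG]; rfl

/-! ### Smallness of the macroscopic fields -/

theorem Admissible.tendsto_a (hG : G.Admissible) :
    Filter.Tendsto G.a G.smallness (nhds 0) :=
  (hG.tendsto_fluxLin 0).congr fun _ => hG.a_eq.symm

theorem Admissible.tendsto_w (hG : G.Admissible) (i : Fin 3) :
    Filter.Tendsto (fun h => G.w h i) G.smallness (nhds 0) :=
  (hG.tendsto_fluxLin i.succ).congr fun _ => (w_eq i).symm

theorem Admissible.tendsto_Ψ (hG : G.Admissible) : Filter.Tendsto G.Ψ G.smallness (nhds 0) := by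
  have h1 := hG.tendsto_a
  have h2 := (((h1.const_mul 2).add (h1.pow 2))).sub
    (tendsto_finsetSum Finset.univ fun i _ => (hG.tendsto_w i).pow 2)
  have h3 : Filter.Tendsto G.Ψ G.smallness
      (nhds (2 * 0 + 0 ^ 2 - ∑ _ : Fin 3, (0 : ℝ) ^ 2)) := h2
  simpa using h3

theorem Admissible.tendsto_n (hG : G.Admissible) :
    Filter.Tendsto (fun h => G.n (G.pert h)) G.smallness (nhds 1) := by
  have h1 := (hG.tendsto_Ψ.const_add 1).sqrt
  simp only [add_zero, Real.sqrt_one] at h1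
  refine h1.congr' ?_
  filter_upwards [G.eventually_squareIntegrable] with h hh
  exact (hh.n_pert hG).symm

theorem Admissible.tendsto_lower_U (hG : G.Admissible) (μ : Fin 4) :
    Filter.Tendsto (fun h => lower (G.U (G.pert h)) μ) G.smallness
      (nhds ((Fin.cons G.c 0 : Fin 4 → ℝ) μ)) := by
  have hn : Filter.Tendsto (fun h => G.c / G.n (G.pert h)) G.smallness (nhds G.c) := by
    have := (tendsto_const_nhds (x := G.c)).div hG.tendsto_n one_ne_zero
    rwa [div_one] at this
  refine Fin.cases ?_ (fun i => ?_) μ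
  · have h1 := hn.mul (hG.tendsto_a.const_add 1)
    simp only [add_zero, mul_one] at h1
    refine h1.congr' ?_
    filter_upwards [G.eventually_squareIntegrable] with h hh
    simp [lower, hh.U_pert_zero hG]
  · have h1 := (hn.mul (hG.tendsto_w i)).neg
    simp only [mul_zero, neg_zero] at h1
    refine h1.congr' ?_
    filter_upwards [G.eventually_squareIntegrable] with h hh
    simp [lower, hh.U_pert_succ hG]

/-- `S` is a polynomial in the velocity and the tensor. In the limit the velocity is `(c, 0, 0, 0)`,
so only `T^{00}` survives, and `c T^{00} = ẽ(T0)`. -/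
theorem Admissible.tendsto_energy_ratio (hG : G.Admissible) :
    Filter.Tendsto (fun h => G.e (G.pert h) / G.n (G.pert h)) G.smallness
      (nhds (G.eTilde G.T0)) := by
  have hT : ∀ μ κ, Filter.Tendsto (fun h => G.stress (G.pert h) μ κ) G.smallness
      (nhds (G.stress G.F0 μ κ)) := fun μ κ => by
    have h1 := (hG.tendsto_stressLin μ κ).const_add (G.stress G.F0 μ κ)
    rw [add_zero] at h1
    refine h1.congr' ?_
    filter_upwards [G.eventually_squareIntegrable] with h hh
    exact (hh.stress_pert hG μ κ).symm
  have hS := tendsto_finsetSum Finset.univ fun μ _ => tendsto_finsetSum Finset.univ fun κ _ =>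
    ((hG.tendsto_lower_U μ).mul (hG.tendsto_lower_U κ)).mul (hT μ κ)
  have hlim : ∑ μ : Fin 4, ∑ κ : Fin 4, (Fin.cons G.c 0 : Fin 4 → ℝ) μ
      * (Fin.cons G.c 0 : Fin 4 → ℝ) κ * G.stress G.F0 μ κ = G.c ^ 2 * G.stress G.F0 0 0 := by
    simp [Fin.sum_univ_succ, sq]
  rw [hlim] at hS
  have hS2 : Filter.Tendsto (fun h => G.S2 (G.pert h)) G.smallness
      (nhds (G.c ^ 2 * G.stress G.F0 0 0)) := by
    refine hS.congr' ?_
    filter_upwards [G.eventually_squareIntegrable] with h hh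
    exact (hh.S2_eq hG).symm
  have h3 := (hS2.const_mul (1 / G.c)).div hG.tendsto_n one_ne_zero
  have hc := hG.c_pos.ne'
  rw [show 1 / G.c * (G.c ^ 2 * G.stress G.F0 0 0) / 1 = G.eTilde G.T0 by
    rw [← hG.stress_F0_zero]; field_simp] at h3
  exact h3

/-! ### Near-equilibrium perturbations -/

/-- A perturbation whose macroscopic fields are close to those of the global equilibrium. -/
structure NearEquilibrium (G : Gas) (h : V3 → ℝ → ℝ) : Prop where
  squareIntegrable : G.SquareIntegrable h
  a_gt : -1 < G.a h
  Ψ_gt : -(1 / 2) < G.Ψ h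
  Ψ_lt : G.Ψ h < 1 / 2
  temperature : ∀ θ ∈ Icc (0 : ℝ) 1, ∃ T, 0 < T ∧ G.eTilde T
    = G.eTilde G.T0 + θ * (G.e (G.pert h) / G.n (G.pert h) - G.eTilde G.T0)

/-- The energies having a temperature contain a ball about `ẽ(T0)`. A ball is star-shaped about its
centre, so one radius serves every `θ`. -/
theorem Admissible.eventually_nearEquilibrium (hG : G.Admissible) :
    ∀ᶠ h in G.smallness, G.NearEquilibrium h := by
  obtain ⟨ε, hε, hball⟩ := Metric.eventually_nhds_iff.1 (hG.temp_smooth hG.T0_pos).2.2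
  filter_upwards [G.eventually_squareIntegrable,
    hG.tendsto_a.eventually (lt_mem_nhds (by norm_num : (-1 : ℝ) < 0)),
    hG.tendsto_Ψ.eventually (lt_mem_nhds (by norm_num : (-(1 / 2) : ℝ) < 0)),
    hG.tendsto_Ψ.eventually (gt_mem_nhds (by norm_num : (0 : ℝ) < 1 / 2)),
    hG.tendsto_energy_ratio.eventually (Metric.ball_mem_nhds _ hε)] with h h1 h2 h3 h4 h5
  refine ⟨h1, h2, h3, h4, fun θ hθ => ?_⟩
  have h6 := hball (y := G.eTilde G.T0
      + θ * (G.e (G.pert h) / G.n (G.pert h) - G.eTilde G.T0)) (by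
    rw [Real.dist_eq, add_sub_cancel_left, abs_mul, abs_of_nonneg hθ.1]
    rw [Real.dist_eq] at h5
    exact (mul_le_of_le_one_left (abs_nonneg _) hθ.2).trans_lt h5)
  exact ⟨_, h6⟩

namespace NearEquilibrium

theorem n_pos (hE : G.NearEquilibrium h) (hG : G.Admissible) : 0 < G.n (G.pert h) := by
  rw [hE.squareIntegrable.n_pert hG]
  exact Real.sqrt_pos.2 (by linarith [hE.Ψ_gt])

theorem n_sq (hE : G.NearEquilibrium h) (hG : G.Admissible) : G.n (G.pert h) ^ 2 = 1 + G.Ψ h := by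
  rw [hE.squareIntegrable.n_pert hG]
  exact Real.sq_sqrt (by linarith [hE.Ψ_gt])

theorem exists_temp (hE : G.NearEquilibrium h) (hG : G.Admissible) : 0 < G.tempOf (G.pert h) ∧
    G.eTilde (G.tempOf (G.pert h)) = G.e (G.pert h) / G.n (G.pert h) := by
  obtain ⟨T, hT, h1⟩ := hE.temperature 1 (by simp)
  rw [one_mul, add_sub_cancel] at h1
  unfold tempOf
  rw [← h1, hG.temp_eTilde hT]
  exact ⟨hT, rfl⟩

/-- `2 + Ψ - Ψ² = (2 - Ψ)(1 + Ψ)` is positive in this range of `Ψ`. -/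
theorem den_pos (hE : G.NearEquilibrium h) : 0 < G.den h := by
  unfold den
  have := Real.sqrt_nonneg (1 + G.Ψ h)
  nlinarith [hE.Ψ_gt, hE.Ψ_lt]

/-- By the definition of `n` the velocity has Minkowski square `c²`, and `A > -1` fixes the sign of
its time component. Its spatial part therefore determines it, which makes `M` a function of nine
fields. -/
theorem fourU_eq (hE : G.NearEquilibrium h) (hG : G.Admissible) :
    G.fourU (WithLp.toLp 2 fun i : Fin 3 => G.U (G.pert h) i.succ)
    = G.U (G.pert h) := by
  have hn := hE.n_pos hG
  have hs := hE.n_sq hG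
  have hc := hG.c_pos
  have ha := hE.a_gt
  ext μ
  refine Fin.cases ?_ (fun i => ?_) μ
  · simp only [fourU, Fin.cons_zero]
    rw [hE.squareIntegrable.U_pert_zero hG, norm_sq_eq_sum]
    refine (Real.sqrt_eq_iff_eq_sq (by positivity) ?_).2 ?_
    · exact mul_nonneg (div_nonneg hc.le hn.le) (by linarith)
    · simp only [hE.squareIntegrable.U_pert_succ hG, mul_pow, ← Finset.mul_sum]
      unfold Ψ at hs
      have hsum : ∑ i : Fin 3, G.w h i ^ 2 = (1 + G.a h) ^ 2 - G.n (G.pert h) ^ 2 := by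
        rw [hs]; ring
      rw [hsum]
      field_simp
      ring
  · simp [fourU]

theorem contDiffAt (hE : G.NearEquilibrium h) (hG : G.Admissible) (p : V3) (I : ℝ)
    {θ : ℝ} (hθ : θ ∈ Icc (0 : ℝ) 1) :
    ContDiffAt ℝ 2 (G.Ftilde p I)
      (G.fields0 + θ • (G.fieldsOf (G.pert h) - G.fields0)) := by
  obtain ⟨T, hT, hTe⟩ := hE.temperature θ hθ
  refine hG.contDiffAt_Ftilde p I ?_ hT hTe.symm
  have hn := hE.n_pos hG
  change 0 < 1 + θ * (G.n (G.pert h) - 1)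
  rcases hθ.2.lt_or_eq with h1 | h1
  · have := mul_nonneg hθ.1 hn.le
    linarith
  · rw [h1]; linarith

theorem wellDefined (hE : G.NearEquilibrium h) (hG : G.Admissible) : G.WellDefined h where
  flux μ := hE.squareIntegrable.integrable_flux hG μ
  stress μ κ := hE.squareIntegrable.integrable_stress hG μ κ
  n_pos := hE.n_pos hG
  temp_unique := ⟨_, hE.exists_temp hG, fun _ hT =>
    hG.strictMonoOn_eTilde.injOn hT.1 (hE.exists_temp hG).1
      (hT.2.trans (hE.exists_temp hG).2.symm)⟩
  b_pos := by
    rw [hG.bCoef_eq _ (hE.exists_temp hG).1]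
    exact mul_pos (hE.n_pos hG) (hG.bUnit_pos (hE.exists_temp hG).1)
  b0_pos := by
    rw [b0, hG.bCoef_eq _ hG.T0_pos, one_mul]
    exact hG.bUnit_pos hG.T0_pos
  deriv_eTilde_pos := hG.deriv_eTilde_pos hG.T0_pos
  Ψ_pos := by linarith [hE.Ψ_gt]
  den_pos := hE.den_pos
  smooth p I _ θ hθ := by
    rw [fieldsθ_eq]
    exact hE.contDiffAt hG p I hθ

/-! ### Decomposition of the first-order terms -/

/-- `-R` is the exact remainder of the expansion `1 - Ψ/2` of `(1+Ψ)^{-1/2}`. With `Ψ = n² - 1` this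
is a polynomial identity in `n`. -/
theorem inv_n (hE : G.NearEquilibrium h) (hG : G.Admissible) :
    1 / G.n (G.pert h) = 1 - (G.Ψ h / 2 + G.R h) := by
  have hn := hE.n_pos hG
  have hs := hE.n_sq hG
  have hd := (hE.den_pos).ne'
  have hR : G.R h * (2 * G.den h) = G.Ψ h ^ 3 - 3 * G.Ψ h ^ 2 := by
    unfold R; field_simp
  have hden : G.den h = 2 + G.Ψ h - G.Ψ h ^ 2 + 2 * G.n (G.pert h) := by
    rw [den, hE.squareIntegrable.n_pert hG]
  have hΨ : G.Ψ h = G.n (G.pert h) ^ 2 - 1 := by linarith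
  set s := G.n (G.pert h)
  rw [eq_comm, eq_div_iff hn.ne']
  refine mul_right_cancel₀ (mul_ne_zero two_ne_zero hd) ?_
  calc (1 - (G.Ψ h / 2 + G.R h)) * s * (2 * G.den h)
      = (1 - G.Ψ h / 2) * s * (2 * G.den h) - s * (G.R h * (2 * G.den h)) := by ring
    _ = 1 * (2 * G.den h) := by rw [hR, hden, hΨ]; ring

/-- The denominator in `Γ₁` is `2(1+n)²`, so `Γ₁` carries the exact remainder of `√(1+Ψ) - 1` beyond
`A`. -/
theorem n_sub_one (hE : G.NearEquilibrium h) (hG : G.Admissible) (p : V3) (I : ℝ) :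
    G.a h * G.sF0 p I + G.Γ₁ h p I = (G.n (G.pert h) - 1) * G.sF0 p I := by
  have hn := hE.n_pos hG
  have hs := hE.n_sq hG
  have h1 : G.Ψ₁ h = G.Ψ h - 2 * G.a h := by unfold Ψ₁ Ψ; ring
  have hΨ : G.Ψ h = G.n (G.pert h) ^ 2 - 1 := by linarith
  unfold Γ₁
  rw [h1, ← hE.squareIntegrable.n_pert hG, hΨ]
  set s := G.n (G.pert h)
  rw [show 2 + (s ^ 2 - 1) + 2 * s = (1 + s) ^ 2 by ring]
  have : 1 + s ≠ 0 := by positivity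
  field_simp
  ring

/-- `2cp⁰Φ + Φ² = (U_μ p^μ)² - (cp⁰)²`. -/
theorem mom_quadratic (hE : G.NearEquilibrium h) (hG : G.Admissible) : (G.mom fun p I =>
      (2 * G.c * G.p0 p * G.Φ h p + G.Φ h p ^ 2) * G.pert h p I * G.wt I / G.p0 p)
    = G.S2 (G.pert h) - G.c ^ 2 * G.stress (G.pert h) 0 0 := by
  unfold S2 stress mom
  rw [← integral_const_mul, ← integral_sub (hE.squareIntegrable.S2_integrable hG)
    ((hE.squareIntegrable.integrable_stress hG 0 0).const_mul _)]
  congr 1; ext z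
  simp only [Φ, fourP, Fin.cons_zero]
  ring

theorem _root_.RelBGK.Gas.Admissible.mom_energy (hG : G.Admissible) :
    (G.mom fun p I => G.p0 p * h p I * G.sF0 p I * G.wt I)
    = G.stressLin h 0 0 := by
  unfold stressLin stress mom
  congr 1; ext z
  have := (hG.p0_pos z.1).ne'
  simp only [fourP, Fin.cons_zero]
  field_simp

theorem ip_e5 (hE : G.NearEquilibrium h) (hG : G.Admissible) : G.ip h G.e5
    = Real.sqrt (1 / (G.kB * G.T0 ^ 2 * deriv G.eTilde G.T0))
    * (G.c * G.stressLin h 0 0 - G.eTilde G.T0 * G.a h) := by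
  have i1 := hE.squareIntegrable.integrable_stressLin hG 0 0
  have i2 := hE.squareIntegrable.integrable_fluxLin hG 0
  rw [hG.a_eq]
  unfold ip stressLin fluxLin stress flux mom
  rw [← integral_const_mul, ← integral_const_mul, ← integral_sub (i1.const_mul _)
    (i2.const_mul _), ← integral_const_mul]
  congr 1; ext z
  have := (hG.p0_pos z.1).ne'
  simp only [fourP, Fin.cons_zero, e5, enDev]
  field_simp

theorem _root_.RelBGK.Gas.Admissible.ip_e234 (hG : G.Admissible) (i : Fin 3) : G.ip h (G.e234 i)
    = Real.sqrt (1 / (G.b0 * G.m)) * G.stressLin h 0 i.succ := by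
  unfold ip stressLin stress mom
  rw [← integral_const_mul]
  congr 1; ext z
  have := (hG.p0_pos z.1).ne'
  simp only [fourP, Fin.cons_zero, Fin.cons_succ, e234]
  field_simp

/-- To first order `e/n - ẽ(T0)` is the energy moment of `f` minus `ẽ(T0) A`, the second term coming
from the expansion of `1/n`. This is the `e₅` coefficient up to normalization; `Γ₂` collects the
rest exactly. -/
theorem energy_deviation (hE : G.NearEquilibrium h) (hG : G.Admissible) (p : V3) (I : ℝ) :
    G.ip h G.e5 * G.e5 p I + G.Γ₂ h p I
      = G.enDev p I / (G.kB * G.T0 ^ 2 * deriv G.eTilde G.T0)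
        * (G.e (G.pert h) / G.n (G.pert h) - G.eTilde G.T0) * G.sF0 p I := by
  have hk := hG.kB_pos
  have hT := hG.T0_pos
  have hd := hG.deriv_eTilde_pos hG.T0_pos
  have hc := hG.c_pos.ne'
  have hsq : Real.sqrt (1 / (G.kB * G.T0 ^ 2 * deriv G.eTilde G.T0))
      * Real.sqrt (1 / (G.kB * G.T0 ^ 2 * deriv G.eTilde G.T0))
      = 1 / (G.kB * G.T0 ^ 2 * deriv G.eTilde G.T0) := Real.mul_self_sqrt (by positivity)
  have h1 : G.Ψ h = 2 * G.a h + G.Ψ₁ h := by unfold Ψ₁ Ψ; ring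
  have hratio : G.e (G.pert h) / G.n (G.pert h)
      = 1 / G.c * G.S2 (G.pert h) * (1 - (G.a h + G.Ψ₁ h / 2 + G.R h)) := by
    rw [div_eq_mul_one_div, hE.inv_n hG, h1]
    unfold e; ring
  unfold Γ₂
  rw [hE.ip_e5 hG, hE.mom_quadratic hG, hG.mom_energy, hratio,
    hE.squareIntegrable.stress_pert hG, ← hG.stress_F0_zero]
  unfold e5
  set σ := Real.sqrt (1 / (G.kB * G.T0 ^ 2 * deriv G.eTilde G.T0))
  have hre : ∀ A B C : ℝ, σ * A * (σ * B * C)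
      = 1 / (G.kB * G.T0 ^ 2 * deriv G.eTilde G.T0) * A * B * C := fun A B C => by
    linear_combination (A * B * C) * hsq
  rw [hre]
  field_simp
  ring

theorem heatFlux_mom (hE : G.NearEquilibrium h) (hG : G.Admissible) (j : Fin 3) :
    Integrable (fun z => z.1 j * mink (G.U (G.pert h)) (G.fourP z.1) * G.pert h z.1 z.2
      * G.wt z.2 / G.p0 z.1) G.ν := by
  refine (hE.squareIntegrable.contract hG (Pi.single j.succ 1)
    (lower (G.U (G.pert h)))).1.congr (Filter.Eventually.of_forall fun z => ?_)
  simp only [← mink_eq_sum_lower, Pi.single_apply, ite_mul, one_mul, zero_mul,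
    Finset.sum_ite_eq', Finset.mem_univ, if_true, fourP, Fin.cons_succ]

theorem mom_Φ₁ (hE : G.NearEquilibrium h) (hG : G.Admissible) (j : Fin 3) :
    (G.mom fun p I => p j * G.Φ₁ h p * G.pert h p I * G.wt I / G.p0 p)
      = (G.mom fun p I => p j * mink (G.U (G.pert h)) (G.fourP p) * G.pert h p I * G.wt I / G.p0 p)
        - G.c * G.stress (G.pert h) 0 j.succ
        + G.c * ∑ i : Fin 3, G.w h i * G.stress (G.pert h) j.succ i.succ := by
  have i1 := hE.heatFlux_mom hG j
  have i2 := (hE.squareIntegrable.integrable_stress hG 0 j.succ).const_mul G.c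
  have i3 : ∀ i : Fin 3, Integrable _ G.ν := fun i =>
    (hE.squareIntegrable.integrable_stress hG j.succ i.succ).const_mul (G.w h i)
  have i4 := (integrable_finsetSum Finset.univ fun i _ => i3 i).const_mul G.c
  unfold stress mom
  simp only [← integral_const_mul]
  have e := integral_add (i1.sub i2) i4
  simp only [Pi.sub_apply] at e
  rw [← integral_finsetSum _ fun i _ => i3 i, ← integral_const_mul, ← integral_sub i1 i2, ← e]
  congr 1; ext z
  simp only [Φ₁, fourP, Fin.cons_zero, Fin.cons_succ, Fin.sum_univ_three]
  ring

theorem mom_cubic (hE : G.NearEquilibrium h) (hG : G.Admissible) :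
    (G.mom fun p I => (G.c ^ 2 * G.p0 p * h p I * G.sF0 p I
      + 1 / G.p0 p * (2 * G.c * G.p0 p * G.Φ h p + G.Φ h p ^ 2) * G.pert h p I) * G.wt I)
      = G.S2 (G.pert h) - G.c ^ 2 * G.stress G.F0 0 0 := by
  have i1 := (hE.squareIntegrable.integrable_stress hG 0 0).const_mul (G.c ^ 2)
  have i2 := (hE.squareIntegrable.integrable_stressLin hG 0 0).const_mul (G.c ^ 2)
  have i3 := hE.squareIntegrable.S2_integrable hG
  have e : G.S2 (G.pert h) - G.c ^ 2 * G.stress G.F0 0 0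
      = G.S2 (G.pert h) - G.c ^ 2 * G.stress (G.pert h) 0 0 + G.c ^ 2 * G.stressLin h 0 0 := by
    rw [hE.squareIntegrable.stress_pert hG]; ring
  rw [e]
  unfold S2 stressLin stress mom
  have e := integral_add (i3.sub i1) i2
  simp only [Pi.sub_apply] at e
  rw [← integral_const_mul, ← integral_const_mul, ← integral_sub i3 i1, ← e]
  congr 1; ext z
  have := (hG.p0_pos z.1).ne'
  simp only [Φ, fourP, Fin.cons_zero]
  field_simp
  ring

/-- `Γ₃*` is the spatial heat flux minus its linear part. That part has two sources: the momentum
moment of `f` at rest velocity, and the velocity perturbation `w` acting on the equilibrium tensor,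
where only diagonal entries survive. -/
theorem Γ₃star_eq (hE : G.NearEquilibrium h) (hG : G.Admissible) (j : Fin 3) :
    G.Γ₃star h j = G.q (G.pert h) j.succ - G.c ^ 2 * G.stressLin h 0 j.succ
      + G.c ^ 2 * G.w h j * (G.stress G.F0 j.succ j.succ + G.stress G.F0 0 0) := by
  have hc := hG.c_pos.ne'
  have hn := (hE.n_pos hG).ne'
  have hstress : ∀ i : Fin 3, (G.mom fun p I => p j * p i * h p I * G.sF0 p I * G.wt I / G.p0 p)
      = G.stressLin h j.succ i.succ := by
    intro i
    unfold stressLin stress mom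
    congr 1; ext z
    simp only [fourP, Fin.cons_succ]; ring
  have hq : G.q (G.pert h) j.succ = G.c * (G.mom fun p I =>
      p j * mink (G.U (G.pert h)) (G.fourP p) * G.pert h p I * G.wt I / G.p0 p)
      - G.w h j * (1 - (G.Ψ h / 2 + G.R h)) * G.S2 (G.pert h) := by
    rw [← hE.inv_n hG]
    unfold q
    rw [hE.squareIntegrable.U_pert_succ hG]
    simp only [fourP, Fin.cons_succ]
    field_simp
  have hdiag : ∑ i : Fin 3, G.w h i * G.stress (G.pert h) j.succ i.succ
      = G.w h j * G.stress G.F0 j.succ j.succ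
        + ∑ i : Fin 3, G.w h i * G.stressLin h j.succ i.succ := by
    simp only [hE.squareIntegrable.stress_pert hG, mul_add, Finset.sum_add_distrib]
    congr 1
    rw [Finset.sum_eq_single j]
    · intro i _ hij
      rw [G.stress_F0_of_ne (Ne.symm hij), mul_zero]
    · simp
  unfold Γ₃star
  rw [hE.mom_Φ₁ hG, hE.mom_cubic hG, hdiag, hq, hE.squareIntegrable.stress_pert hG 0 j.succ,
    G.stress_F0_zero_succ]
  simp only [hstress]
  ring

/-- By `b0_eq` the `w`-term of the heat flux, divided by `b₀ m c²`, is exactly opposite to the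
linear velocity term `c ω w·p/(kB T0)`. What remains linear is the momentum moment of `f`, which is
the projection on `e₂, e₃, e₄`. -/
theorem momentum_deviation (hE : G.NearEquilibrium h) (hG : G.Admissible) (p : V3) (I : ℝ) :
    ∑ i : Fin 3, G.ip h (G.e234 i) * G.e234 i p I + G.Γ₃ h p I
      = (G.wt I / (G.kB * G.T0) * ∑ i : Fin 3, G.U (G.pert h) i.succ * p i
        - mink (G.fourP p) (G.q (G.pert h)) * (G.wt I / (G.b0 * G.m * G.c ^ 2))) * G.sF0 p I := by
  have hb := (hE.wellDefined hG).b0_pos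
  have hm := hG.m_pos
  have hc := hG.c_pos
  have hk := hG.kB_pos
  have hT := hG.T0_pos
  have hsq : Real.sqrt (1 / (G.b0 * G.m)) * Real.sqrt (1 / (G.b0 * G.m)) = 1 / (G.b0 * G.m) :=
    Real.mul_self_sqrt (by positivity)
  have hU : ∀ i : Fin 3, G.U (G.pert h) i.succ = G.c * (1 - (G.Ψ h / 2 + G.R h)) * G.w h i := by
    intro i
    rw [hE.squareIntegrable.U_pert_succ hG, ← hE.inv_n hG]; ring
  have key : ∀ i : Fin 3, G.ip h (G.e234 i) * G.e234 i p I
      + G.wt I / (G.b0 * G.m * G.c ^ 2) * (G.Γ₃star h i * p i) * G.sF0 p I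
      = (G.c * (G.wt I / (G.kB * G.T0)) * (G.w h i * p i)
        + p i * G.q (G.pert h) i.succ * (G.wt I / (G.b0 * G.m * G.c ^ 2))) * G.sF0 p I := by
    intro i
    have hB := hG.b0_eq i
    rw [hG.ip_e234, hE.Γ₃star_eq hG]
    unfold e234
    set B := G.stress G.F0 i.succ i.succ + G.stress G.F0 0 0
    have hB' : B = G.b0 * G.m * G.c / (G.kB * G.T0) := by
      rw [hB]; field_simp
    rw [hB']
    set σ := Real.sqrt (1 / (G.b0 * G.m))
    have hre : ∀ A B C D : ℝ, σ * A * (σ * B * C * D) = 1 / (G.b0 * G.m) * A * B * C * D :=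
      fun A B C D => by linear_combination (A * B * C * D) * hsq
    rw [hre]
    field_simp
    ring
  have hsum := Finset.sum_congr (rfl : (Finset.univ : Finset (Fin 3)) = Finset.univ)
    fun i _ => key i
  rw [Finset.sum_add_distrib, ← Finset.sum_mul, ← Finset.mul_sum, ← Finset.sum_mul,
    Finset.sum_add_distrib, ← Finset.mul_sum, ← Finset.sum_mul] at hsum
  have hUsum : ∑ i : Fin 3, G.U (G.pert h) i.succ * p i
      = G.c * (1 - (G.Ψ h / 2 + G.R h)) * ∑ i : Fin 3, G.w h i * p i := by
    rw [Finset.mul_sum]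
    exact Finset.sum_congr rfl fun i _ => by rw [hU]; ring
  rw [hUsum, mink_fourP]
  unfold Γ₃
  linear_combination hsum

/-- The linearization of the modified equilibrium. -/
theorem modEqOf_sub_F0 (hE : G.NearEquilibrium h) (hG : G.Admissible) (p : V3) (I : ℝ) :
    G.modEqOf (G.pert h) p I - G.F0 p I
      = (G.P h p I + G.Γsum h p I) * Real.sqrt (G.F0 p I) := by
  have hmod : G.modEqOf (G.pert h) p I = G.Ftilde p I (G.fieldsOf (G.pert h)) := by
    unfold Ftilde fieldsOf modEqOf tempOf
    simp only [hE.fourU_eq hG]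
  have ht := taylor_segment fun θ hθ => hE.contDiffAt hG p I hθ
  rw [add_sub_cancel, hG.Ftilde_fields0, hG.fderiv_Ftilde, ← hmod] at ht
  have hs := hG.sF0_pos p I
  have h4 : G.Γ₄ h p I * G.sF0 p I = ∫ θ in (0 : ℝ)..1, (1 - θ) *
      fderiv ℝ (fderiv ℝ (G.Ftilde p I))
        (G.fields0 + θ • (G.fieldsOf (G.pert h) - G.fields0))
        (G.fieldsOf (G.pert h) - G.fields0) (G.fieldsOf (G.pert h) - G.fields0) := by
    unfold Γ₄
    simp only [fieldsθ_eq]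
    field_simp
  rw [← h4, ← hG.sF0_sq] at ht
  have v1 : (G.fieldsOf (G.pert h) - G.fields0).1 = G.n (G.pert h) - 1 := rfl
  have v2 : ∀ i : Fin 3, (G.fieldsOf (G.pert h) - G.fields0).2.1 i = G.U (G.pert h) i.succ :=
    fun i => by simp [fieldsOf, fields0]
  have v3 : (G.fieldsOf (G.pert h) - G.fields0).2.2.1
      = G.e (G.pert h) / G.n (G.pert h) - G.eTilde G.T0 := rfl
  have v4 : (G.fieldsOf (G.pert h) - G.fields0).2.2.2 = G.q (G.pert h) := by
    simp [fieldsOf, fields0]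
  simp only [v1, v2, v3, v4] at ht
  have d1 := hE.n_sub_one hG p I
  have d2 := hE.energy_deviation hG p I
  have d3 := hE.momentum_deviation hG p I
  have hP : G.P h p I = G.a h * G.sF0 p I + ∑ i : Fin 3, G.ip h (G.e234 i) * G.e234 i p I
      + G.ip h G.e5 * G.e5 p I := rfl
  have hroot : Real.sqrt (G.F0 p I) = G.sF0 p I := rfl
  rw [ht, hroot, hP]
  unfold Γsum
  rw [← hG.sF0_sq]
  linear_combination (-G.sF0 p I) * d1 - G.sF0 p I * d2 - G.sF0 p I * d3

end NearEquilibrium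

/-! ### The equation for the perturbation -/

/-- `F_E⁰` is constant in `(t, x)`, so it drops out and its root factors out of every derivative; no
differentiability of `f` is needed. -/
theorem transport_pertST (G : Gas) (S : Set ℝ) (f : STFun) (t : ℝ) (x p : V3) (I : ℝ) :
    G.transport S (G.pertST f) t x p I = G.transport S f t x p I * G.sF0 p I := by
  have h1 : dt S (G.pertST f) t x p I = dt S f t x p I * G.sF0 p I := by
    simp only [dt, pertST, pert, derivWithin_const_add, derivWithin_mul_const_field]
  have h2 : ∀ i, dx i (G.pertST f) t x p I = dx i f t x p I * G.sF0 p I := fun i => by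
    simp only [dx, pertST, pert, lineDeriv, deriv_const_add', deriv_mul_const_field]
  unfold transport
  simp only [h1, h2, add_mul, Finset.sum_mul, mul_assoc]

/-- Since `U_μ p^μ/(cp⁰) = 1 + Φ/(cp⁰)`, the collision factor times `P(f) - f + ∑ Γ_i` equals `L(f)
+ Γ(f)`. Division by `√F_E⁰ > 0` gives both directions. -/
theorem NearEquilibrium.BGKAt_iff_LinAt (hG : G.Admissible) {f : STFun} {t : ℝ} {x : V3}
    (hE : G.NearEquilibrium (f t x)) {τ : ℝ} (hτ : 0 < τ) (S : Set ℝ) (p : V3) (I : ℝ) :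
    G.BGKAt τ S (G.pertST f) t x p I ↔ G.LinAt τ S f t x p I := by
  have hs := (hG.sF0_pos p I).ne'
  have hc := hG.c_pos.ne'
  have hp := (hG.p0_pos p).ne'
  have h1 : G.modEqOf (G.pert (f t x)) p I - G.pert (f t x) p I
      = (G.P (f t x) p I + G.Γsum (f t x) p I - f t x p I) * G.sF0 p I := by
    have h2 := hE.modEqOf_sub_F0 hG p I
    have hroot : Real.sqrt (G.F0 p I) = G.sF0 p I := rfl
    rw [hroot] at h2
    unfold pert at h2 ⊢
    linear_combination h2
  have h3 : 1 / τ * (G.L (f t x) p I + G.Γ (f t x) p I)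
      = mink (G.U (G.pert (f t x))) (G.fourP p) / (G.c * τ * G.p0 p)
        * (G.P (f t x) p I + G.Γsum (f t x) p I - f t x p I) := by
    unfold L Γ Φ
    field_simp
    ring
  unfold BGKAt LinAt
  rw [transport_pertST, h3]
  simp only [pertST]
  rw [h1, ← mul_assoc, mul_left_inj' hs]

end Gas

end

end RelBGK

/-! ### Proof of the proposition -/

theorem proposition3p3 (G : RelBGK.Gas) (hG : G.Admissible) (N : ℕ) (hN : 3 ≤ N) :
    ∃ δ : ℝ, 0 < δ ∧
      ∀ (S : Set ℝ), RelBGK.IsTimeInterval S →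
      ∀ (f : RelBGK.STFun), RelBGK.IsClassical N S f →
        (∀ t ∈ S, G.energy N S f t < ENNReal.ofReal δ →
          ∀ x : RelBGK.V3,
            G.WellDefined (f t x) ∧
            (∀ (p : RelBGK.V3) (I : ℝ), 0 < I →
              G.modEqOf (G.pert (f t x)) p I - G.F0 p I
                = (G.P (f t x) p I + G.Γsum (f t x) p I) * Real.sqrt (G.F0 p I)) ∧
            (∀ τ : ℝ, 0 < τ → ∀ (p : RelBGK.V3) (I : ℝ), 0 < I →
              (G.BGKAt τ S (G.pertST f) t x p I ↔ G.LinAt τ S f t x p I))) ∧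
        ((∀ t ∈ S, G.energy N S f t < ENNReal.ofReal δ) →
          ∀ τ : ℝ, 0 < τ →
          ∀ Finit finit : RelBGK.V3 → RelBGK.V3 → ℝ → ℝ,
            (∀ x p I, 0 < I → Finit x p I = G.F0 p I + finit x p I * Real.sqrt (G.F0 p I)) →
            (G.SolvesBGK τ S (G.pertST f) Finit ↔ G.SolvesLin τ S f finit)) := by
  obtain ⟨ε, hε, hnear⟩ := RelBGK.Gas.eventually_smallness_iff.1 hG.eventually_nearEquilibrium
  -- The division by 64 compensates the constant of the embedding.
  refine ⟨ε / 64, by positivity, fun S _ f hf => ?_⟩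
  have key : ∀ t ∈ S, G.energy N S f t < ENNReal.ofReal (ε / 64) → ∀ x,
      G.NearEquilibrium (f t x) := by
    intro t ht hlt x
    refine hnear _ ((hf.measurable t ht).comp (f := fun z : RelBGK.V3 × ℝ => (x, z.1, z.2))
      (by fun_prop)) ?_
    refine (G.lintegral_enorm_sq_le_energy hN hf ht x).trans_lt ?_
    rw [show ε = 64 * (ε / 64) by ring, ENNReal.ofReal_mul (by norm_num)]
    simp only [ENNReal.ofReal_ofNat]
    exact ENNReal.mul_lt_mul_right (by simp) (by simp) hlt
  refine ⟨fun t ht hlt x => ?_, fun hlt τ hτ Finit finit hinit => ?_⟩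
  · have hE := key t ht hlt x
    exact ⟨hE.wellDefined hG, fun p I _ => hE.modEqOf_sub_F0 hG p I,
      fun τ hτ p I _ => hE.BGKAt_iff_LinAt hG hτ S p I⟩
  · refine and_congr ?_ ?_
    · exact forall₂_congr fun t ht => forall₄_congr fun x p I _ =>
        (key t ht (hlt t ht) x).BGKAt_iff_LinAt hG hτ S p I
    · refine forall₄_congr fun x p I hI => ?_
      rw [hinit x p I hI]
      have hs : G.sF0 p I ≠ 0 := (hG.sF0_pos p I).ne'
      change G.F0 p I + f 0 x p I * G.sF0 p I = G.F0 p I + finit x p I * G.sF0 p I ↔ _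
      rw [add_right_inj, mul_left_inj' hs]
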